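/- Let $k$ be a field, let $Sm/k$ be the category of smooth separated schemes of finite type over $k$ (not necessarily connected), and write $U\times X$ for $U\times_k X$. **The categories $\mathcal A(U,X)$.** For $U,X\in Sm/k$ let $\mathrm{Supp}(U\times X/X)$ be the set of closed subsets $A\subset U\times X$ that are finite unions (possibly empty) of irreducible closed subsets, each of them finite over $U$ (with its reduced structure) and surjective onto an irreducible component of $U$. Let $\mathrm{SubSch}(U\times X/X)$ be the set of closed subschemes $A_m\subset U\times X$ with ideal sheaf $I_A^m$, where $A\in\mathrm{Supp}(U\times X/X)$, $I_A$ is the ideal sheaf of all functions vanishing on $A$, and $m\ge 0$. Write $p_U:Z\to U$ for the projection of a closed subscheme $Z\subset U\times X$. Objects of $\mathcal A(U,X)$ are equivalence classes $\Phi$ of triples $(n,Z,\phi)$ with $n\ge0$, $Z\in\mathrm{SubSch}(U\times X/X)$ and $\phi:p_{U,*}\mathcal O_Z\to M_n(\mathcal O_U)$ a non-unital homomorphism of sheaves of $\mathcal O_U$-algebras; $(n,Z,\phi)$ and $(n',Z',\phi')$ are equivalent if $n=n'$ and there is a triple $(n,Z'',\phi'')$ such that $Z,Z'\subset Z''$ and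 both $\phi$ and $\phi'$ give $\phi''$ after composition with the canonical maps $p_{U,*}\mathcal O_{Z''}\to p_{U,*}\mathcal O_{Z}$ and $p_{U,*}\mathcal O_{Z''}\to p_{U,*}\mathcal O_{Z'}$. Put $P(\phi)=\mathrm{im}(\phi(1))\subset\mathcal O_U^n$, a $p_{U,*}\mathcal O_Z$-module via $\phi$. Morphisms $\Phi\to\Psi$ are the $p_{U,*}\mathcal O_Z$-linear morphisms $P(\phi)\to P(\psi)$ for representatives $(n,Z,\phi)$, $(n',Z,\psi)$ with a common $Z$. For $f:U'\to U$ in $Sm/k$ the pullback $f^*:\mathcal A(U,X)\to\mathcal A(U',X)$ (composition with the graph of $f$) sends the class of $(n,Z,\phi)$ to the class of $(n,Z',\phi')$, where $Z'\in\mathrm{SubSch}(U'\times X/X)$ contains $T=(f\times1)^{-1}(Z)=U'\times_UZ$ and $\phi'$ is the composite of the restriction of functions from $Z'$ to $T$ with the base change $\sum a_i\otimes b_i\mapsto\sum a_i\,f^*(\phi(b_i))$ of $\phi$; a morphism $\alpha$ is sent to the morphism $f^*\alpha$ with $(f^*\alpha)(f^*m)=f^*(\alpha(m))$ for all local sections $m$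 of $P(\phi)$. **Big bimodules.** For $U,Y$ of finite type over $k$ let $\mathcal P(U,Y)$ be the category of coherent $\mathcal O_{U\times Y}$-modules whose support is finite over $U$ and whose direct image on $U$ is locally free. A big bimodule $P\in\tilde{\mathcal P}(X,Y)$ consists of an object $P_{U,Y}\in\mathcal P(U,Y)$ for every scheme $U$ of finite type over $X$, and of a morphism $\sigma_f:P_{U,Y}\to(f\times1_Y)_*P_{U',Y}$ of $\mathcal O_{U\times Y}$-modules for every $X$-morphism $f:U'\to U$, such that $\sigma_1=1$, the adjoint $\tau_f:(f\times1_Y)^*P_{U,Y}\to P_{U',Y}$ of each $\sigma_f$ is an isomorphism, and $\sigma_{f\circ f_1}=(f\times1_Y)_*(\sigma_{f_1})\circ\sigma_f$. Morphisms $P\to Q$ are the $\mathcal O_{X\times Y}$-module morphisms $P_{X,Y}\to Q_{X,Y}$. For $g:X'\to X$ in $Sm/k$ the functor $g^*:\tilde{\mathcal P}(X,Y)\to\tilde{\mathcal P}(X',Y)$ restricts the data $(P_{U,Y},\sigma_f)$ to the schemes over $X'$, viewed over $X$ through $g$, and sends $\alpha$ to $\tau_g\circ(g\times1_Y)^*(\alpha)\circ\tau_g^{-1}$.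 This defines a presheaf $\tilde{\mathcal P}(-,Y)$ on $Sm/k$: one has $1^*=1$ and $(g\circ g_1)^*=g_1^*\circ g^*$ strictly. **Theorem.** Let $Y\in Sm/k$ be affine. For every $X\in Sm/k$ the categories $\mathcal A(X,Y)$ and $\tilde{\mathcal P}(X,Y)$ are additive, the additive pullback functors $f^*$ make $\mathcal A(-,Y)$ a (strict) presheaf of additive categories on $Sm/k$, and there is a morphism of presheaves of additive categories $$F:\mathcal A(-,Y)\to\tilde{\mathcal P}(-,Y),$$ that is, a family of additive functors $F_{X,Y}:\mathcal A(X,Y)\to\tilde{\mathcal P}(X,Y)$, $X\in Sm/k$, with $F_{X',Y}\circ f^*=f^*\circ F_{X,Y}$ (strict equality) for every $f:X'\to X$ in $Sm/k$, such that for every affine $X\in Sm/k$ the functor $F_{X,Y}$ is an equivalence of categories. -/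

import Mathlib

open CategoryTheory Limits AlgebraicGeometry TopologicalSpace

universe u

namespace KCorr

noncomputable section

variable {S : Scheme.{u}}

/-- The fibre product `U ×_S X`. -/
abbrev prod (U X : Over S) : Scheme.{u} := pullback U.hom X.hom

/-- The projection `U ×_S X ⟶ U`. -/
abbrev prodFst (U X : Over S) : prod U X ⟶ U.left := pullback.fst U.hom X.hom

/-- The morphism `f × 1_X : U' ×_S X ⟶ U ×_S X`. -/
def prodMap {U' U : Over S} (f : U' ⟶ U) (X : Over S) : prod U' X ⟶ prod U X :=
  pullback.lift (pullback.fst _ _ ≫ f.left) (pullback.snd _ _) (by simp [pullback.condition])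

/-! ### Supports -/

/-- A closed subset of `U × X` which is irreducible, finite over `U` (with its reduced scheme
structure), and whose image in `U` is an irreducible component of `U`. -/
def IsFiniteSurjective (U X : Over S) (A : Closeds (prod U X)) : Prop :=
  IsIrreducible (A : Set (prod U X)) ∧
    IsFinite ((Scheme.IdealSheafData.vanishingIdeal A).subschemeι ≫ prodFst U X) ∧
    prodFst U X '' (A : Set (prod U X)) ∈ irreducibleComponents U.left

/-- `Supp(U × X / X)`: finite unions of irreducible closed subsets of `U × X` that are finite and
surjective over a component of `U`; the empty set is included. -/
def Supp (U X : Over S) : Set (Closeds (prod U X)) :=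
  {A | ∃ s : Set (Closeds (prod U X)), s.Finite ∧ (∀ B ∈ s, IsFiniteSurjective U X B) ∧
    A = sSup s}

/-- `SubSch(U × X / X)`: the closed subschemes `A_m` of `U × X`, given by their ideal sheaves
`I_A ^ m`. -/
def SubSch (U X : Over S) : Set (prod U X).IdealSheafData :=
  {Z | ∃ A ∈ Supp U X, ∃ m : ℕ, Z = Scheme.IdealSheafData.vanishingIdeal A ^ m}

lemma SubSch.directed {U X : Over S} {Z Z' : (prod U X).IdealSheafData}
    (hZ : Z ∈ SubSch U X) (hZ' : Z' ∈ SubSch U X) : ∃ W ∈ SubSch U X, W ≤ Z ∧ W ≤ Z' := by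
  obtain ⟨A, ⟨s, hs, hsA, rfl⟩, m, rfl⟩ := hZ
  obtain ⟨B, ⟨t, ht, htB, rfl⟩, l, rfl⟩ := hZ'
  refine ⟨_, ⟨sSup (s ∪ t), ⟨s ∪ t, hs.union ht, ?_, rfl⟩, m + l, rfl⟩, ?_, ?_⟩
  · rintro C (h | h)
    exacts [hsA C h, htB C h]
  · refine le_trans ?_ (pow_le_pow_left₀ bot_le
      (Scheme.IdealSheafData.vanishingIdeal_antimono (sSup_le_sSup (Set.subset_union_left (t := t)))) m)
    intro V
    exact Ideal.pow_le_pow_right (Nat.le_add_right m l)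
  · refine le_trans ?_ (pow_le_pow_left₀ bot_le
      (Scheme.IdealSheafData.vanishingIdeal_antimono (sSup_le_sSup (Set.subset_union_right (s := s)))) l)
    intro V
    exact Ideal.pow_le_pow_right (Nat.le_add_left l m)

lemma SubSch.nonempty (U X : Over S) : (SubSch U X).Nonempty :=
  ⟨_, ⊥, ⟨∅, Set.finite_empty, by simp, by simp⟩, 0, rfl⟩

/-! ### Objects of `𝒜(U, X)` -/

section Objects

variable {U X : Over S}

/-- The projection `p_U : Z ⟶ U` of a closed subscheme `Z` of `U × X`. -/
abbrev proj (Z : (prod U X).IdealSheafData) : Z.subscheme ⟶ U.left :=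
  Z.subschemeι ≫ prodFst U X

/-- Sections of `p_{U,*} 𝒪_Z` over `V`. -/
abbrev secs (Z : (prod U X).IdealSheafData) (V : U.left.Opens) : CommRingCat.{u} :=
  Γ(Z.subscheme, proj Z ⁻¹ᵁ V)

/-- Restriction of sections of `p_{U,*} 𝒪_Z`. -/
abbrev secsRes (Z : (prod U X).IdealSheafData) {V' V : U.left.Opens} (h : V' ≤ V) :
    secs Z V ⟶ secs Z V' :=
  Z.subscheme.presheaf.map (homOfLE ((proj Z).preimage_mono h)).op

/-- Restriction of functions on `U`. -/
abbrev res {V' V : U.left.Opens} (h : V' ≤ V) : Γ(U.left, V) ⟶ Γ(U.left, V') :=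
  U.left.presheaf.map (homOfLE h).op

/-- The canonical map `p_{U,*} 𝒪_{Z'} ⟶ p_{U,*} 𝒪_Z` for closed subschemes `Z ⊆ Z'`. -/
def can {Z Z' : (prod U X).IdealSheafData} (h : Z' ≤ Z) (V : U.left.Opens) :
    secs Z' V ⟶ secs Z V :=
  (Scheme.IdealSheafData.inclusion h).appLE _ _ (by
    rw [← Scheme.Hom.comp_preimage, Scheme.IdealSheafData.inclusion_subschemeι_assoc])

lemma can_self {Z : (prod U X).IdealSheafData} (V : U.left.Opens) (z : secs Z V) :
    can (le_refl Z) V z = z := by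
  have : can (le_refl Z) V = 𝟙 _ := by
    simp only [can, Scheme.IdealSheafData.inclusion_id]
    exact (Scheme.Hom.appLE_eq_app _).trans (Scheme.Hom.id_app _)
  exact congr($this z)

lemma can_comp {Z Z' Z'' : (prod U X).IdealSheafData} (h : Z' ≤ Z) (h' : Z'' ≤ Z')
    (V : U.left.Opens) (z : secs Z'' V) : can h V (can h' V z) = can (h'.trans h) V z := by
  have : can h' V ≫ can h V = can (h'.trans h) V := by
    simp only [can, Scheme.Hom.appLE_comp_appLE, Scheme.IdealSheafData.inclusion_comp]
  exact congr($this z)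

lemma can_proj {Z Z' : (prod U X).IdealSheafData} (h : Z' ≤ Z) (V : U.left.Opens)
    (a : Γ(U.left, V)) : can h V ((proj Z').app V a) = (proj Z).app V a := by
  have : (proj Z').app V ≫ can h V = (proj Z).app V := by
    simp only [can, Scheme.Hom.app_eq_appLE, Scheme.Hom.appLE_comp_appLE,
      Scheme.IdealSheafData.inclusion_subschemeι_assoc]
  exact congr($this a)

lemma can_res {Z Z' : (prod U X).IdealSheafData} (h : Z' ≤ Z) {V' V : U.left.Opens} (hV : V' ≤ V)
    (z : secs Z' V) : can h V' (secsRes Z' hV z) = secsRes Z hV (can h V z) := by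
  have : secsRes Z' hV ≫ can h V' = can h V ≫ secsRes Z hV := by
    simp only [can, secsRes, Scheme.Hom.map_appLE, Scheme.Hom.appLE_map]
  exact congr($this z)

/-- A non-unital homomorphism `p_{U,*} 𝒪_Z ⟶ M_n(𝒪_U)` of sheaves of `𝒪_U`-algebras. -/
@[ext]
structure AlgHomOver (Z : (prod U X).IdealSheafData) (n : ℕ) where
  /-- the homomorphism on sections over `V` -/
  app (V : U.left.Opens) : secs Z V →ₙ+* Matrix (Fin n) (Fin n) Γ(U.left, V)
  map_smul (V : U.left.Opens) (a : Γ(U.left, V)) (z : secs Z V) :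
    app V ((proj Z).app V a * z) = a • app V z
  naturality {V' V : U.left.Opens} (h : V' ≤ V) (z : secs Z V) :
    app V' (secsRes Z h z) = (app V z).map (res h)

/-- The composite of `φ` with the canonical map, for a larger closed subscheme. -/
def AlgHomOver.extend {Z Z' : (prod U X).IdealSheafData} {n : ℕ} (φ : AlgHomOver Z n)
    (h : Z' ≤ Z) : AlgHomOver Z' n where
  app V := (φ.app V).comp (can h V).hom.toNonUnitalRingHom
  map_smul V a z := by
    change φ.app V (can h V _) = a • φ.app V (can h V z)
    rw [map_mul, can_proj, φ.map_smul]
  naturality {V' V} hV z := by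
    change φ.app V' (can h V' _) = (φ.app V (can h V z)).map _
    rw [can_res, φ.naturality]

lemma AlgHomOver.extend_app {Z Z' : (prod U X).IdealSheafData} {n : ℕ} (φ : AlgHomOver Z n)
    (h : Z' ≤ Z) (V : U.left.Opens) (z : secs Z' V) :
    (φ.extend h).app V z = φ.app V (can h V z) := rfl

lemma AlgHomOver.extend_extend {Z Z' Z'' : (prod U X).IdealSheafData} {n : ℕ}
    (φ : AlgHomOver Z n) (h : Z' ≤ Z) (h' : Z'' ≤ Z') :
    (φ.extend h).extend h' = φ.extend (h'.trans h) := by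
  ext V z
  simp only [extend_app, can_comp]

end Objects

variable (U X : Over S)

/-- The triples `(n, Z, φ)` with a fixed `n`. -/
structure Triple (n : ℕ) where
  /-- the closed subscheme -/
  Z : (prod U X).IdealSheafData
  mem : Z ∈ SubSch U X
  /-- the non-unital homomorphism -/
  φ : AlgHomOver Z n

variable {U X}

/-- Two triples are equivalent if they become equal on a common larger closed subscheme. -/
def Triple.Rel {n : ℕ} (T T' : Triple U X n) : Prop :=
  ∃ T'' : Triple U X n, ∃ (h : T''.Z ≤ T.Z) (h' : T''.Z ≤ T'.Z),
    T''.φ = T.φ.extend h ∧ T''.φ = T'.φ.extend h'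

instance tripleSetoid (n : ℕ) : Setoid (Triple U X n) where
  r := Triple.Rel
  iseqv :=
    { refl T := ⟨T, le_rfl, le_rfl, by
        ext V z
        rw [AlgHomOver.extend_app, can_self], by
        ext V z
        rw [AlgHomOver.extend_app, can_self]⟩
      symm := fun ⟨T, h, h', e, e'⟩ ↦ ⟨T, h', h, e', e⟩
      trans := by
        rintro T₁ T₂ T₃ ⟨T, h₁, h₂, e₁, e₂⟩ ⟨T', h₂', h₃', e₂', e₃'⟩
        obtain ⟨W, hW, hT, hT'⟩ := SubSch.directed T.mem T'.mem
        refine ⟨⟨W, hW, T₂.φ.extend (hT.trans h₂)⟩, hT.trans h₁, hT'.trans h₃', ?_, ?_⟩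
        · dsimp only
          rw [← AlgHomOver.extend_extend _ h₂ hT, ← e₂, e₁, AlgHomOver.extend_extend]
        · dsimp only
          rw [← AlgHomOver.extend_extend _ h₂' hT', ← e₂', e₃', AlgHomOver.extend_extend] }

variable (U X) in
/-- The objects of `𝒜(U, X)`: equivalence classes of triples `(n, Z, φ)`. -/
structure Corr where
  /-- the size of the matrices -/
  n : ℕ
  /-- the equivalence class -/
  cls : Quotient (tripleSetoid (U := U) (X := X) n)

/-- The idempotent `p(φ) = φ(1)`, on sections over `V`. -/
def Corr.idem (Φ : Corr U X) (V : U.left.Opens) : Matrix (Fin Φ.n) (Fin Φ.n) Γ(U.left, V) :=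
  Quotient.lift (fun T : Triple U X Φ.n ↦ T.φ.app V 1) (by
    rintro T T' ⟨T'', h, h', e, e'⟩
    have h₁ := congr(($e).app V 1)
    rw [e', AlgHomOver.extend_app, AlgHomOver.extend_app, map_one (can h V).hom,
      map_one (can h' V).hom] at h₁
    exact h₁.symm) Φ.cls

/-- The sections over `V` of the `𝒪_U`-module `P(φ) = im p(φ) ⊆ 𝒪_U ^ n`. -/
def Corr.P (Φ : Corr U X) (V : U.left.Opens) : Submodule Γ(U.left, V) (Fin Φ.n → Γ(U.left, V)) :=
  LinearMap.range (Φ.idem V).mulVecLin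

/-- `Φ.Represents φ`: the object `Φ` is the class of the triple `(n, Z, φ)`. -/
def Corr.Represents (Φ : Corr U X) {Z : (prod U X).IdealSheafData} (hZ : Z ∈ SubSch U X)
    (φ : AlgHomOver Z Φ.n) : Prop :=
  Φ.cls = Quotient.mk _ ⟨Z, hZ, φ⟩

lemma Corr.exists_represents (Φ : Corr U X) :
    ∃ (Z : _) (hZ : Z ∈ SubSch U X) (φ : AlgHomOver Z Φ.n), Φ.Represents hZ φ := by
  obtain ⟨⟨Z, hZ, φ⟩, h⟩ := Quotient.exists_rep Φ.cls
  exact ⟨Z, hZ, φ, h.symm⟩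

lemma Corr.Represents.extend {Φ : Corr U X} {Z Z' : (prod U X).IdealSheafData}
    {hZ : Z ∈ SubSch U X} {φ : AlgHomOver Z Φ.n} (h : Φ.Represents hZ φ)
    (hZ' : Z' ∈ SubSch U X) (hle : Z' ≤ Z) : Φ.Represents hZ' (φ.extend hle) := by
  refine h.trans (Quotient.sound ⟨⟨Z', hZ', φ.extend hle⟩, hle, le_rfl, rfl, ?_⟩)
  rw [AlgHomOver.extend_extend]

lemma Corr.Represents.exists_eq {Φ : Corr U X} {Z Z' : (prod U X).IdealSheafData}
    {hZ : Z ∈ SubSch U X} {φ : AlgHomOver Z Φ.n} (h : Φ.Represents hZ φ)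
    {hZ' : Z' ∈ SubSch U X} {φ' : AlgHomOver Z' Φ.n} (h' : Φ.Represents hZ' φ') :
    ∃ W ∈ SubSch U X, ∃ (hW : W ≤ Z) (hW' : W ≤ Z'), φ.extend hW = φ'.extend hW' := by
  obtain ⟨T, h₁, h₂, e₁, e₂⟩ := Quotient.exact (h.symm.trans h')
  exact ⟨T.Z, T.mem, h₁, h₂, e₁.symm.trans e₂⟩

/-! ### Morphisms of `𝒜(U, X)` -/

/-- Families of linear maps `P(Φ)(V) ⟶ P(Ψ)(V)`. -/
abbrev PreHom (Φ Ψ : Corr U X) : Type u :=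
  ∀ V : U.left.Opens, Φ.P V →ₗ[Γ(U.left, V)] Ψ.P V

/-- The family is compatible with restrictions, that is, it is a morphism of `𝒪_U`-modules. -/
def PreHom.IsNatural {Φ Ψ : Corr U X} (α : PreHom Φ Ψ) : Prop :=
  ∀ {V' V : U.left.Opens} (h : V' ≤ V) (x : Φ.P V) (x' : Φ.P V'),
    (∀ i, x'.1 i = res h (x.1 i)) → ∀ j, (α V' x').1 j = res h ((α V x).1 j)

/-- The family commutes with the actions of `p_{U,*} 𝒪_Z` through `φ` and `ψ`. -/
def PreHom.IsLinearOver {Φ Ψ : Corr U X} (α : PreHom Φ Ψ) {Z : (prod U X).IdealSheafData}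
    (φ : AlgHomOver Z Φ.n) (ψ : AlgHomOver Z Ψ.n) : Prop :=
  ∀ (V : U.left.Opens) (z : secs Z V) (x x' : Φ.P V), x'.1 = (φ.app V z).mulVec x.1 →
    (α V x').1 = (ψ.app V z).mulVec (α V x).1

lemma PreHom.IsLinearOver.extend {Φ Ψ : Corr U X} {α : PreHom Φ Ψ}
    {Z Z' : (prod U X).IdealSheafData} {φ : AlgHomOver Z Φ.n} {ψ : AlgHomOver Z Ψ.n}
    (h : α.IsLinearOver φ ψ) (hle : Z' ≤ Z) : α.IsLinearOver (φ.extend hle) (ψ.extend hle) :=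
  fun V z x x' e ↦ h V (can hle V z) x x' e

/-- After equalizing the supports of `Φ` and `Ψ`, the family is `p_{U,*} 𝒪_Z`-linear. -/
def PreHom.IsSupportLinear {Φ Ψ : Corr U X} (α : PreHom Φ Ψ) : Prop :=
  ∃ (Z : _) (hZ : Z ∈ SubSch U X) (φ : AlgHomOver Z Φ.n) (ψ : AlgHomOver Z Ψ.n),
    Φ.Represents hZ φ ∧ Ψ.Represents hZ ψ ∧ α.IsLinearOver φ ψ

/-- Two support-linear families `Φ ⟶ Ψ` are linear over a common support. -/
lemma PreHom.IsSupportLinear.common {Φ Ψ : Corr U X} {α β : PreHom Φ Ψ} (hα : α.IsSupportLinear)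
    (hβ : β.IsSupportLinear) :
    ∃ (Z : _) (hZ : Z ∈ SubSch U X) (φ : AlgHomOver Z Φ.n) (ψ : AlgHomOver Z Ψ.n),
      Φ.Represents hZ φ ∧ Ψ.Represents hZ ψ ∧ α.IsLinearOver φ ψ ∧ β.IsLinearOver φ ψ := by
  obtain ⟨Z₁, hZ₁, φ₁, ψ₁, hφ₁, hψ₁, h₁⟩ := hα
  obtain ⟨Z₂, hZ₂, φ₂, ψ₂, hφ₂, hψ₂, h₂⟩ := hβ
  obtain ⟨W, hW, a₁, a₂, ea⟩ := hφ₁.exists_eq hφ₂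
  obtain ⟨W', hW', b₁, b₂, eb⟩ := hψ₁.exists_eq hψ₂
  obtain ⟨Z, hZ, c, c'⟩ := SubSch.directed hW hW'
  refine ⟨Z, hZ, φ₁.extend (c.trans a₁), ψ₁.extend (c.trans a₁), hφ₁.extend hZ _,
    hψ₁.extend hZ _, h₁.extend _, ?_⟩
  rw [← φ₁.extend_extend a₁ c, ea, φ₂.extend_extend, ← ψ₁.extend_extend b₁ c', eb,
    ψ₂.extend_extend]
  exact h₂.extend _

lemma PreHom.isSupportLinear_id (Φ : Corr U X) :
    PreHom.IsSupportLinear (Φ := Φ) (Ψ := Φ) fun _ ↦ LinearMap.id := by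
  obtain ⟨Z, hZ, φ, h⟩ := Φ.exists_represents
  exact ⟨Z, hZ, φ, φ, h, h, fun V z x x' e ↦ e⟩

lemma PreHom.IsSupportLinear.comp {Φ Ψ Ω : Corr U X} {α : PreHom Φ Ψ} {β : PreHom Ψ Ω}
    (hα : α.IsSupportLinear) (hβ : β.IsSupportLinear) :
    PreHom.IsSupportLinear (Φ := Φ) (Ψ := Ω) fun V ↦ (β V).comp (α V) := by
  obtain ⟨Z₁, hZ₁, φ₁, ψ₁, hφ₁, hψ₁, h₁⟩ := hα
  obtain ⟨Z₂, hZ₂, ψ₂, ω₂, hψ₂, hω₂, h₂⟩ := hβ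
  obtain ⟨Z, hZ, a₁, a₂, ea⟩ := hψ₁.exists_eq hψ₂
  refine ⟨Z, hZ, φ₁.extend a₁, ω₂.extend a₂, hφ₁.extend hZ _, hω₂.extend hZ _, ?_⟩
  intro V z x x' e
  refine h₂.extend a₂ V z _ _ ?_
  rw [← ea]
  exact h₁.extend a₁ V z _ _ e

/-- `Hom_{𝒜(U, X)}(Φ, Ψ)`, the group of `p_{U,*} 𝒪_Z`-linear morphisms `P(φ) ⟶ P(ψ)`. -/
def homGroup (Φ Ψ : Corr U X) : AddSubgroup (PreHom Φ Ψ) where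
  carrier := {α | α.IsNatural ∧ α.IsSupportLinear}
  zero_mem' := by
    refine ⟨fun h x x' _ j ↦ by simp, ?_⟩
    obtain ⟨Z₁, hZ₁, φ, hφ⟩ := Φ.exists_represents
    obtain ⟨Z₂, hZ₂, ψ, hψ⟩ := Ψ.exists_represents
    obtain ⟨Z, hZ, a, b⟩ := SubSch.directed hZ₁ hZ₂
    exact ⟨Z, hZ, φ.extend a, ψ.extend b, hφ.extend hZ _, hψ.extend hZ _, fun V z x x' _ ↦ by simp⟩
  add_mem' {α β} hα hβ := by
    refine ⟨fun h x x' e j ↦ ?_, ?_⟩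
    · simp [hα.1 h x x' e j, hβ.1 h x x' e j]
    · obtain ⟨Z, hZ, φ, ψ, hφ, hψ, h₁, h₂⟩ := hα.2.common hβ.2
      refine ⟨Z, hZ, φ, ψ, hφ, hψ, fun V z x x' e ↦ ?_⟩
      simp [h₁ V z x x' e, h₂ V z x x' e, Matrix.mulVec_add]
  neg_mem' {α} hα := by
    refine ⟨fun h x x' e j ↦ ?_, ?_⟩
    · simp [hα.1 h x x' e j]
    · obtain ⟨Z, hZ, φ, ψ, hφ, hψ, h₁⟩ := hα.2
      refine ⟨Z, hZ, φ, ψ, hφ, hψ, fun V z x x' e ↦ ?_⟩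
      simp [h₁ V z x x' e, Matrix.mulVec_neg]

/-- The category `𝒜(U, X)`. -/
instance : Category (Corr U X) where
  Hom Φ Ψ := homGroup Φ Ψ
  id Φ := ⟨fun _ ↦ LinearMap.id, fun _ _ _ e j ↦ e j, PreHom.isSupportLinear_id Φ⟩
  comp α β := ⟨fun V ↦ (β.1 V).comp (α.1 V),
    fun h x x' e j ↦ β.2.1 h _ _ (fun i ↦ α.2.1 h x x' e i) j, α.2.2.comp β.2.2⟩

instance : Preadditive (Corr U X) where
  homGroup Φ Ψ := inferInstanceAs (AddCommGroup (homGroup Φ Ψ))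
  add_comp _ _ _ _ _ _ := Subtype.ext (funext fun _ ↦ LinearMap.comp_add _ _ _)
  comp_add _ _ _ _ _ _ := Subtype.ext (funext fun _ ↦ LinearMap.add_comp _ _ _)

/-- The action of a morphism of `𝒜(U, X)` on sections over `V`. -/
def Corr.homApp {Φ Ψ : Corr U X} (α : Φ ⟶ Ψ) (V : U.left.Opens) :
    Φ.P V →ₗ[Γ(U.left, V)] Ψ.P V :=
  Subtype.val (p := (· ∈ homGroup Φ Ψ)) α V

/-! ### The functors `f^* : 𝒜(U, X) ⥤ 𝒜(U', X)` -/

variable {U' : Over S}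

/-- `T` is `Z ×_U U'`, viewed as closed subscheme `(f × 1)⁻¹(Z)` of `U' × X`. -/
abbrev baseChange (f : U' ⟶ U) (Z : (prod U X).IdealSheafData) : (prod U' X).IdealSheafData :=
  Z.comap (prodMap f X)

/-- Pullback of sections along the projection `Z ×_U U' ⟶ Z`. -/
def pullSecs (f : U' ⟶ U) (Z : (prod U X).IdealSheafData) (V : U.left.Opens)
    (V' : U'.left.Opens) (h : V' ≤ f.left ⁻¹ᵁ V) : secs Z V ⟶ secs (baseChange f Z) V' :=
  (Scheme.IdealSheafData.subschemeMap (baseChange f Z) Z (prodMap f X)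
    (Z.le_map_comap _)).appLE _ _ (by
      rw [← Scheme.Hom.comp_preimage, Scheme.IdealSheafData.subschemeMap_subschemeι_assoc,
        prodMap, pullback.lift_fst, ← Category.assoc, Scheme.Hom.comp_preimage _ f.left]
      exact Scheme.Hom.preimage_mono _ h)

/-- `φ' : p_{U',*} 𝒪_{Z'} ⟶ M_n(𝒪_{U'})` is the composite of the restriction
`p_{U',*} 𝒪_{Z'} ⟶ q_* 𝒪_T` to the closed subscheme `T = Z ×_U U'` of `Z'` with the base change
`q_* 𝒪_T ⟶ M_n(𝒪_{U'})`, `∑ aᵢ ⊗ bᵢ ↦ ∑ aᵢ f^*(φ(bᵢ))`, of `φ` along `f : U' ⟶ U`. -/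
def AlgHomOver.IsBaseChange (f : U' ⟶ U) {n : ℕ} {Z : (prod U X).IdealSheafData}
    (φ : AlgHomOver Z n) {Z' : (prod U' X).IdealSheafData} (φ' : AlgHomOver Z' n) : Prop :=
  ∃ hT : Z' ≤ baseChange f Z,
    ∀ (V : U.left.Opens) (V' : U'.left.Opens) (hV : V' ≤ f.left ⁻¹ᵁ V) (r : ℕ)
      (a : Fin r → Γ(U'.left, V')) (b : Fin r → secs Z V) (c : secs Z' V'),
      can hT V' c = ∑ i, (proj (baseChange f Z)).app V' (a i) * pullSecs f Z V V' hV (b i) →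
      φ'.app V' c = ∑ i, a i • (φ.app V (b i)).map (f.left.appLE V V' hV)

/-- `Φ' = f^* Φ`, the composite of `Φ` with the graph of `f`. -/
def IsPullbackObj (f : U' ⟶ U) (Φ : Corr U X) (Φ' : Corr U' X) : Prop :=
  ∃ (n : ℕ) (Z : _) (hZ : Z ∈ SubSch U X) (φ : AlgHomOver Z n)
    (Z' : _) (hZ' : Z' ∈ SubSch U' X) (φ' : AlgHomOver Z' n),
    φ.IsBaseChange f φ' ∧ Φ = ⟨n, Quotient.mk _ ⟨Z, hZ, φ⟩⟩ ∧
      Φ' = ⟨n, Quotient.mk _ ⟨Z', hZ', φ'⟩⟩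

/-- `α' = f^* α`: one has `α'(f^* m) = f^*(α(m))` for all local sections `m` of `P(Φ)`. -/
def IsPullbackHom (f : U' ⟶ U) {Φ Ψ : Corr U X} {Φ' Ψ' : Corr U' X} (α : Φ ⟶ Ψ)
    (α' : Φ' ⟶ Ψ') : Prop :=
  ∀ (V : U.left.Opens) (V' : U'.left.Opens) (hV : V' ≤ f.left ⁻¹ᵁ V) (m : Φ.P V) (m' : Φ'.P V'),
    (∀ i i', i'.val = i.val → m'.1 i' = f.left.appLE V V' hV (m.1 i)) →
    ∀ j j', j'.val = j.val →
      (Corr.homApp α' V' m').1 j' = f.left.appLE V V' hV ((Corr.homApp α V m).1 j)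

/-- `G` is the functor `f^* : 𝒜(U, X) ⥤ 𝒜(U', X)`. -/
structure IsPullbackFunctor (f : U' ⟶ U) (G : Corr U X ⥤ Corr U' X) : Prop where
  obj (Φ : Corr U X) : IsPullbackObj f Φ (G.obj Φ)
  map {Φ Ψ : Corr U X} (α : Φ ⟶ Ψ) : IsPullbackHom f α (G.map α)

/-! ### The category `𝒫(U, Y)` -/

lemma prodMap_id (U Y : Over S) : prodMap (𝟙 U) Y = 𝟙 (prod U Y) := by
  apply pullback.hom_ext <;> simp [prodMap]

lemma prodMap_comp {U'' U' U : Over S} (f₁ : U'' ⟶ U') (f : U' ⟶ U) (Y : Over S) :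
    prodMap (f₁ ≫ f) Y = prodMap f₁ Y ≫ prodMap f Y := by
  apply pullback.hom_ext
  · simp only [prodMap, pullback.lift_fst, Category.assoc, pullback.lift_fst_assoc, Over.comp_left]
  · simp only [prodMap, pullback.lift_snd, Category.assoc]

/-- The closure of the support of a sheaf of modules (the support of a coherent sheaf is
closed). -/
def suppClosure {X : Scheme.{u}} (M : X.Modules) : Closeds X :=
  ⟨closure {x | Nontrivial (M.presheaf.stalk x)}, isClosed_closure⟩

/-- `M` is an object of `𝒫(U, Y)`: a coherent `𝒪_{U × Y}`-module (on a locally noetherian scheme,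
quasi-coherent of finite type) whose support is finite over `U` and whose direct image on `U` is
locally free. -/
structure IsBimodule (U Y : Over S) (M : (prod U Y).Modules) : Prop where
  isQuasicoherent : M.IsQuasicoherent
  isFiniteType : M.IsFiniteType
  isFinite_supp :
    IsFinite ((Scheme.IdealSheafData.vanishingIdeal (suppClosure M)).subschemeι ≫ prodFst U Y)
  isLocallyFree :
    ((Scheme.Modules.pushforward (prodFst U Y)).obj M).IsLocallyFree

/-! ### Big bimodules -/

/-- Schemes of finite type over `X`. -/
structure Sch (X : Over S) where
  /-- the underlying `S`-scheme -/
  left : Over S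
  /-- the structure morphism -/
  hom : left ⟶ X
  locallyOfFiniteType : LocallyOfFiniteType hom.left
  quasiCompact : QuasiCompact hom.left

/-- `X` as a scheme over itself. -/
abbrev Sch.self (X : Over S) : Sch X where
  left := X
  hom := 𝟙 X
  locallyOfFiniteType := by rw [Over.id_left]; infer_instance
  quasiCompact := by rw [Over.id_left]; infer_instance

/-- A scheme over `X'` viewed as a scheme over `X`. -/
abbrev Sch.map {X' X : Over S} (g : X' ⟶ X) [LocallyOfFiniteType g.left] [QuasiCompact g.left]
    (U : Sch X') : Sch X where
  left := U.left
  hom := U.hom ≫ g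
  locallyOfFiniteType := by
    have := U.locallyOfFiniteType
    rw [Over.comp_left]; infer_instance
  quasiCompact := by
    have := U.quasiCompact
    rw [Over.comp_left]; infer_instance

open Scheme.Modules in
/-- Big bimodules, the objects of `𝒫̃(X, Y)`. -/
structure BigBimodule (X Y : Over S) where
  /-- the bimodule `P_{U, Y}` -/
  obj (U : Sch X) : (prod U.left Y).Modules
  isBimodule (U : Sch X) : IsBimodule U.left Y (obj U)
  /-- the morphism `σ_f : P_{U, Y} ⟶ (f × 1_Y)_* P_{U', Y}` -/
  σ {U' U : Sch X} (f : U'.left ⟶ U.left) (w : f ≫ U.hom = U'.hom) :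
    obj U ⟶ (pushforward (prodMap f Y)).obj (obj U')
  /-- `σ_1 = 1` -/
  σ_id (U : Sch X) : σ (𝟙 U.left) (Category.id_comp U.hom) ≫
    (pushforwardCongr (prodMap_id U.left Y)).hom.app (obj U) ≫ (pushforwardId _).hom.app (obj U) =
      𝟙 (obj U)
  /-- the adjoint morphism `τ_f : (f × 1_Y)^* P_{U, Y} ⟶ P_{U', Y}` is an isomorphism -/
  isIso_τ {U' U : Sch X} (f : U'.left ⟶ U.left) (w : f ≫ U.hom = U'.hom) :
    IsIso (((pullbackPushforwardAdjunction (prodMap f Y)).homEquiv _ _).symm (σ f w))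
  /-- `σ_{f ∘ f₁} = (f × 1_Y)_*(σ_{f₁}) ∘ σ_f` -/
  σ_comp {U'' U' U : Sch X} (f₁ : U''.left ⟶ U'.left) (w₁ : f₁ ≫ U'.hom = U''.hom)
    (f : U'.left ⟶ U.left) (w : f ≫ U.hom = U'.hom) (h : U''.left ⟶ U.left) (e : f₁ ≫ f = h) :
    σ h (by rw [← e, Category.assoc, w, w₁]) =
      σ f w ≫ (pushforward (prodMap f Y)).map (σ f₁ w₁) ≫
        (pushforwardComp (prodMap f₁ Y) (prodMap f Y)).hom.app (obj U'') ≫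
        (pushforwardCongr (by rw [← e, prodMap_comp])).hom.app (obj U'')

namespace BigBimodule

open Scheme.Modules

variable {X Y : Over S}

/-- A morphism `P ⟶ Q` of big bimodules is a morphism `P_{X, Y} ⟶ Q_{X, Y}`. -/
instance : Category (BigBimodule X Y) where
  Hom P Q := P.obj (Sch.self X) ⟶ Q.obj (Sch.self X)
  id P := 𝟙 (P.obj (Sch.self X))
  comp α β := CategoryStruct.comp (obj := (prod X Y).Modules) α β
  id_comp _ := Category.id_comp (obj := (prod X Y).Modules) _
  comp_id _ := Category.comp_id (obj := (prod X Y).Modules) _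
  assoc _ _ _ := Category.assoc (obj := (prod X Y).Modules) _ _ _

instance : Preadditive (BigBimodule X Y) where
  homGroup P Q := inferInstanceAs (AddCommGroup (P.obj (Sch.self X) ⟶ Q.obj (Sch.self X)))
  add_comp _ _ _ _ _ _ := Preadditive.add_comp (C := (prod X Y).Modules) _ _ _ _ _ _
  comp_add _ _ _ _ _ _ := Preadditive.comp_add (C := (prod X Y).Modules) _ _ _ _ _ _

/-- The component `P_{X, Y} ⟶ Q_{X, Y}`. -/
def homSelf {P Q : BigBimodule X Y} (α : P ⟶ Q) : P.obj (Sch.self X) ⟶ Q.obj (Sch.self X) := α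

/-- The isomorphism `τ_f : (f × 1_Y)^* P_{X, Y} ⟶ P_{U, Y}` for `f : U ⟶ X`. -/
def τ (P : BigBimodule X Y) (U : Sch X) :
    (Scheme.Modules.pullback (prodMap U.hom Y)).obj (P.obj (Sch.self X)) ⟶ P.obj U :=
  ((pullbackPushforwardAdjunction (prodMap U.hom Y)).homEquiv _ _).symm
    (P.σ (U := Sch.self X) U.hom (Category.comp_id _))

instance (P : BigBimodule X Y) (U : Sch X) : IsIso (P.τ U) :=
  P.isIso_τ (U := Sch.self X) U.hom (Category.comp_id _)

/-- The morphism `α_{U, Y} : P_{U, Y} ⟶ Q_{U, Y}` induced by `α_{X, Y}` for `U` over `X`. -/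
def homAt {P Q : BigBimodule X Y} (α : P ⟶ Q) (U : Sch X) : P.obj U ⟶ Q.obj U :=
  inv (P.τ U) ≫ (Scheme.Modules.pullback (prodMap U.hom Y)).map (homSelf α) ≫ Q.τ U

/-- The functor `g^* : 𝒫̃(X, Y) ⥤ 𝒫̃(X', Y)`. -/
def pull {X' : Over S} (g : X' ⟶ X) [LocallyOfFiniteType g.left] [QuasiCompact g.left]
    (Y : Over S) : BigBimodule X Y ⥤ BigBimodule X' Y where
  obj P :=
    { obj U := P.obj (U.map g)
      isBimodule U := P.isBimodule (U.map g)
      σ {U' U} f w := P.σ (U' := U'.map g) (U := U.map g) f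
        (by
        change f ≫ U.hom ≫ g = U'.hom ≫ g
        rw [← w, Category.assoc])
      σ_id U := P.σ_id (U.map g)
      isIso_τ {U' U} f w := P.isIso_τ (U' := U'.map g) (U := U.map g) f _
      σ_comp {U'' U' U} f₁ w₁ f w h e :=
        P.σ_comp (U'' := U''.map g) (U' := U'.map g) (U := U.map g) f₁ _ f _ h e }
  map α := homAt α ((Sch.self X').map g)
  map_id P := by
    change inv (P.τ _) ≫ (Scheme.Modules.pullback _).map (𝟙 (P.obj (Sch.self X))) ≫ P.τ _ = 𝟙 (P.obj _)
    rw [CategoryTheory.Functor.map_id, Category.id_comp, IsIso.inv_hom_id]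
  map_comp {P Q R} α β := by
    change inv (P.τ _) ≫ (Scheme.Modules.pullback _).map (homSelf α ≫ homSelf β) ≫ R.τ _ =
      (inv (P.τ _) ≫ (Scheme.Modules.pullback _).map (homSelf α) ≫ Q.τ _) ≫
        (inv (Q.τ _) ≫ (Scheme.Modules.pullback _).map (homSelf β) ≫ R.τ _)
    simp

lemma σ_injective (P : BigBimodule X Y) (U : Sch X) {M : (prod U.left Y).Modules}
    {β β' : P.obj U ⟶ M}
    (h : P.σ (U := Sch.self X) U.hom (Category.comp_id _) ≫
        (pushforward (prodMap U.hom Y)).map β =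
      P.σ (U := Sch.self X) U.hom (Category.comp_id _) ≫
        (pushforward (prodMap U.hom Y)).map β') : β = β' := by
  rw [← cancel_epi (P.τ U)]
  apply ((pullbackPushforwardAdjunction (prodMap U.hom Y)).homEquiv _ _).injective
  simpa [τ, Adjunction.homEquiv_naturality_right] using h

lemma σ_homAt {P Q : BigBimodule X Y} (α : P ⟶ Q) (U : Sch X) :
    P.σ (U := Sch.self X) U.hom (Category.comp_id _) ≫
        (pushforward (prodMap U.hom Y)).map (homAt α U) =
      homSelf α ≫ Q.σ (U := Sch.self X) U.hom (Category.comp_id _) := by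
  have h : P.τ U ≫ homAt α U = (Scheme.Modules.pullback (prodMap U.hom Y)).map (homSelf α) ≫ Q.τ U := by
    simp [homAt]
  have h' := congr((pullbackPushforwardAdjunction (prodMap U.hom Y)).homEquiv _ _ $h)
  rw [Adjunction.homEquiv_naturality_right, Adjunction.homEquiv_naturality_left] at h'
  simpa only [τ, Equiv.apply_symm_apply] using h'

lemma homAt_naturality {P Q : BigBimodule X Y} (α : P ⟶ Q) {U' U : Sch X} (f : U'.left ⟶ U.left)
    (w : f ≫ U.hom = U'.hom) :
    P.σ f w ≫ (pushforward (prodMap f Y)).map (homAt α U') = homAt α U ≫ Q.σ f w := by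
  apply P.σ_injective U
  have hP := P.σ_comp f w (U := Sch.self X) U.hom (Category.comp_id _) U'.hom w
  have hQ := Q.σ_comp f w (U := Sch.self X) U.hom (Category.comp_id _) U'.hom w
  have h := σ_homAt α U'
  have h₀ := σ_homAt α U
  have nat := (pushforwardComp (prodMap f Y) (prodMap U.hom Y)).hom.naturality (homAt α U')
  have nat' := (pushforwardCongr (f := prodMap f Y ≫ prodMap U.hom Y) (g := prodMap U'.hom Y)
    (by rw [← w, prodMap_comp])).hom.naturality (homAt α U')
  rw [hP, hQ] at h
  rw [← cancel_mono ((pushforwardComp (prodMap f Y) (prodMap U.hom Y)).hom.app (Q.obj U')),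
    ← cancel_mono ((pushforwardCongr (f := prodMap f Y ≫ prodMap U.hom Y) (g := prodMap U'.hom Y)
    (by rw [← w, prodMap_comp])).hom.app (Q.obj U'))]
  simp only [Functor.map_comp, Category.assoc] at h ⊢
  rw [reassoc_of% h₀]
  dsimp only [Functor.comp_map] at nat
  rw [reassoc_of% nat, nat']
  exact h

lemma homAt_unique {P Q : BigBimodule X Y} (α : P ⟶ Q) (U : Sch X) (β : P.obj U ⟶ Q.obj U)
    (h : P.σ (U := Sch.self X) U.hom (Category.comp_id _) ≫
        (pushforward (prodMap U.hom Y)).map β =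
      homSelf α ≫ Q.σ (U := Sch.self X) U.hom (Category.comp_id _)) : β = homAt α U :=
  P.σ_injective U (h.trans (σ_homAt α U).symm)

lemma homAt_self {P Q : BigBimodule X Y} (α : P ⟶ Q) : homAt α (Sch.self X) = homSelf α := by
  symm
  apply homAt_unique
  have hP := P.σ_id (Sch.self X)
  have hQ := Q.σ_id (Sch.self X)
  have nat := (pushforwardId (prod X Y)).hom.naturality (homSelf α)
  have nat' := (pushforwardCongr (prodMap_id X Y)).hom.naturality (homSelf α)
  rw [← cancel_mono ((pushforwardCongr (prodMap_id X Y)).hom.app (Q.obj (Sch.self X))),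
    ← cancel_mono ((pushforwardId (prod X Y)).hom.app (Q.obj (Sch.self X)))]
  simp only [Category.assoc]
  rw [hQ, reassoc_of% nat', nat, reassoc_of% hP]
  simp

/-- Big bimodules with equal components and transition morphisms are equal. -/
lemma ext' {P Q : BigBimodule X Y} (h : ∀ U, P.obj U = Q.obj U)
    (h' : ∀ (U' U : Sch X) (f : U'.left ⟶ U.left) (w : f ≫ U.hom = U'.hom),
      P.σ f w ≍ Q.σ f w) : P = Q := by
  obtain ⟨o, _, s, _, _, _⟩ := P
  obtain ⟨o', _, s', _, _, _⟩ := Q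
  obtain rfl : o = o' := funext h
  obtain rfl : @s = @s' := by
    funext U' U f w
    exact eq_of_heq (h' U' U f w)
  rfl

lemma σ_congr (P : BigBimodule X Y) {A' A : Over S} (f : A' ⟶ A) {u₁' u₂' : A' ⟶ X}
    {u₁ u₂ : A ⟶ X} (h' : u₁' = u₂') (h : u₁ = u₂) (a₁' b₁' a₁ b₁ a₂' b₂' a₂ b₂ w₁ w₂) :
    P.σ (U' := ⟨A', u₁', a₁', b₁'⟩) (U := ⟨A, u₁, a₁, b₁⟩) f w₁ ≍
      P.σ (U' := ⟨A', u₂', a₂', b₂'⟩) (U := ⟨A, u₂, a₂, b₂⟩) f w₂ := by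
  subst h h'
  rfl

lemma homAt_congr {P Q : BigBimodule X Y} (α : P ⟶ Q) {A : Over S} {u₁ u₂ : A ⟶ X}
    (h : u₁ = u₂) (a₁ b₁ a₂ b₂) :
    homAt α ⟨A, u₁, a₁, b₁⟩ ≍ homAt α ⟨A, u₂, a₂, b₂⟩ := by
  subst h
  rfl

lemma obj_congr (P : BigBimodule X Y) {A : Over S} {u₁ u₂ : A ⟶ X} (h : u₁ = u₂)
    (a₁ b₁ a₂ b₂) : P.obj ⟨A, u₁, a₁, b₁⟩ = P.obj ⟨A, u₂, a₂, b₂⟩ := by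
  subst h
  rfl

lemma pull_id (X Y : Over S) [LocallyOfFiniteType (Over.Hom.left (𝟙 X))]
    [QuasiCompact (Over.Hom.left (𝟙 X))] :
    pull (𝟙 X) Y = 𝟭 (BigBimodule X Y) := by
  refine Functor.hext (fun P ↦ ext' (fun U ↦ P.obj_congr (Category.comp_id _) _ _ _ _)
    fun U' U f w ↦ P.σ_congr f (Category.comp_id _) (Category.comp_id _) _ _ _ _ _ _ _ _ _ _)
    fun P Q α ↦ ?_
  exact (homAt_congr α (Category.comp_id (𝟙 X)) _ _ _ _).trans (heq_of_eq (homAt_self α))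

lemma pull_comp {X'' X' : Over S} (g₁ : X'' ⟶ X') (g : X' ⟶ X) (Y : Over S)
    [LocallyOfFiniteType g.left] [QuasiCompact g.left] [LocallyOfFiniteType g₁.left]
    [QuasiCompact g₁.left] [LocallyOfFiniteType (g₁ ≫ g).left] [QuasiCompact (g₁ ≫ g).left] :
    pull (g₁ ≫ g) Y = pull g Y ⋙ pull g₁ Y := by
  refine Functor.hext (fun P ↦ ext'
    (fun U ↦ P.obj_congr (Category.assoc _ _ _).symm _ _ _ _)
    fun U' U f w ↦ P.σ_congr f (Category.assoc _ _ _).symm (Category.assoc _ _ _).symm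
      _ _ _ _ _ _ _ _ _ _) fun P Q α ↦ ?_
  refine (homAt_congr α (Category.assoc _ _ _).symm _ _ _ _).trans
    (heq_of_eq (homAt_unique (P := (pull g Y).obj P) (Q := (pull g Y).obj Q)
      ((pull g Y).map α) ((Sch.self X'').map g₁) (homAt α (((Sch.self X'').map g₁).map g)) ?_))
  exact homAt_naturality α (U' := ((Sch.self X'').map g₁).map g) (U := (Sch.self X').map g) _ _

instance {X' : Over S} (g : X' ⟶ X) [LocallyOfFiniteType g.left] [QuasiCompact g.left] :
    (pull g Y).Additive where
  map_add {P Q α β} := by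
    change inv (P.τ _) ≫ (Scheme.Modules.pullback _).map (homSelf α + homSelf β) ≫ Q.τ _ =
      inv (P.τ _) ≫ (Scheme.Modules.pullback _).map (homSelf α) ≫ Q.τ _ +
        inv (P.τ _) ≫ (Scheme.Modules.pullback _).map (homSelf β) ≫ Q.τ _
    rw [Functor.map_add, Preadditive.add_comp, Preadditive.comp_add]
    rfl

end BigBimodule

/-! ### Presheaves of additive categories on `Sm/k` -/

/-- Smooth separated schemes of finite type over `k`. -/
def isSm (k : Type u) [Field k] : ObjectProperty (Over (Spec (CommRingCat.of k))) :=
  fun X ↦ Smooth X.hom ∧ IsSeparated X.hom ∧ LocallyOfFiniteType X.hom ∧ QuasiCompact X.hom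

/-- The category `Sm/k`. -/
abbrev Sm (k : Type u) [Field k] := (isSm k).FullSubcategory

variable {k : Type u} [Field k]

instance {X' X : Sm k} (f : X' ⟶ X) : LocallyOfFiniteType f.hom.left := by
  have := X'.property.2.2.1
  have : LocallyOfFiniteType (f.hom.left ≫ X.obj.hom) := by rw [Over.w]; infer_instance
  exact locallyOfFiniteType_of_comp _ X.obj.hom

instance {X' X : Sm k} (f : X' ⟶ X) : QuasiCompact f.hom.left := by
  have := X'.property.2.2.2
  have := X.property.2.1
  have : QuasiCompact (f.hom.left ≫ X.obj.hom) := by rw [Over.w]; infer_instance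
  exact QuasiCompact.of_comp _ X.obj.hom

universe w v w' v'

/-- A strict contravariant functorial structure, by additive functors, on a family of preadditive
categories indexed by `Sm/k`. -/
structure AdditivePresheaf (C : Sm k → Type w) [∀ X, Category.{v} (C X)]
    [∀ X, Preadditive (C X)] where
  /-- the functor `f^*` -/
  map {X' X : Sm k} (f : X' ⟶ X) : C X ⥤ C X'
  additive {X' X : Sm k} (f : X' ⟶ X) : (map f).Additive
  map_id (X : Sm k) : map (𝟙 X) = 𝟭 (C X)
  map_comp {X'' X' X : Sm k} (f₁ : X'' ⟶ X') (f : X' ⟶ X) : map (f₁ ≫ f) = map f ⋙ map f₁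

/-- A morphism of presheaves of additive categories: a family of additive functors which commute
strictly with the functors `f^*`. -/
structure AdditivePresheaf.Hom {C : Sm k → Type w} [∀ X, Category.{v} (C X)]
    [∀ X, Preadditive (C X)] {D : Sm k → Type w'} [∀ X, Category.{v'} (D X)]
    [∀ X, Preadditive (D X)] (𝒜 : AdditivePresheaf C) (ℬ : AdditivePresheaf D) where
  /-- the component at `X` -/
  app (X : Sm k) : C X ⥤ D X
  additive (X : Sm k) : (app X).Additive
  naturality {X' X : Sm k} (f : X' ⟶ X) : 𝒜.map f ⋙ app X' = app X ⋙ ℬ.map f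

/-- The presheaf `𝒫̃(-, Y)` on `Sm/k`. -/
def bigBimodules (Y : Sm k) : AdditivePresheaf (fun X : Sm k ↦ BigBimodule X.obj Y.obj) where
  map f := BigBimodule.pull f.hom Y.obj
  additive _ := inferInstance
  map_id X := by
    have : LocallyOfFiniteType (Over.Hom.left (𝟙 X.obj)) := by
      rw [Over.id_left]; infer_instance
    have : QuasiCompact (Over.Hom.left (𝟙 X.obj)) := by
      rw [Over.id_left]; infer_instance
    exact BigBimodule.pull_id X.obj Y.obj
  map_comp f₁ f := by
    have : LocallyOfFiniteType (f₁.hom ≫ f.hom).left := by rw [Over.comp_left]; infer_instance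
    have : QuasiCompact (f₁.hom ≫ f.hom).left := by rw [Over.comp_left]; infer_instance
    exact BigBimodule.pull_comp f₁.hom f.hom Y.obj

/-- `𝒜` is the presheaf `𝒜(-, Y)` on `Sm/k`: its functors are the pullback functors `f^*`. -/
def IsCorrPresheaf {Y : Sm k} (𝒜 : AdditivePresheaf (fun X : Sm k ↦ Corr X.obj Y.obj)) : Prop :=
  ∀ {X' X : Sm k} (f : X' ⟶ X), IsPullbackFunctor f.hom (𝒜.map f)

end

end KCorr

/-! The two sides are linked by a third category, `MatRep X Y`. Its objects are non-unital
homomorphisms ρ : O(Y) → M_n(O(X)), linear over the base. Its morphisms are the matrices a that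
intertwine two such homomorphisms and satisfy ρ'(1)a = a = aρ(1). The functor F is the composite of
`Corr.toMat` and `BigBimodule.ofMatFunctor`. Pullback on `MatRep` acts on matrix entries, so it is
strictly functorial.

For every X in Sm/k, `toMat` is an isomorphism of categories. Since Y is affine, the functions on V
× Y for V affine are O(V) ⊗ O(Y). A homomorphism on p_*O_Z is therefore determined by its
restriction ρ to O(Y) (`AlgHomOver.ext_rep`), so that classes of triples are determined by ρ
(`toMat_obj_injective`) and morphisms are intertwining matrices (`exists_mat_eq`).

Conversely, each ρ has to factor through some member of SubSch. Locally ρ extends to θ : C → M_n(R),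
and im θ(1) is a C-module with annihilator ker θ. Since C/ker θ embeds in M_n(R), the support of ρ
is finite over X. Since im θ(1) lies in R^n and R is reduced (X is smooth), the minimal primes over
ker θ contract to minimal primes of R, so every component of the support surjects onto a component
of X (`closedSupport_mem_supp`). A power of the ideal of the support is killed because everything is
noetherian (`exists_kills`). The support is described by eigenvectors over residue fields, which
survive base change (`prodMap_mem_support`). This makes it possible to realise pullback in 𝒜 by
members of SubSch, and to identify it with entrywise pullback of matrices (`isPullbackObj_iff`).

The functor `ofMatFunctor` sends ρ to the modules on U × Y with generators e_i and relations b e_i =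
Σ_j ρ(b)_{ji} e_j, where ρ is first pulled back to U. A presentation pulls back to the presentation
with pulled back coefficients. So the σ_f send generators to generators, their identities can be
read off there, and compatibility with pullback is an equality because (ρ.map g).map u = ρ.map (u ≫
g). Over an affine V the direct image is O(V)^n modulo ker ρ(1), that is im ρ(1), hence finite
projective (`exists_section_pushSec`).

Let X be affine. Morphisms of the modules are given by intertwining matrices (`exists_matrix`). The
global sections N of a bimodule M form a finite projective O(X)-module
(`IsBimodule.finite_and_projective`). A surjection π : O(X)^n → N with a section s yields ρ(b) = s b
π, and the module of this ρ is isomorphic to M (`exists_iso_of_section`). -/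

namespace KCorr

noncomputable section

/-! ### Non-unital matrix representations of commutative algebras -/

open TensorProduct in
/-- A non-unital matrix representation of `B` over `R` extends `R`-linearly to the pushout. -/
lemma exists_extend_of_isPushout {K R B C : CommRingCat.{u}} {f : K ⟶ R} {g : K ⟶ B} {i : R ⟶ C}
    {j : B ⟶ C} (h : IsPushout f g i j) {n : ℕ} (ρ : B →ₙ+* Matrix (Fin n) (Fin n) R)
    (hρ : ∀ s b, ρ (g s * b) = f s • ρ b) :
    ∃ θ : C →ₙ+* Matrix (Fin n) (Fin n) R, ∀ r b, θ (i r * j b) = r • ρ b := by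
  algebraize [f.hom, g.hom]
  let e := (CommRingCat.isPushout_tensorProduct K R B).isoIsPushout _ _ h
  have e1 (r : R) : e.inv (i r) = r ⊗ₜ 1 := by
    have : i ≫ e.inv = _ := IsPushout.inl_isoIsPushout_inv _ _ _ _
    exact congr($this r)
  have e2 (b : B) : e.inv (j b) = 1 ⊗ₜ b := by
    have : j ≫ e.inv = _ := IsPushout.inr_isoIsPushout_inv _ _ _ _
    exact congr($this b)
  let ρ' : B →ₗ[K] Matrix (Fin n) (Fin n) R :=
    { toFun := ρ
      map_add' := map_add ρ
      map_smul' := fun s b ↦ by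
        rw [Algebra.smul_def]
        exact (hρ s b).trans (algebraMap_smul R s (ρ b)) }
  let L : R ⊗[K] B →ₗ[R] Matrix (Fin n) (Fin n) R := TensorProduct.AlgebraTensorModule.lift
    ((LinearMap.ringLmapEquivSelf R R _).symm ρ')
  have hL (r b) : L (r ⊗ₜ b) = r • ρ b := by
    simp [L, ρ']
  have hmul (x y) : L (x * y) = L x * L y := by
    induction x with
    | zero => simp
    | add x₁ x₂ h₁ h₂ => simp [add_mul, h₁, h₂]
    | tmul r b =>
      induction y with
      | zero => simp
      | add x₁ x₂ h₁ h₂ => simp [mul_add, h₁, h₂]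
      | tmul r' b' => simp [hL, smul_smul, mul_comm]
  refine ⟨{ toFun := fun c ↦ L (e.inv c)
            map_mul' := fun x y ↦ by rw [map_mul, hmul]
            map_zero' := by rw [map_zero, map_zero]
            map_add' := fun x y ↦ by rw [map_add, map_add] }, fun r b ↦ ?_⟩
  · change L (e.inv (i r * j b)) = _
    rw [map_mul, e1, e2, Algebra.TensorProduct.tmul_mul_tmul, hL]
    simp

-- A pushout of commutative rings is a tensor product, and pure tensors span it. Identities between
-- linear extensions can thus be checked on products `i a * j b`.
open TensorProduct in
lemma exists_sum_of_isPushout {K R B C : CommRingCat.{u}} {f : K ⟶ R} {g : K ⟶ B} {i : R ⟶ C}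
    {j : B ⟶ C} (h : IsPushout f g i j) (c : C) :
    ∃ (r : ℕ) (a : Fin r → R) (b : Fin r → B), c = ∑ l, i (a l) * j (b l) := by
  algebraize [f.hom, g.hom]
  let e := (CommRingCat.isPushout_tensorProduct K R B).isoIsPushout _ _ h
  have e1 (r : R) : e.hom (r ⊗ₜ 1) = i r := by
    have : _ ≫ e.hom = i := IsPushout.inl_isoIsPushout_hom _ _ _ _
    exact congr($this r)
  have e2 (b : B) : e.hom (1 ⊗ₜ b) = j b := by
    have : _ ≫ e.hom = j := IsPushout.inr_isoIsPushout_hom _ _ _ _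
    exact congr($this b)
  obtain ⟨x, rfl⟩ : ∃ x, e.hom x = c := ⟨e.inv c, by simp⟩
  induction x using TensorProduct.induction_on with
  | zero => exact ⟨0, 0, 0, by simp⟩
  | tmul r b =>
    refine ⟨1, fun _ ↦ r, fun _ ↦ b, ?_⟩
    simp only [Finset.univ_unique, Finset.sum_singleton]
    rw [← e1 r, ← e2 b, ← map_mul, Algebra.TensorProduct.tmul_mul_tmul, mul_one, one_mul]
  | add x y hx hy =>
    obtain ⟨r, a, b, e⟩ := hx
    obtain ⟨r', a', b', e'⟩ := hy
    refine ⟨r + r', Fin.append a a', Fin.append b b', ?_⟩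
    rw [map_add, e, e', Fin.sum_univ_add]
    simp

section Algebra

set_option linter.unusedSectionVars false

variable {R C : Type*} [CommRing R] [CommRing C] [Algebra R C] {n : ℕ}

/-- `θ` is linear over `R`. -/
def IsScalarLinear (θ : C →ₙ+* Matrix (Fin n) (Fin n) R) : Prop :=
  ∀ (r : R) (c : C), θ (algebraMap R C r * c) = r • θ c

/-- The image `θ(1) R ^ n`, a module over `C`. -/
def RepMod (θ : C →ₙ+* Matrix (Fin n) (Fin n) R) : Type _ := LinearMap.range (θ 1).mulVecLin

namespace RepMod

variable {θ : C →ₙ+* Matrix (Fin n) (Fin n) R}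

instance : AddCommGroup (RepMod θ) := inferInstanceAs (AddCommGroup (LinearMap.range _))

instance : Module R (RepMod θ) := inferInstanceAs (Module R (LinearMap.range _))

/-- The inclusion into `R ^ n`. -/
def incl : RepMod θ →ₗ[R] (Fin n → R) := (LinearMap.range (θ 1).mulVecLin).subtype

lemma incl_injective : Function.Injective (incl (θ := θ)) := Subtype.val_injective

@[ext]
lemma ext {x y : RepMod θ} (h : x.incl = y.incl) : x = y := incl_injective h

lemma one_mulVec_incl (x : RepMod θ) : (θ 1).mulVec x.incl = x.incl := by
  obtain ⟨_, v, rfl⟩ := x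
  change (θ 1).mulVec ((θ 1).mulVec v) = (θ 1).mulVec v
  rw [Matrix.mulVec_mulVec, ← map_mul, one_mul]

/-- The projection from `R ^ n`. -/
def proj : (Fin n → R) →ₗ[R] RepMod θ := (θ 1).mulVecLin.rangeRestrict

@[simp] lemma incl_proj (v : Fin n → R) : (proj (θ := θ) v).incl = (θ 1).mulVec v := rfl

@[simp] lemma proj_incl (x : RepMod θ) : proj (θ := θ) x.incl = x := ext (by
  rw [incl_proj, one_mulVec_incl])

lemma proj_surjective : Function.Surjective (proj (θ := θ)) := fun x ↦ ⟨x.incl, proj_incl x⟩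

instance : SMul C (RepMod θ) where
  smul c x := proj ((θ c).mulVec x.incl)

@[simp] lemma incl_smul (c : C) (x : RepMod θ) : (c • x).incl = (θ c).mulVec x.incl := by
  change (θ 1).mulVec _ = _
  rw [Matrix.mulVec_mulVec, ← map_mul, one_mul]

instance : Module C (RepMod θ) where
  one_smul x := ext (by simp [one_mulVec_incl])
  mul_smul a b x := ext (by simp [Matrix.mulVec_mulVec])
  smul_zero a := ext (by simp)
  smul_add a x y := ext (by simp [Matrix.mulVec_add])
  add_smul a b x := ext (by simp [Matrix.add_mulVec])
  zero_smul x := ext (by simp)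

lemma isScalarTower (hθ : IsScalarLinear θ) : IsScalarTower R C (RepMod θ) where
  smul_assoc r c x := ext (by
    rw [Algebra.smul_def, incl_smul, hθ, map_smul, incl_smul, Matrix.smul_mulVec])

lemma proj_mulVec (c : C) (v : Fin n → R) :
    proj (θ := θ) ((θ c).mulVec v) = c • proj (θ := θ) v := ext (by
  rw [incl_proj, incl_smul, incl_proj, Matrix.mulVec_mulVec, Matrix.mulVec_mulVec, ← map_mul,
    ← map_mul, mul_comm])

instance : Module.Finite R (RepMod θ) := Module.Finite.of_surjective proj proj_surjective

lemma finite (hθ : IsScalarLinear θ) : Module.Finite C (RepMod θ) :=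
  have := isScalarTower hθ
  Module.Finite.of_restrictScalars_finite R C (RepMod θ)

/-- The matrix `θ c` kills the image of `θ 1` exactly when `θ c * θ 1 = θ c` vanishes. The kernel of
`θ` is thus the annihilator of a finite module, and the theory of supports and associated primes
applies to it. -/
lemma mem_annihilator_iff (c : C) : c ∈ Module.annihilator C (RepMod θ) ↔ θ c = 0 := by
  rw [Module.mem_annihilator]
  constructor
  · intro h
    have : θ c * θ 1 = 0 := by
      apply Matrix.ext_of_mulVec_single
      intro i
      have := congr(($(h (proj (Pi.single i 1)))).incl)
      rw [incl_smul, incl_proj, Matrix.mulVec_mulVec] at this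
      rw [this]
      ext
      simp
    rwa [← map_mul, mul_one] at this
  · intro h x
    ext1
    simp [h]

end RepMod

variable {θ : C →ₙ+* Matrix (Fin n) (Fin n) R}

open TensorProduct in
/-- A prime ideal containing the kernel of `θ` admits an eigenvector over its residue field. -/
lemma IsScalarLinear.exists_eigenvector (hθ : IsScalarLinear θ) (q : Ideal C) [q.IsPrime]
    (hq : ∀ c, θ c = 0 → c ∈ q) :
    ∃ v : Fin n → q.ResidueField, v ≠ 0 ∧ ∀ (c : C) (i : Fin n),
      ∑ j, algebraMap C q.ResidueField (algebraMap R C (θ c j i)) * v j =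
        algebraMap C q.ResidueField c * v i := by
  have := RepMod.finite hθ
  have := RepMod.isScalarTower hθ
  -- The module is finite, so a prime containing its annihilator lies in its support, and the fibre
  -- at that prime is nonzero.
  have h : (⟨q, inferInstance⟩ : PrimeSpectrum C) ∈ Module.support C (RepMod θ) := by
    rw [Module.support_eq_zeroLocus, PrimeSpectrum.mem_zeroLocus]
    intro c hc
    exact hq c ((RepMod.mem_annihilator_iff c).mp hc)
  rw [Module.mem_support_iff_nontrivial_residueField_tensorProduct] at h
  obtain ⟨t, ht⟩ := exists_ne (0 : q.ResidueField ⊗[C] RepMod θ)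
  -- The eigenvector is a nonzero functional on the fibre: its coordinates are the values at the
  -- projections of the standard basis, and linearity over `C` is the eigenvector equation.
  obtain ⟨l, hl⟩ := Module.Projective.exists_dual_ne_zero q.ResidueField ht
  let l' : RepMod θ →ₗ[C] q.ResidueField :=
    (l.restrictScalars C).comp (TensorProduct.mk C q.ResidueField (RepMod θ) 1)
  have hl' (x) : l' x = ∑ j, algebraMap C q.ResidueField (algebraMap R C (x.incl j)) *
      l' (RepMod.proj (Pi.single j 1)) := by
    conv_lhs => rw [← RepMod.proj_incl x, ← Finset.univ_sum_single x.incl]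
    rw [map_sum, map_sum]
    refine Finset.sum_congr rfl fun j _ ↦ ?_
    have : (Pi.single j (x.incl j) : Fin n → R) = x.incl j • Pi.single j 1 := by
      rw [← Pi.single_smul, smul_eq_mul, mul_one]
    rw [this, map_smul, ← algebraMap_smul C, map_smul, Algebra.smul_def]
  refine ⟨fun j ↦ l' (RepMod.proj (Pi.single j 1)), fun h0 ↦ hl ?_, fun c i ↦ ?_⟩
  · have h0' (x) : l' x = 0 := by
      rw [hl']
      exact Finset.sum_eq_zero fun j _ ↦ by rw [congr_fun h0 j, Pi.zero_apply, mul_zero]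
    induction t with
    | zero => simp
    | add x y hx hy =>
      have : l = 0 := by
        ext x
        exact h0' x
      simp [this]
    | tmul a x =>
      have : a ⊗ₜ[C] x = a • ((1 : q.ResidueField) ⊗ₜ[C] x) := by simp [TensorProduct.smul_tmul']
      rw [this, map_smul]
      have := h0' x
      change l (1 ⊗ₜ x) = 0 at this
      rw [this, smul_zero]
  · have := hl' (RepMod.proj ((θ c).mulVec (Pi.single i 1)))
    rw [RepMod.proj_mulVec, map_smul, Algebra.smul_def] at this
    rw [this]
    refine Finset.sum_congr rfl fun j _ ↦ ?_
    rw [RepMod.incl_smul, RepMod.incl_proj, Matrix.mulVec_mulVec, ← map_mul, mul_one,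
      Matrix.mulVec_single_one]
    rfl

/-- Over a reduced noetherian ring the minimal primes over the kernel of `θ` lie over minimal
primes. -/
lemma IsScalarLinear.comap_mem_minimalPrimes [IsReduced R] [IsNoetherianRing C]
    (hθ : IsScalarLinear θ) (q : Ideal C) (hq : q ∈ (Module.annihilator C (RepMod θ)).minimalPrimes) :
    q.comap (algebraMap R C) ∈ minimalPrimes R := by
  have := RepMod.finite hθ
  have := RepMod.isScalarTower hθ
  -- A minimal prime over the annihilator of a finite module over a noetherian ring is the
  -- annihilator of some element `x`. As `x` is a vector in R^n, the contraction of `q` consists of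
  -- the `r` that kill all its coordinates.
  obtain ⟨hp, x, hx⟩ := isAssociatedPrime_iff.mp
    (Module.associatedPrimes.minimalPrimes_annihilator_subset_associatedPrimes C (RepMod θ) hq)
  have mem (r : R) : r ∈ q.comap (algebraMap R C) ↔ ∀ i, r * x.incl i = 0 := by
    rw [Ideal.mem_comap, hx, Submodule.mem_colon_singleton, Submodule.mem_bot, algebraMap_smul]
    refine ⟨fun h i ↦ ?_, fun h ↦ RepMod.ext (funext fun i ↦ ?_)⟩
    · simpa using congr_fun congr(($h).incl) i
    · simpa using h i
  have hp' : (q.comap (algebraMap R C)).IsPrime := hp.comap _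
  -- A prime that is a finite intersection of annihilators of coordinates contains one of them, so
  -- it is the annihilator of a single element of `R`.
  obtain ⟨i, -, hi⟩ := (Ideal.IsPrime.inf_le' (s := Finset.univ)
    (f := fun i ↦ LinearMap.ker (LinearMap.toSpanSingleton R R (x.incl i))) hp').mp fun r hr ↦ by
      rw [mem]
      intro i
      simpa using (Submodule.mem_finsetInf.mp hr) i (Finset.mem_univ _)
  have hi' (r : R) : r * x.incl i = 0 → r ∈ q.comap (algebraMap R C) := fun h ↦ hi (by simpa using h)
  -- This is where reducedness enters: otherwise the square of the coordinate would vanish. A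
  -- smaller prime then contains `r * x.incl i = 0` but not `x.incl i`, so it contains `r`.
  have hxi : x.incl i ∉ q.comap (algebraMap R C) := fun h ↦ by
    have h0 : x.incl i = 0 := by
      have := (mem _).mp h i
      exact (pow_eq_zero_iff two_ne_zero).mp (by rw [sq, this])
    exact hp'.ne_top ((Ideal.eq_top_iff_one _).mpr (hi' 1 (by simp [h0])))
  refine ⟨⟨hp', bot_le⟩, fun p' ⟨hp'', _⟩ hle r hr ↦ ?_⟩
  have := (mem r).mp hr i
  exact (hp''.mem_or_mem (this ▸ p'.zero_mem)).resolve_right fun h ↦ hxi (hle h)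

end Algebra

open TensorProduct Polynomial in
/-- A smooth algebra over a field is reduced. -/
lemma isReduced_of_smooth (k A : Type*) [Field k] [CommRing A] [Algebra k A] [Algebra.Smooth k A] :
    _root_.IsReduced A := by
  refine ⟨fun s hs ↦ ?_⟩
  -- The map reads off the coefficient of `X`. It will be evaluated at `s ⊗ X`, where it returns the
  -- nilpotent element `s`.
  let L : A ⊗[k] k[X] →ₗ[A] A :=
    TensorProduct.AlgebraTensorModule.lift ((LinearMap.ringLmapEquivSelf A A _).symm
      ((Algebra.linearMap k A).comp (Polynomial.lcoeff k 1)))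
  have hL (a : A) (p : k[X]) : L (a ⊗ₜ p) = a * algebraMap k A (p.coeff 1) := by
    simp [L]
  have hnil : IsNilpotent (s ⊗ₜ[k] (X : k[X])) := by
    obtain ⟨m, hm⟩ := hs
    exact ⟨m, by rw [Algebra.TensorProduct.tmul_pow, hm, zero_tmul]⟩
  have hint : IsIntegral A (s ⊗ₜ[k] (X : k[X])) := by
    obtain ⟨m, hm⟩ := hnil
    exact ⟨X ^ m, monic_X_pow m, by simp [hm]⟩
  -- Integral closure commutes with smooth base change. Elements of `k[X]` integral over `k` are
  -- constants, so the integral element `s ⊗ X` comes from tensors with no coefficient at `X`.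
  obtain ⟨t, ht⟩ := (TensorProduct.toIntegralClosure_bijective_of_smooth (R := k) (S := A)
    (B := k[X])).2 ⟨_, hint⟩
  have h0 (t) : L (TensorProduct.toIntegralClosure k A k[X] t).1 = 0 := by
    induction t with
    | zero => simp
    | add x y hx hy => simp [hx, hy]
    | tmul a p =>
      change L (a ⊗ₜ p.1) = 0
      have hp : p.1.coeff 1 = 0 := by
        by_contra h
        have hd : p.1.natDegree ≠ 0 := fun h' ↦ h (coeff_eq_zero_of_natDegree_lt (by omega))
        refine Polynomial.transcendental p.1 hd ?_ (p.2 : IsIntegral k p.1).isAlgebraic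
        exact mem_nonZeroDivisors_of_ne_zero (leadingCoeff_ne_zero.mpr fun h' ↦ hd (by simp [h']))
      simp [hL, hp]
  have := h0 t
  rw [ht] at this
  simpa [hL] using this

end

end KCorr

/-! ### Functions on `V × Y` and linear extension of matrix representations -/

namespace KCorr

noncomputable section

variable {S : Scheme.{u}}

/-- The projection `U ×_S Y ⟶ Y`. -/
abbrev prodSnd (U Y : Over S) : prod U Y ⟶ Y.left := pullback.snd U.hom Y.hom

/-- Functions on `Y`, as functions on `V × Y`. -/
abbrev sndFun (U Y : Over S) (V : U.left.Opens) :
    Γ(Y.left, ⊤) ⟶ Γ(prod U Y, prodFst U Y ⁻¹ᵁ V) :=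
  (prodSnd U Y).appLE ⊤ _ (by simp)

/-- Functions on `V`, as functions on `V × Y`. -/
abbrev fstFun (U Y : Over S) (V : U.left.Opens) :
    Γ(U.left, V) ⟶ Γ(prod U Y, prodFst U Y ⁻¹ᵁ V) :=
  (prodFst U Y).app V

/-- Restriction of functions on `V × Y`. -/
abbrev prodRes (U Y : Over S) {V' V : U.left.Opens} (h : V' ≤ V) :
    Γ(prod U Y, prodFst U Y ⁻¹ᵁ V) ⟶ Γ(prod U Y, prodFst U Y ⁻¹ᵁ V') :=
  (prod U Y).presheaf.map (homOfLE ((prodFst U Y).preimage_mono h)).op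

lemma prodRes_sndFun (U Y : Over S) {V' V : U.left.Opens} (h : V' ≤ V) (b : Γ(Y.left, ⊤)) :
    prodRes U Y h (sndFun U Y V b) = sndFun U Y V' b := by
  have : sndFun U Y V ≫ prodRes U Y h = sndFun U Y V' := by
    exact Scheme.Hom.appLE_map _ _ _
  exact congr($this b)

lemma prodRes_fstFun (U Y : Over S) {V' V : U.left.Opens} (h : V' ≤ V) (a : Γ(U.left, V)) :
    prodRes U Y h (fstFun U Y V a) = fstFun U Y V' (res h a) := by
  have : fstFun U Y V ≫ prodRes U Y h = res h ≫ fstFun U Y V' := by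
    simp only [fstFun, prodRes, Scheme.Hom.naturality]
    rfl
  exact congr($this a)

lemma preimage_prodFst_le {U' U : Over S} (f : U' ⟶ U) (Y : Over S) {V : U.left.Opens}
    {V' : U'.left.Opens} (h : V' ≤ f.left ⁻¹ᵁ V) :
    prodFst U' Y ⁻¹ᵁ V' ≤ prodMap f Y ⁻¹ᵁ prodFst U Y ⁻¹ᵁ V := by
  rw [← Scheme.Hom.comp_preimage, prodMap, pullback.lift_fst, Scheme.Hom.comp_preimage]
  exact Scheme.Hom.preimage_mono _ h

/-- Pullback of functions along `f × 1`. -/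
abbrev prodPull {U' U : Over S} (f : U' ⟶ U) (Y : Over S) {V : U.left.Opens} {V' : U'.left.Opens}
    (h : V' ≤ f.left ⁻¹ᵁ V) :
    Γ(prod U Y, prodFst U Y ⁻¹ᵁ V) ⟶ Γ(prod U' Y, prodFst U' Y ⁻¹ᵁ V') :=
  (prodMap f Y).appLE _ _ (preimage_prodFst_le f Y h)

lemma prodMap_fst {U' U : Over S} (f : U' ⟶ U) (Y : Over S) :
    prodMap f Y ≫ prodFst U Y = prodFst U' Y ≫ f.left := pullback.lift_fst _ _ _

lemma prodMap_snd {U' U : Over S} (f : U' ⟶ U) (Y : Over S) :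
    prodMap f Y ≫ prodSnd U Y = prodSnd U' Y := pullback.lift_snd _ _ _

lemma prodPull_sndFun {U' U : Over S} (f : U' ⟶ U) (Y : Over S) {V : U.left.Opens}
    {V' : U'.left.Opens} (h : V' ≤ f.left ⁻¹ᵁ V) (b : Γ(Y.left, ⊤)) :
    prodPull f Y h (sndFun U Y V b) = sndFun U' Y V' b := by
  have : sndFun U Y V ≫ prodPull f Y h = sndFun U' Y V' := by
    refine (Scheme.Hom.appLE_comp_appLE (prodMap f Y) (prodSnd U Y) ⊤ _ _ _ _).trans ?_
    simp only [prodMap_snd]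
  exact congr($this b)

lemma prodPull_fstFun {U' U : Over S} (f : U' ⟶ U) (Y : Over S) {V : U.left.Opens}
    {V' : U'.left.Opens} (h : V' ≤ f.left ⁻¹ᵁ V) (a : Γ(U.left, V)) :
    prodPull f Y h (fstFun U Y V a) = fstFun U' Y V' (f.left.appLE V V' h a) := by
  have : fstFun U Y V ≫ prodPull f Y h = f.left.appLE V V' h ≫ fstFun U' Y V' := by
    simp only [fstFun, prodPull, Scheme.Hom.app_eq_appLE, Scheme.Hom.appLE_comp_appLE, prodMap_fst]
  exact congr($this a)

/-- Over an affine base the functions on a product of affine schemes form the tensor product. Both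
the extension of a representation from O(Y) to functions on V × Y and its uniqueness come from here.
-/
lemma isPushout_of_isAffineOpen [IsAffine S] (U Y : Over S) [IsAffine Y.left] {V : U.left.Opens}
    (hV : IsAffineOpen V) :
    IsPushout (U.hom.appLE ⊤ V le_top) Y.hom.appTop (fstFun U Y V) (sndFun U Y V) := by
  have := (isIso_pushoutSection_iff (IsPullback.of_hasPullback U.hom Y.hom)
    (US := ⊤) (UT := ⊤) (UX := V) (UY := prodFst U Y ⁻¹ᵁ V) le_top le_top (by simp)).mp
    (isIso_pushoutSection_of_isAffineOpen _ _ _ _ (isAffineOpen_top _) (isAffineOpen_top _) hV)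
  convert this using 1
  · exact Scheme.Hom.app_eq_appLE _
  · exact Scheme.Hom.app_eq_appLE _

instance [IsAffine S] (U Y : Over S) [IsAffine Y.left] : IsAffineHom (prodFst U Y) :=
  have : IsAffineHom Y.hom := inferInstance
  MorphismProperty.of_isPullback (P := @IsAffineHom)
    (IsPullback.of_hasPullback U.hom Y.hom).flip this

lemma exists_sum [IsAffine S] {U Y : Over S} [IsAffine Y.left] {V : U.left.Opens}
    (hV : IsAffineOpen V) (c : Γ(prod U Y, prodFst U Y ⁻¹ᵁ V)) :
    ∃ (r : ℕ) (a : Fin r → Γ(U.left, V)) (b : Fin r → Γ(Y.left, ⊤)),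
      c = ∑ l, fstFun U Y V (a l) * sndFun U Y V (b l) :=
  exists_sum_of_isPushout (isPushout_of_isAffineOpen U Y hV) c

/-! ### Matrix representations of functions on `Y` over `U` -/

/-- Non-unital homomorphisms `𝒪(Y) ⟶ M_n(𝒪(U))`, linear over the base. -/
@[ext]
structure Rep (U Y : Over S) (n : ℕ) where
  /-- the homomorphism -/
  toHom : Γ(Y.left, ⊤) →ₙ+* Matrix (Fin n) (Fin n) Γ(U.left, ⊤)
  map_smul (s : Γ(S, ⊤)) (b : Γ(Y.left, ⊤)) :
    toHom (Y.hom.appTop s * b) = U.hom.appTop s • toHom b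

namespace Rep

variable {U Y : Over S} {n : ℕ}

/-- Pullback of a matrix representation. -/
def map (ρ : Rep U Y n) {U' : Over S} (f : U' ⟶ U) : Rep U' Y n where
  toHom := (RingHom.mapMatrix f.left.appTop.hom).toNonUnitalRingHom.comp ρ.toHom
  map_smul s b := by
    have h : U.hom.appTop ≫ f.left.appTop = U'.hom.appTop := by
      rw [← Scheme.Hom.comp_appTop, Over.w]
    change (ρ.toHom _).map f.left.appTop = _ • (ρ.toHom b).map f.left.appTop
    rw [ρ.map_smul, ← h]
    ext i j
    simp

@[simp] lemma map_toHom (ρ : Rep U Y n) {U' : Over S} (f : U' ⟶ U) (b : Γ(Y.left, ⊤)) :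
    (ρ.map f).toHom b = (ρ.toHom b).map f.left.appTop := rfl

/-- Pullback acts on entries, so this identity and `map_comp` are equalities and not just
isomorphisms. All strict equalities of functors below rest on these two. -/
lemma map_id (ρ : Rep U Y n) : ρ.map (𝟙 U) = ρ := by
  ext b i j
  simp

lemma map_comp (ρ : Rep U Y n) {U'' U' : Over S} (f₁ : U'' ⟶ U') (f : U' ⟶ U) :
    ρ.map (f₁ ≫ f) = (ρ.map f).map f₁ := by
  ext b i j
  simp
  rfl

variable [IsAffine S] [IsAffine Y.left]

lemma exists_extend (ρ : Rep U Y n) {V : U.left.Opens} (hV : IsAffineOpen V) :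
    ∃ θ : Γ(prod U Y, prodFst U Y ⁻¹ᵁ V) →ₙ+* Matrix (Fin n) (Fin n) Γ(U.left, V),
      ∀ a b, θ (fstFun U Y V a * sndFun U Y V b) = a • (ρ.toHom b).map (res le_top) := by
  refine exists_extend_of_isPushout (isPushout_of_isAffineOpen U Y hV)
    ((RingHom.mapMatrix (res (U := U) (le_top : V ≤ ⊤)).hom).toNonUnitalRingHom.comp ρ.toHom)
    fun s b ↦ ?_
  have h : U.hom.appTop ≫ res le_top = U.hom.appLE ⊤ V le_top := rfl
  change (ρ.toHom _).map _ = _ • (ρ.toHom b).map _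
  rw [ρ.map_smul, ← h]
  ext i j
  simp

/-- The `𝒪(V)`-linear extension of a matrix representation to functions on `V × Y`. -/
def extend (ρ : Rep U Y n) {V : U.left.Opens} (hV : IsAffineOpen V) :
    Γ(prod U Y, prodFst U Y ⁻¹ᵁ V) →ₙ+* Matrix (Fin n) (Fin n) Γ(U.left, V) :=
  (ρ.exists_extend hV).choose

lemma extend_mul (ρ : Rep U Y n) {V : U.left.Opens} (hV : IsAffineOpen V) (a b) :
    ρ.extend hV (fstFun U Y V a * sndFun U Y V b) = a • (ρ.toHom b).map (res le_top) :=
  (ρ.exists_extend hV).choose_spec a b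

lemma extend_sndFun (ρ : Rep U Y n) {V : U.left.Opens} (hV : IsAffineOpen V) (b) :
    ρ.extend hV (sndFun U Y V b) = (ρ.toHom b).map (res le_top) := by
  simpa using ρ.extend_mul hV 1 b

lemma extend_one (ρ : Rep U Y n) {V : U.left.Opens} (hV : IsAffineOpen V) :
    ρ.extend hV 1 = (ρ.toHom 1).map (res le_top) := by
  simpa using ρ.extend_mul hV 1 1

lemma extend_fstFun_mul (ρ : Rep U Y n) {V : U.left.Opens} (hV : IsAffineOpen V) (a c) :
    ρ.extend hV (fstFun U Y V a * c) = a • ρ.extend hV c := by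
  obtain ⟨r, a', b, rfl⟩ := exists_sum hV c
  rw [Finset.mul_sum, map_sum, map_sum, Finset.smul_sum]
  refine Finset.sum_congr rfl fun l _ ↦ ?_
  rw [← mul_assoc, ← map_mul, extend_mul, extend_mul, mul_smul]

lemma extend_pull (ρ : Rep U Y n) {U' : Over S} (f : U' ⟶ U) {V : U.left.Opens}
    (hV : IsAffineOpen V) {V' : U'.left.Opens} (hV' : IsAffineOpen V') (h : V' ≤ f.left ⁻¹ᵁ V)
    (c) : (ρ.map f).extend hV' (prodPull f Y h c) =
      (ρ.extend hV c).map (f.left.appLE V V' h) := by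
  obtain ⟨r, a', b, rfl⟩ := exists_sum hV c
  have key : res le_top ≫ f.left.appLE V V' h = f.left.appTop ≫ res le_top := by
    rw [Scheme.Hom.map_appLE]
    rfl
  ext i j
  simp only [map_sum, Matrix.map_apply, Matrix.sum_apply]
  refine Finset.sum_congr rfl fun l _ ↦ ?_
  rw [map_mul (prodPull f Y h).hom, prodPull_fstFun, prodPull_sndFun, extend_mul, extend_mul]
  simp only [Matrix.smul_apply, smul_eq_mul, map_mul, Matrix.map_apply, map_toHom]
  exact congr_arg _ congr($(key.symm) _)

lemma extend_res (ρ : Rep U Y n) {V' V : U.left.Opens} (hV : IsAffineOpen V)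
    (hV' : IsAffineOpen V') (h : V' ≤ V) (c) : ρ.extend hV' (prodRes U Y h c) =
      (ρ.extend hV c).map (res h) := by
  obtain ⟨r, a', b, rfl⟩ := exists_sum hV c
  have key : res (le_top : V ≤ ⊤) ≫ res h = res le_top := by
    rw [← Functor.map_comp]
    rfl
  ext i j
  simp only [map_sum, Matrix.map_apply, Matrix.sum_apply]
  refine Finset.sum_congr rfl fun l _ ↦ ?_
  rw [map_mul (prodRes U Y h).hom, prodRes_fstFun, prodRes_sndFun, extend_mul, extend_mul]
  simp only [Matrix.smul_apply, smul_eq_mul, map_mul, Matrix.map_apply]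
  exact congr_arg _ congr($(key.symm) _)

end Rep

end

end KCorr

/-! ### The support of a matrix representation -/

namespace KCorr

noncomputable section

lemma evaluation_res {X : Scheme.{u}} {V' V : X.Opens} (h : V' ≤ V) (x : X) (hx : x ∈ V')
    (s : Γ(X, V)) : X.evaluation V' x hx (X.presheaf.map (homOfLE h).op s) =
      X.evaluation V x (h hx) s := by
  have : X.presheaf.map (homOfLE h).op ≫ X.evaluation V' x hx = X.evaluation V x (h hx) := by
    rw [← Scheme.germ_residue, ← Scheme.germ_residue, X.presheaf.germ_res_assoc]
  exact congr($this s)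

lemma evaluation_appLE {X Y : Scheme.{u}} (f : X ⟶ Y) {V' : X.Opens} {V : Y.Opens}
    (h : V' ≤ f ⁻¹ᵁ V) (x : X) (hx : x ∈ V') (s : Γ(Y, V)) :
    X.evaluation V' x hx (f.appLE V V' h s) = X.evaluation (f ⁻¹ᵁ V) x (h hx) (f.app V s) := by
  rw [Scheme.Hom.appLE, CommRingCat.comp_apply]
  exact evaluation_res _ _ _ _

variable {S : Scheme.{u}}

namespace Rep

variable {U Y : Over S} {n : ℕ}

/-- The points at which the representation of functions on `Y` has a (left) eigenvector. -/
def support (ρ : Rep U Y n) : Set (prod U Y) :=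
  {z | ∃ v : Fin n → (prod U Y).residueField z, v ≠ 0 ∧ ∀ b i,
    ∑ j, (prod U Y).evaluation (prodFst U Y ⁻¹ᵁ ⊤) z trivial (fstFun U Y ⊤ (ρ.toHom b j i)) * v j =
      (prod U Y).evaluation (prodFst U Y ⁻¹ᵁ ⊤) z trivial (sndFun U Y ⊤ b) * v i}

lemma evaluation_fstFun {V' V : U.left.Opens} (h : V' ≤ V) (z : prod U Y)
    (hz : z ∈ prodFst U Y ⁻¹ᵁ V') (a : Γ(U.left, V)) :
    (prod U Y).evaluation _ z hz (fstFun U Y V' (res h a)) =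
      (prod U Y).evaluation _ z ((prodFst U Y).preimage_mono h hz) (fstFun U Y V a) := by
  rw [← prodRes_fstFun, evaluation_res]

lemma evaluation_sndFun {V' V : U.left.Opens} (h : V' ≤ V) (z : prod U Y)
    (hz : z ∈ prodFst U Y ⁻¹ᵁ V') (b : Γ(Y.left, ⊤)) :
    (prod U Y).evaluation _ z hz (sndFun U Y V' b) =
      (prod U Y).evaluation _ z ((prodFst U Y).preimage_mono h hz) (sndFun U Y V b) := by
  rw [← prodRes_sndFun U Y h, evaluation_res]

/-- An eigenvector over the residue field of the image point stays one after extension to the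
residue field of `z`. This compatibility with base change is immediate from eigenvectors, but not
from a description by kernels. -/
lemma prodMap_mem_support (ρ : Rep U Y n) {U' : Over S} (f : U' ⟶ U) {z : prod U' Y}
    (hz : prodMap f Y z ∈ ρ.support) : z ∈ (ρ.map f).support := by
  obtain ⟨v, hv, h⟩ := hz
  have hf : (⊤ : U'.left.Opens) ≤ f.left ⁻¹ᵁ ⊤ := le_rfl
  let l := ((prodMap f Y).residueFieldMap z).hom
  refine ⟨fun i ↦ l (v i), fun h0 ↦ hv (funext fun i ↦ l.injective ?_), fun b i ↦ ?_⟩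
  · simpa using congr_fun h0 i
  have e (s : Γ(prod U Y, prodFst U Y ⁻¹ᵁ ⊤)) :
      l ((prod U Y).evaluation (prodFst U Y ⁻¹ᵁ ⊤) (prodMap f Y z) trivial s) =
      (prod U' Y).evaluation (prodFst U' Y ⁻¹ᵁ ⊤) z trivial
        (prodPull f Y (V := ⊤) (V' := ⊤) hf s) := by
    refine (Scheme.evaluation_naturality_apply (prodMap f Y) (V := prodFst U Y ⁻¹ᵁ ⊤) z trivial s).trans ?_
    exact (evaluation_appLE (prodMap f Y) (V := prodFst U Y ⁻¹ᵁ ⊤) (V' := prodFst U' Y ⁻¹ᵁ ⊤)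
      (preimage_prodFst_le f Y hf) z trivial s).symm
  have := congr(l $(h b i))
  simp only [map_sum, map_mul, e] at this
  rw [prodPull_sndFun f Y hf] at this
  rw [← this]
  refine Finset.sum_congr rfl fun j _ ↦ ?_
  rw [prodPull_fstFun f Y hf, map_toHom, Matrix.map_apply, Scheme.Hom.appTop,
    Scheme.Hom.app_eq_appLE]
  rfl

variable [IsAffine S] [IsAffine Y.left]

/-- The kernel of evaluation at `z` is a prime containing the kernel of the extended representation,
so `exists_eigenvector` gives an eigenvector over its residue field, which maps to that of `z`. -/
lemma mem_support_of_forall (ρ : Rep U Y n) {V : U.left.Opens} (hV : IsAffineOpen V) {z : prod U Y}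
    (hz : z ∈ prodFst U Y ⁻¹ᵁ V)
    (h : ∀ c, ρ.extend hV c = 0 → (prod U Y).evaluation _ z hz c = 0) : z ∈ ρ.support := by
  algebraize [(fstFun U Y V).hom]
  have hθ : IsScalarLinear (ρ.extend hV) := fun a c ↦ ρ.extend_fstFun_mul hV a c
  let ev := ((prod U Y).evaluation _ z hz).hom
  let q : Ideal Γ(prod U Y, prodFst U Y ⁻¹ᵁ V) := RingHom.ker ev
  have : q.IsPrime := RingHom.ker_isPrime ev
  obtain ⟨v, hv, hv'⟩ := hθ.exists_eigenvector q h
  let l : q.ResidueField →+* (prod U Y).residueField z :=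
    Ideal.ResidueField.lift q ev le_rfl fun x hx ↦ by
      exact isUnit_iff_ne_zero.mpr (by simpa [q, Ideal.primeCompl] using hx)
  have hl c : l (algebraMap _ _ c) = ev c := Ideal.ResidueField.lift_algebraMap ..
  refine ⟨fun i ↦ l (v i), fun h0 ↦ hv (funext fun i ↦ l.injective ?_), fun b i ↦ ?_⟩
  · simpa using congr_fun h0 i
  have := congr(l $(hv' (sndFun U Y V b) i))
  simp only [map_sum, map_mul, hl, extend_sndFun, Matrix.map_apply] at this
  rw [← evaluation_sndFun le_top z hz, ← this]
  refine Finset.sum_congr rfl fun j _ ↦ ?_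
  rw [← evaluation_fstFun le_top z hz]
  rfl

/-- The eigenvector equation extends linearly from functions on `Y` to all `c` on V × Y. If the
matrix of `c` is zero, then c(z)v = 0 with v nonzero. Together with `mem_support_of_forall` this
shows that the support is locally the zero locus of a kernel, hence closed. -/
lemma evaluation_eq_zero_of_mem_support (ρ : Rep U Y n) {V : U.left.Opens} (hV : IsAffineOpen V)
    {z : prod U Y} (hz : z ∈ prodFst U Y ⁻¹ᵁ V) (h : z ∈ ρ.support) (c)
    (hc : ρ.extend hV c = 0) : (prod U Y).evaluation _ z hz c = 0 := by
  obtain ⟨v, hv, h⟩ := h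
  have key (i : Fin n) : ∑ j, (prod U Y).evaluation _ z hz (fstFun U Y V (ρ.extend hV c j i)) * v j =
      (prod U Y).evaluation _ z hz c * v i := by
    obtain ⟨r, a, b, rfl⟩ := exists_sum hV c
    simp only [map_sum, extend_mul, Matrix.sum_apply, Finset.sum_mul]
    simp only [Matrix.smul_apply, smul_eq_mul, map_mul, Matrix.map_apply]
    rw [Finset.sum_comm]
    refine Finset.sum_congr rfl fun l _ ↦ ?_
    rw [evaluation_sndFun le_top z hz, mul_assoc, ← h, Finset.mul_sum]
    refine Finset.sum_congr rfl fun j _ ↦ ?_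
    rw [evaluation_fstFun le_top z hz, mul_assoc]
  obtain ⟨i, hi⟩ := Function.ne_iff.mp hv
  have := key i
  simp only [hc, Matrix.zero_apply, map_zero, zero_mul, Finset.sum_const_zero] at this
  exact (mul_eq_zero.mp this.symm).resolve_right hi

lemma mem_support_iff (ρ : Rep U Y n) {V : U.left.Opens} (hV : IsAffineOpen V)
    {z : prod U Y} (hz : z ∈ prodFst U Y ⁻¹ᵁ V) : z ∈ ρ.support ↔
      ∀ c, ρ.extend hV c = 0 → z ∉ (prod U Y).basicOpen c := by
  simp only [← Scheme.evaluation_eq_zero_iff_notMem_basicOpen _ _ hz]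
  exact ⟨fun h c hc ↦ ρ.evaluation_eq_zero_of_mem_support hV hz h c hc,
    ρ.mem_support_of_forall hV hz⟩

lemma isClosed_support (ρ : Rep U Y n) : IsClosed ρ.support := by
  rw [← isOpen_compl_iff, isOpen_iff_forall_mem_open]
  intro z hz
  obtain ⟨_, ⟨V, hV, rfl⟩, hzV, -⟩ := U.left.isBasis_affineOpens.exists_subset_of_mem_open
    (Set.mem_univ (prodFst U Y z)) isOpen_univ
  obtain ⟨c, hc, hc'⟩ : ∃ c, ρ.extend hV c = 0 ∧ z ∈ (prod U Y).basicOpen c := by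
    simpa [ρ.mem_support_iff hV (z := z) hzV] using hz
  refine ⟨(prod U Y).basicOpen c, fun y hy hy' ↦ ?_, (prod U Y).basicOpen c |>.2, hc'⟩
  exact (ρ.mem_support_iff hV ((prod U Y).basicOpen_le c hy)).mp hy' c hc hy

/-- The support of a matrix representation as a closed subset. -/
def closedSupport (ρ : Rep U Y n) : Closeds (prod U Y) := ⟨ρ.support, ρ.isClosed_support⟩

end Rep

end

end KCorr

/-! ### The support belongs to `Supp(U × Y / Y)` -/

namespace KCorr

noncomputable section

lemma section_ext {X : Scheme.{u}} {V : X.Opens} {s t : Γ(X, V)}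
    (h : ∀ x ∈ V, ∃ (W : X.Opens) (hW : W ≤ V), x ∈ W ∧
      X.presheaf.map (homOfLE hW).op s = X.presheaf.map (homOfLE hW).op t) : s = t :=
  TopCat.Presheaf.IsSheaf.section_ext X.sheaf.2 h

lemma fromSpec_specializes_iff {X : Scheme.{u}} {V : X.Opens} (hV : IsAffineOpen V)
    (q₁ q₂ : PrimeSpectrum Γ(X, V)) : hV.fromSpec q₁ ⤳ hV.fromSpec q₂ ↔ q₁ ≤ q₂ :=
  hV.fromSpec.isOpenEmbedding.isInducing.specializes_iff.trans
    (PrimeSpectrum.le_iff_specializes _ _).symm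

/-- The quotient of `C` by the kernel of `θ` embeds `R`-linearly in a matrix module, so it is finite
because `R` is noetherian, and `D` is a quotient of it. -/
lemma IsScalarLinear.finite_of_surjective {R C : Type*} [CommRing R] [CommRing C] [Algebra R C]
    [IsNoetherianRing R] {n : ℕ} {θ : C →ₙ+* Matrix (Fin n) (Fin n) R} (hθ : IsScalarLinear θ)
    {D : Type*} [CommRing D] (g : C →+* D) (hg : Function.Surjective g)
    (h : ∀ c, θ c = 0 → g c = 0) : (g.comp (algebraMap R C)).Finite := by
  algebraize [g, g.comp (algebraMap R C)]
  let Lθ : C →ₗ[R] Matrix (Fin n) (Fin n) R :=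
    { toFun := θ
      map_add' := map_add θ
      map_smul' r c := by rw [Algebra.smul_def, hθ]; rfl }
  let Lg : C →ₗ[R] D := (IsScalarTower.toAlgHom R C D).toLinearMap
  have : Module.Finite R (C ⧸ LinearMap.ker Lθ) :=
    Module.Finite.equiv Lθ.quotKerEquivRange.symm
  exact Module.Finite.of_surjective ((LinearMap.ker Lθ).liftQ Lg h)
    fun d ↦ (hg d).elim fun c hc ↦ ⟨Submodule.Quotient.mk c, hc⟩

variable {S : Scheme.{u}}

/-- The affine open `V × Y` for `V` an affine open. -/
abbrev prodOpen (U Y : Over S) [IsAffineHom (prodFst U Y)] {V : U.left.Opens} (hV : IsAffineOpen V) :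
    (prod U Y).affineOpens := ⟨prodFst U Y ⁻¹ᵁ V, hV.preimage (prodFst U Y)⟩

namespace Rep

variable {U Y : Over S} {n : ℕ} [IsAffine S] [IsAffine Y.left]

/-- The functions on `V × Y` killed by the representation. -/
def kerIdeal (ρ : Rep U Y n) {V : U.left.Opens} (hV : IsAffineOpen V) :
    Ideal Γ(prod U Y, prodFst U Y ⁻¹ᵁ V) where
  carrier := {c | ρ.extend hV c = 0}
  add_mem' {a b} ha hb := by
    change ρ.extend hV (a + b) = 0
    rw [map_add, ha, hb, add_zero]
  zero_mem' := map_zero _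
  smul_mem' a b hb := by
    change ρ.extend hV (a * b) = 0
    rw [map_mul, hb, mul_zero]

lemma mem_kerIdeal {ρ : Rep U Y n} {V : U.left.Opens} {hV : IsAffineOpen V} {c} :
    c ∈ ρ.kerIdeal hV ↔ ρ.extend hV c = 0 := Iff.rfl

lemma fromSpec_preimage_support (ρ : Rep U Y n) {V : U.left.Opens} (hV : IsAffineOpen V) :
    (prodOpen U Y hV).2.fromSpec ⁻¹' ρ.support = PrimeSpectrum.zeroLocus (ρ.kerIdeal hV) := by
  ext x
  have hx : (prodOpen U Y hV).2.fromSpec x ∈ prodFst U Y ⁻¹ᵁ V := by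
    have := (prodOpen U Y hV).2.range_fromSpec
    exact this.le (Set.mem_range_self x)
  rw [Set.mem_preimage, ρ.mem_support_iff hV hx]
  refine forall_congr' fun c ↦ imp_congr_right fun _ ↦ ?_
  have := congr(x ∈ $((prodOpen U Y hV).2.fromSpec_preimage_basicOpen c))
  rw [← not_iff_not, not_not]
  exact (this.to_iff : _)

lemma vanishingIdeal_closedSupport (ρ : Rep U Y n) {V : U.left.Opens} (hV : IsAffineOpen V) :
    (Scheme.IdealSheafData.vanishingIdeal ρ.closedSupport).ideal (prodOpen U Y hV) =
      (ρ.kerIdeal hV).radical := by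
  rw [← PrimeSpectrum.vanishingIdeal_zeroLocus_eq_radical, ← fromSpec_preimage_support]
  rfl

/-- The representation factors through the functions on the closed subscheme `Z`. -/
def Kills (ρ : Rep U Y n) (Z : (prod U Y).IdealSheafData) : Prop :=
  ∀ ⦃V : U.left.Opens⦄ (hV : IsAffineOpen V), Z.ideal (prodOpen U Y hV) ≤ ρ.kerIdeal hV

lemma ideal_le_kerIdeal_of_le (ρ : Rep U Y n) (Z : (prod U Y).IdealSheafData) {V' V : U.left.Opens}
    (hV : IsAffineOpen V) (hV' : IsAffineOpen V') (h : V' ≤ V)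
    (hZ : Z.ideal (prodOpen U Y hV) ≤ ρ.kerIdeal hV) :
    Z.ideal (prodOpen U Y hV') ≤ ρ.kerIdeal hV' := by
  rw [← Z.map_ideal (U := prodOpen U Y hV') (V := prodOpen U Y hV)
    ((prodFst U Y).preimage_mono h), Ideal.map_le_iff_le_comap]
  intro c hc
  change ρ.extend hV' (prodRes U Y h c) = 0
  rw [extend_res ρ hV hV', mem_kerIdeal.mp (hZ hc)]
  simp

/-- Matrix entries are sections of the structure sheaf, so their vanishing is local on `U`. Two
affine opens are compared on a common open subset that is principal in both. -/
lemma kills_of_cover (ρ : Rep U Y n) (Z : (prod U Y).IdealSheafData)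
    (h : ∀ x : U.left, ∃ (V : U.left.Opens) (hV : IsAffineOpen V), x ∈ V ∧
      Z.ideal (prodOpen U Y hV) ≤ ρ.kerIdeal hV) : ρ.Kills Z := by
  intro V hV c hc
  rw [mem_kerIdeal]
  ext i j
  refine section_ext fun x hx ↦ ?_
  obtain ⟨V₁, hV₁, hx₁, h₁⟩ := h x
  obtain ⟨f, g, hfg, hxf⟩ := exists_basicOpen_le_affine_inter hV hV₁ x ⟨hx, hx₁⟩
  have hD := hV.basicOpen f
  have hDV : U.left.basicOpen f ≤ V := U.left.basicOpen_le f
  have hDV₁ : U.left.basicOpen f ≤ V₁ := hfg.trans_le (U.left.basicOpen_le g)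
  refine ⟨_, hDV, hxf, ?_⟩
  have h₂ := ρ.ideal_le_kerIdeal_of_le Z hV₁ hD hDV₁ h₁
  have h₃ : prodRes U Y hDV c ∈ Z.ideal (prodOpen U Y hD) := by
    rw [← Z.map_ideal (U := prodOpen U Y hD) (V := prodOpen U Y hV)
      ((prodFst U Y).preimage_mono hDV)]
    exact Ideal.mem_map_of_mem _ hc
  have h₄ := congr($(mem_kerIdeal.mp (h₂ h₃)) i j)
  rw [extend_res ρ hV hD] at h₄
  rw [Matrix.zero_apply, map_zero]
  exact h₄

variable [IsLocallyNoetherian U.left]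

/-- Functions killed by the representation vanish on its support, hence on `A`. So the functions on
`A` over an affine open are a quotient as in `finite_of_surjective`. -/
lemma isFinite_of_le_closedSupport (ρ : Rep U Y n) {A : Closeds (prod U Y)}
    (hA : A ≤ ρ.closedSupport) :
    IsFinite ((Scheme.IdealSheafData.vanishingIdeal A).subschemeι ≫ prodFst U Y) where
  finite_app V hV := by
    have : IsNoetherianRing Γ(U.left, V) := IsLocallyNoetherian.component_noetherian ⟨V, hV⟩
    algebraize [(fstFun U Y V).hom]
    have hθ : IsScalarLinear (ρ.extend hV) := fun a c ↦ ρ.extend_fstFun_mul hV a c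
    let I := Scheme.IdealSheafData.vanishingIdeal A
    rw [Scheme.Hom.comp_app]
    refine hθ.finite_of_surjective (I.subschemeι.app (prodFst U Y ⁻¹ᵁ V)).hom
      (I.subschemeι_app_surjective (prodOpen U Y hV)) fun c hc ↦ ?_
    have h : c ∈ I.ideal (prodOpen U Y hV) := by
      refine (Scheme.IdealSheafData.vanishingIdeal_antimono hA) (prodOpen U Y hV) ?_
      rw [vanishingIdeal_closedSupport]
      exact Ideal.le_radical hc
    rw [← I.ker_subschemeι_app] at h
    exact h

/-- Over an affine open the ideal of the support is the radical of the kernel, and noetherianity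
puts a power of it into the kernel. Quasi-compactness of `U` makes the exponent uniform. -/
lemma exists_kills [CompactSpace U.left] [LocallyOfFiniteType (prodFst U Y)] (ρ : Rep U Y n) :
    ∃ m : ℕ, ρ.Kills (Scheme.IdealSheafData.vanishingIdeal ρ.closedSupport ^ m) := by
  have : IsLocallyNoetherian (prod U Y) := LocallyOfFiniteType.isLocallyNoetherian (prodFst U Y)
  have key (V : U.left.affineOpens) : ∃ m : ℕ,
      (Scheme.IdealSheafData.vanishingIdeal ρ.closedSupport).ideal (prodOpen U Y V.2) ^ m ≤
        ρ.kerIdeal V.2 := by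
    have := IsLocallyNoetherian.component_noetherian (prodOpen U Y V.2)
    rw [vanishingIdeal_closedSupport]
    exact Ideal.exists_radical_pow_le_of_fg _ (IsNoetherian.noetherian _)
  choose m hm using key
  obtain ⟨t, ht⟩ := CompactSpace.elim_nhds_subcover (fun x : U.left ↦
    ((exists_isAffineOpen_mem_and_subset (x := x) (U := ⊤) trivial).choose : Set U.left)) fun x ↦
      IsOpen.mem_nhds (Opens.isOpen _)
        (exists_isAffineOpen_mem_and_subset (x := x) (U := ⊤) trivial).choose_spec.2.1
  let W (x : U.left) : U.left.affineOpens :=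
    ⟨(exists_isAffineOpen_mem_and_subset (x := x) (U := ⊤) trivial).choose,
      (exists_isAffineOpen_mem_and_subset (x := x) (U := ⊤) trivial).choose_spec.1⟩
  refine ⟨t.sup fun x ↦ m (W x), ρ.kills_of_cover _ fun x ↦ ?_⟩
  have hx : x ∈ ⋃ y ∈ t, ((W y).1 : Set U.left) := ht.ge (Set.mem_univ x)
  simp only [Set.mem_iUnion] at hx
  obtain ⟨y, hy, hxy⟩ := hx
  refine ⟨W y, (W y).2, hxy, le_trans ?_ (hm (W y))⟩
  rw [Scheme.IdealSheafData.ideal_pow]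
  exact Ideal.pow_le_pow_right (Finset.le_sup (f := fun x ↦ m (W x)) hy)

/-- A point of the support with no proper generization there is a minimal prime over the annihilator
of `RepMod`. Its contraction to the reduced ring of functions on `V` is minimal by
`comap_mem_minimalPrimes`. -/
lemma comap_mem_minimalPrimes_of_maximal [_root_.AlgebraicGeometry.IsReduced U.left]
    [LocallyOfFiniteType (prodFst U Y)] (ρ : Rep U Y n) {η : prod U Y} (hη : η ∈ ρ.support)
    (hmax : ∀ z ∈ ρ.support, z ⤳ η → η ⤳ z) {V : U.left.Opens} (hV : IsAffineOpen V)
    (hηV : prodFst U Y η ∈ V) :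
    (hV.primeIdealOf ⟨prodFst U Y η, hηV⟩).asIdeal ∈ minimalPrimes Γ(U.left, V) := by
  have : IsLocallyNoetherian (prod U Y) := LocallyOfFiniteType.isLocallyNoetherian (prodFst U Y)
  have := IsLocallyNoetherian.component_noetherian (prodOpen U Y hV)
  algebraize [(fstFun U Y V).hom]
  have hθ : IsScalarLinear (ρ.extend hV) := fun a c ↦ ρ.extend_fstFun_mul hV a c
  let hC := (prodOpen U Y hV).2
  let q := hC.primeIdealOf ⟨η, hηV⟩
  have hq : hC.fromSpec q = η := hC.fromSpec_primeIdealOf ⟨η, hηV⟩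
  have hsupp (q' : PrimeSpectrum Γ(prod U Y, prodFst U Y ⁻¹ᵁ V)) :
      hC.fromSpec q' ∈ ρ.support ↔ ρ.kerIdeal hV ≤ q'.asIdeal :=
    congr(q' ∈ $(ρ.fromSpec_preimage_support hV)).to_iff
  have hspec := fromSpec_specializes_iff hC
  have hann : Module.annihilator _ (RepMod (ρ.extend hV)) = ρ.kerIdeal hV :=
    Ideal.ext fun c ↦ RepMod.mem_annihilator_iff c
  have hmin : q.asIdeal ∈ (Module.annihilator _ (RepMod (ρ.extend hV))).minimalPrimes := by
    rw [hann]
    refine ⟨⟨q.isPrime, (hsupp q).mp (hq ▸ hη)⟩, fun q' ⟨h₁, h₂⟩ h₃ ↦ ?_⟩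
    have h₄ := (hspec ⟨q', h₁⟩ q).mpr h₃
    rw [hq] at h₄
    have h₅ := hmax _ ((hsupp ⟨q', h₁⟩).mpr h₂) h₄
    rw [← hq] at h₅
    exact (hspec _ _).mp h₅
  have := hθ.comap_mem_minimalPrimes _ hmin
  have h := IsAffineOpen.comap_primeIdealOf_appLE (f := prodFst U Y) V hV (prodFst U Y ⁻¹ᵁ V) hC
    le_rfl hηV
  rw [← h, ← Scheme.Hom.app_eq_appLE]
  exact this

/-- The generic point of the closure of a larger irreducible set specializes to `x`, so it lies in
`V`. It corresponds there to a smaller prime, which equals the given one by minimality. -/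
lemma closure_mem_irreducibleComponents {X : Scheme.{u}} {x : X} {V : X.Opens}
    (hV : IsAffineOpen V) (hx : x ∈ V)
    (h : (hV.primeIdealOf ⟨x, hx⟩).asIdeal ∈ minimalPrimes Γ(X, V)) :
    closure {x} ∈ irreducibleComponents X := by
  refine ⟨isIrreducible_singleton.closure, fun T hT hxT ↦ ?_⟩
  have hgen := hT.isGenericPoint_genericPoint_closure
  have hs : hT.genericPoint ⤳ x := hgen.specializes
    (subset_closure (hxT (subset_closure (Set.mem_singleton x))))
  have hξ : hT.genericPoint ∈ V := hs.mem_open V.isOpen hx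
  have h₁ : hV.fromSpec (hV.primeIdealOf ⟨_, hξ⟩) = hT.genericPoint := hV.fromSpec_primeIdealOf _
  have h₂ : hV.fromSpec (hV.primeIdealOf ⟨_, hx⟩) = x := hV.fromSpec_primeIdealOf _
  have hle : hV.primeIdealOf ⟨_, hξ⟩ ≤ hV.primeIdealOf ⟨_, hx⟩ := by
    rw [← fromSpec_specializes_iff hV, h₁, h₂]
    exact hs
  have heq : hV.primeIdealOf ⟨_, hξ⟩ = hV.primeIdealOf ⟨_, hx⟩ :=
    le_antisymm hle (h.2 ⟨(hV.primeIdealOf ⟨_, hξ⟩).isPrime, bot_le⟩ hle)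
  rw [heq, h₂] at h₁
  intro t ht
  have : t ∈ closure {hT.genericPoint} := hgen.def.symm ▸ subset_closure ht
  rwa [← h₁] at this

/-- Finiteness makes the image closed, so the image is the closure of the image of the generic
point. By maximality of `B` that point has no proper generization in the support, and hence lies
over a minimal prime. -/
lemma isFiniteSurjective_of_maximal [_root_.AlgebraicGeometry.IsReduced U.left]
    [LocallyOfFiniteType (prodFst U Y)] (ρ : Rep U Y n) (B : Closeds (prod U Y))
    (hB : IsIrreducible (B : Set (prod U Y))) (hBA : B ≤ ρ.closedSupport)
    (hmax : ∀ T : Closeds (prod U Y), IsIrreducible (T : Set (prod U Y)) →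
      T ≤ ρ.closedSupport → B ≤ T → T ≤ B) : IsFiniteSurjective U Y B := by
  have hfin := ρ.isFinite_of_le_closedSupport hBA
  refine ⟨hB, hfin, ?_⟩
  have hclosed : IsClosed (prodFst U Y '' (B : Set (prod U Y))) := by
    have := ((Scheme.IdealSheafData.vanishingIdeal B).subschemeι ≫ prodFst U Y).isClosedMap.isClosed_range
    rw [Scheme.Hom.comp_base, TopCat.coe_comp, Set.range_comp,
      Scheme.IdealSheafData.range_subschemeι] at this
    simpa using this
  have hgen : IsGenericPoint hB.genericPoint (B : Set (prod U Y)) :=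
    hB.isGenericPoint_genericPoint B.isClosed
  set η := hB.genericPoint
  have himage : prodFst U Y '' (B : Set (prod U Y)) = closure {prodFst U Y η} := by
    refine subset_antisymm ?_ ?_
    · rw [← hgen.def]
      exact (image_closure_subset_closure_image (prodFst U Y).continuous).trans (by simp)
    · refine hclosed.closure_subset_iff.mpr ?_
      rintro _ rfl
      exact ⟨η, hgen.mem, rfl⟩
  obtain ⟨V, hV, hηV, -⟩ := exists_isAffineOpen_mem_and_subset (x := prodFst U Y η) (U := ⊤) trivial
  rw [himage]
  refine closure_mem_irreducibleComponents hV hηV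
    (ρ.comap_mem_minimalPrimes_of_maximal (hBA hgen.mem) (fun z hz hzη ↦ ?_) hV hηV)
  refine hgen.specializes (hmax ⟨closure {z}, isClosed_closure⟩ isIrreducible_singleton.closure
    (ρ.isClosed_support.closure_subset_iff.mpr (by simpa using hz)) ?_ (subset_closure rfl))
  intro y hy
  exact (hzη.trans (hgen.specializes hy)).mem_closure

lemma closedSupport_mem_supp [_root_.AlgebraicGeometry.IsReduced U.left] [CompactSpace U.left]
    [LocallyOfFiniteType (prodFst U Y)] (ρ : Rep U Y n) : ρ.closedSupport ∈ Supp U Y := by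
  have : IsLocallyNoetherian (prod U Y) := LocallyOfFiniteType.isLocallyNoetherian (prodFst U Y)
  have : CompactSpace (prod U Y) := QuasiCompact.compactSpace_of_compactSpace (prodFst U Y)
  have : IsNoetherian (prod U Y) := { }
  obtain ⟨s, hs, hirr, hsup⟩ :=
    NoetherianSpace.exists_finite_set_closeds_irreducible ρ.closedSupport
  -- A decomposition may contain redundant members that do not dominate a component of `U`. The
  -- maximal members have the same union, and each is maximal among irreducible closed subsets of
  -- the support, since such a subset lies in a single member.
  refine ⟨{B ∈ s | Maximal (· ∈ s) B}, hs.subset (Set.sep_subset _ _), fun B hB ↦ ?_, ?_⟩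
  · refine ρ.isFiniteSurjective_of_maximal B (hirr B hB.1) (hsup.ge.trans' (le_sSup hB.1))
      fun T hT hTA hBT ↦ ?_
    obtain ⟨t, ht, hTt⟩ : ∃ t ∈ s, T ≤ t := by
      have := (isIrreducible_iff_sUnion_isClosed.mp hT) (hs.image SetLike.coe).toFinset (by
        simp only [Set.Finite.mem_toFinset, Set.mem_image, forall_exists_index, and_imp]
        rintro _ t - rfl
        exact t.isClosed) (by
          rw [hsup] at hTA
          lift s to Finset (Closeds (prod U Y)) using hs
          rw [← Finset.sup_id_eq_sSup] at hTA
          intro x hx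
          have : x ∈ ((s.sup id : Closeds (prod U Y)) : Set (prod U Y)) := hTA hx
          rw [Closeds.coe_finset_sup] at this
          simpa using this)
      simpa using this
    exact hTt.trans (hB.2.2 ht (hBT.trans hTt))
  · rw [hsup]
    refine le_antisymm (sSup_le fun B hB ↦ ?_) (sSup_le_sSup (Set.sep_subset _ _))
    obtain ⟨T, hBT, hT⟩ := hs.exists_le_maximal hB
    exact hBT.trans (le_sSup ⟨hT.1, hT⟩)

end Rep

end

end KCorr

/-! ### Homomorphisms on closed subschemes versus representations of `O(Y)` -/

namespace KCorr

noncomputable section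

lemma presheaf_map_map {X : Scheme.{u}} {A B C : (Opens X)ᵒᵖ} (f : A ⟶ B) (g : B ⟶ C) (h : A ⟶ C)
    (s : X.presheaf.obj A) :
    X.presheaf.map g (X.presheaf.map f s) = X.presheaf.map h s := by
  rw [← CommRingCat.comp_apply, ← Functor.map_comp]
  rfl

lemma exists_glue {X : Scheme.{u}} {V : X.Opens}
    (s : ∀ W : X.Opens, IsAffineOpen W → W ≤ V → Γ(X, W))
    (hs : ∀ W W' (hW : IsAffineOpen W) (hW' : IsAffineOpen W') (h : W ≤ V) (h' : W' ≤ W),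
      X.presheaf.map (homOfLE h').op (s W hW h) = s W' hW' (h'.trans h)) :
    ∃ t : Γ(X, V), ∀ W (hW : IsAffineOpen W) (h : W ≤ V),
      X.presheaf.map (homOfLE h).op t = s W hW h := by
  let ι := {W : X.Opens // IsAffineOpen W ∧ W ≤ V}
  obtain ⟨t, ht, -⟩ := X.sheaf.existsUnique_gluing' (fun W : ι ↦ W.1) V (fun W ↦ homOfLE W.2.2)
    (fun x hx ↦ by
      obtain ⟨W, hW, hxW, hWV⟩ := exists_isAffineOpen_mem_and_subset (x := x) (U := V) hx
      exact Opens.mem_iSup.mpr ⟨⟨W, hW, hWV⟩, hxW⟩) (fun W ↦ s W.1 W.2.1 W.2.2) (by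
      intro W₁ W₂
      refine section_ext fun x hx ↦ ?_
      obtain ⟨W, hW, hxW, hWV⟩ := exists_isAffineOpen_mem_and_subset (x := x) (U := W₁.1 ⊓ W₂.1) hx
      refine ⟨W, hWV, hxW, ?_⟩
      have h₁ := hs W₁.1 W W₁.2.1 hW W₁.2.2 (hWV.trans inf_le_left)
      have h₂ := hs W₂.1 W W₂.2.1 hW W₂.2.2 (hWV.trans inf_le_right)
      exact (presheaf_map_map _ _ _ _).trans
        ((h₁.trans h₂.symm).trans (presheaf_map_map _ _ _ _).symm))
  exact ⟨t, fun W hW h ↦ ht ⟨W, hW, h⟩⟩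

variable {S : Scheme.{u}} {U Y : Over S}

/-- Restriction of functions on `V × Y` to a closed subscheme. -/
def toSecs (Z : (prod U Y).IdealSheafData) (V : U.left.Opens) :
    Γ(prod U Y, prodFst U Y ⁻¹ᵁ V) ⟶ secs Z V :=
  Z.subschemeι.appLE _ _ (by rw [← Scheme.Hom.comp_preimage])

lemma toSecs_fstFun (Z : (prod U Y).IdealSheafData) (V : U.left.Opens) (a : Γ(U.left, V)) :
    toSecs Z V (fstFun U Y V a) = (proj Z).app V a := by
  have : fstFun U Y V ≫ toSecs Z V = (proj Z).app V := by
    rw [toSecs, fstFun, Scheme.Hom.app_eq_appLE, Scheme.Hom.appLE_comp_appLE,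
      Scheme.Hom.app_eq_appLE]
  exact congr($this a)

lemma toSecs_prodRes (Z : (prod U Y).IdealSheafData) {V' V : U.left.Opens} (h : V' ≤ V) (c) :
    toSecs Z V' (prodRes U Y h c) = secsRes Z h (toSecs Z V c) := by
  have : prodRes U Y h ≫ toSecs Z V' = toSecs Z V ≫ secsRes Z h := by
    rw [toSecs, prodRes, Scheme.Hom.map_appLE, toSecs, secsRes, Scheme.Hom.appLE_map]
  exact congr($this c)

lemma can_toSecs {Z Z' : (prod U Y).IdealSheafData} (h : Z' ≤ Z) (V : U.left.Opens) (c) :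
    can h V (toSecs Z' V c) = toSecs Z V c := by
  have : toSecs Z' V ≫ can h V = toSecs Z V := by
    simp only [toSecs, can]
    rw [Scheme.Hom.appLE_comp_appLE]
    simp only [Scheme.IdealSheafData.inclusion_subschemeι]
  exact congr($this c)

lemma pullSecs_toSecs {U' : Over S} (f : U' ⟶ U) (Z : (prod U Y).IdealSheafData)
    (V : U.left.Opens) (V' : U'.left.Opens) (h : V' ≤ f.left ⁻¹ᵁ V) (c) :
    pullSecs f Z V V' h (toSecs Z V c) = toSecs (baseChange f Z) V' (prodPull f Y h c) := by
  have : toSecs Z V ≫ pullSecs f Z V V' h = prodPull f Y h ≫ toSecs (baseChange f Z) V' := by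
    simp only [toSecs, pullSecs, prodPull]
    rw [Scheme.Hom.appLE_comp_appLE, Scheme.Hom.appLE_comp_appLE]
    simp only [Scheme.IdealSheafData.subschemeMap_subschemeι]
  exact congr($this c)

lemma toSecs_eq_app (Z : (prod U Y).IdealSheafData) (V : U.left.Opens) :
    toSecs Z V = Z.subschemeι.app (prodFst U Y ⁻¹ᵁ V) := (Scheme.Hom.app_eq_appLE _).symm

lemma toSecs_surjective [IsAffineHom (prodFst U Y)] (Z : (prod U Y).IdealSheafData)
    {V : U.left.Opens} (hV : IsAffineOpen V) : Function.Surjective (toSecs Z V) := by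
  rw [toSecs_eq_app]
  exact Z.subschemeι_app_surjective (prodOpen U Y hV)

lemma toSecs_eq_zero_iff [IsAffineHom (prodFst U Y)] (Z : (prod U Y).IdealSheafData)
    {V : U.left.Opens} (hV : IsAffineOpen V) (c) :
    toSecs Z V c = 0 ↔ c ∈ Z.ideal (prodOpen U Y hV) := by
  rw [toSecs_eq_app, ← Z.ker_subschemeι_app]
  rfl

lemma sndFun_appTop (s : Γ(S, ⊤)) : sndFun U Y ⊤ (Y.hom.appTop s) =
    fstFun U Y ⊤ (U.hom.appTop s) := by
  have : Y.hom.appTop ≫ sndFun U Y ⊤ = U.hom.appTop ≫ fstFun U Y ⊤ := by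
    rw [Scheme.Hom.appTop, Scheme.Hom.appTop, fstFun, Scheme.Hom.app_eq_appLE,
      Scheme.Hom.app_eq_appLE, Scheme.Hom.app_eq_appLE]
    refine (Scheme.Hom.appLE_comp_appLE (prodSnd U Y) Y.hom ⊤ ⊤ _ le_rfl le_top).trans
      (Eq.trans ?_ (Scheme.Hom.appLE_comp_appLE (prodFst U Y) U.hom ⊤ ⊤ _ le_rfl le_top).symm)
    simp only [prodSnd, prodFst, pullback.condition]
  exact congr($this s)

namespace AlgHomOver

variable {n : ℕ} {Z : (prod U Y).IdealSheafData}

/-- The underlying matrix representation of functions on `Y`. -/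
def rep (φ : AlgHomOver Z n) : Rep U Y n where
  toHom := (φ.app ⊤).comp ((sndFun U Y ⊤ ≫ toSecs Z ⊤).hom.toNonUnitalRingHom)
  map_smul s b := by
    change φ.app ⊤ (toSecs Z ⊤ (sndFun U Y ⊤ _)) = _ • φ.app ⊤ (toSecs Z ⊤ (sndFun U Y ⊤ b))
    rw [map_mul, map_mul, sndFun_appTop, toSecs_fstFun, φ.map_smul]

lemma rep_toHom (φ : AlgHomOver Z n) (b) :
    φ.rep.toHom b = φ.app ⊤ (toSecs Z ⊤ (sndFun U Y ⊤ b)) := rfl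

/-- Functions on `Y` restrict compatibly to all closed subschemes. The representation is therefore
an invariant of the equivalence class of a triple. -/
lemma rep_extend {Z' : (prod U Y).IdealSheafData} (φ : AlgHomOver Z n) (h : Z' ≤ Z) :
    (φ.extend h).rep = φ.rep := by
  refine Rep.ext (NonUnitalRingHom.ext fun b ↦ ?_)
  rw [rep_toHom, extend_app, can_toSecs, rep_toHom]

variable [IsAffine S] [IsAffine Y.left]

lemma app_toSecs (φ : AlgHomOver Z n) {V : U.left.Opens} (hV : IsAffineOpen V) (c) :
    φ.app V (toSecs Z V c) = φ.rep.extend hV c := by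
  obtain ⟨r, a, b, rfl⟩ := exists_sum hV c
  simp only [map_sum]
  refine Finset.sum_congr rfl fun l _ ↦ ?_
  rw [map_mul, toSecs_fstFun, φ.map_smul, Rep.extend_mul, rep_toHom, ← φ.naturality,
    ← toSecs_prodRes, prodRes_sndFun]

lemma kills (φ : AlgHomOver Z n) : φ.rep.Kills Z := fun V hV c hc ↦ by
  rw [Rep.mem_kerIdeal, ← app_toSecs, (toSecs_eq_zero_iff Z hV c).mpr hc, map_zero]

/-- Over an affine `W` every function on `Z` lifts to W × Y, where functions are combinations of
functions on `W` and on `Y`. Linearity settles affine opens, and the sheaf property of the entries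
settles the rest. -/
lemma ext_rep {φ φ' : AlgHomOver Z n} (h : φ.rep = φ'.rep) : φ = φ' := by
  ext V z i j
  refine section_ext fun x hx ↦ ?_
  obtain ⟨W, hW, hxW, hWV⟩ := exists_isAffineOpen_mem_and_subset (x := x) (U := V) hx
  refine ⟨W, hWV, hxW, ?_⟩
  obtain ⟨c, hc⟩ := toSecs_surjective Z hW (secsRes Z hWV z)
  have h₁ := φ.naturality hWV z
  have h₂ := φ'.naturality hWV z
  rw [← hc, app_toSecs _ hW] at h₁ h₂
  rw [← h, h₁] at h₂
  exact congr_fun₂ h₂ i j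

end AlgHomOver

namespace Rep

variable {n : ℕ} {Z : (prod U Y).IdealSheafData} [IsAffine S] [IsAffine Y.left]

/-- The matrix `a` is the value on `z` of the homomorphism on functions on `Z`. -/
def IsValue (ρ : Rep U Y n) (V : U.left.Opens) (z : secs Z V)
    (a : Matrix (Fin n) (Fin n) Γ(U.left, V)) : Prop :=
  ∀ (W : U.left.Opens) (hW : IsAffineOpen W) (h : W ≤ V) (c), toSecs Z W c = secsRes Z h z →
    a.map (res h) = ρ.extend hW c

lemma IsValue.unique {ρ : Rep U Y n} {V : U.left.Opens} {z : secs Z V}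
    {a a' : Matrix (Fin n) (Fin n) Γ(U.left, V)} (h : ρ.IsValue V z a) (h' : ρ.IsValue V z a') :
    a = a' := by
  ext i j
  refine section_ext fun x hx ↦ ?_
  obtain ⟨W, hW, hxW, hWV⟩ := exists_isAffineOpen_mem_and_subset (x := x) (U := V) hx
  obtain ⟨c, hc⟩ := toSecs_surjective Z hW (secsRes Z hWV z)
  exact ⟨W, hWV, hxW, congr_fun₂ ((h W hW hWV c hc).trans (h' W hW hWV c hc).symm) i j⟩

lemma Kills.extend_eq {ρ : Rep U Y n} (hZ : ρ.Kills Z) {W : U.left.Opens} (hW : IsAffineOpen W)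
    {c c'} (h : toSecs Z W c = toSecs Z W c') : ρ.extend hW c = ρ.extend hW c' := by
  rw [← sub_eq_zero, ← map_sub, toSecs_eq_zero_iff Z hW] at h
  have := hZ hW h
  rwa [mem_kerIdeal, map_sub, sub_eq_zero] at this

lemma Kills.exists_isValue {ρ : Rep U Y n} (hZ : ρ.Kills Z) (V : U.left.Opens) (z : secs Z V) :
    ∃ a, ρ.IsValue V z a := by
  choose c hc using fun (W : U.left.Opens) (hW : IsAffineOpen W) (h : W ≤ V) ↦
    toSecs_surjective Z hW (secsRes Z h z)
  have key (i j : Fin n) := exists_glue (V := V) (fun W hW h ↦ ρ.extend hW (c W hW h) i j) (by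
    intro W W' hW hW' h h'
    have h₁ := congr_fun₂ (ρ.extend_res hW hW' h' (c W hW h)) i j
    rw [Matrix.map_apply] at h₁
    refine h₁.symm.trans (congr_fun₂ (hZ.extend_eq hW' ?_) i j)
    rw [toSecs_prodRes, hc, hc]
    exact presheaf_map_map _ _ _ _)
  choose t ht using key
  refine ⟨t, fun W hW h c' hc' ↦ ?_⟩
  rw [hZ.extend_eq hW (hc'.trans (hc W hW h).symm)]
  ext i j
  exact ht i j W hW h

/-- The choice of the lift is irrelevant because the representation kills the ideal of `Z`. With
`IsValue.unique` this reduces each law of `toAlgHom` to a check on one lift over each affine open.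
-/
lemma Kills.isValue_of_forall {ρ : Rep U Y n} (hZ : ρ.Kills Z) {V : U.left.Opens} {z : secs Z V}
    {a : Matrix (Fin n) (Fin n) Γ(U.left, V)}
    (h : ∀ (W : U.left.Opens) (hW : IsAffineOpen W) (h : W ≤ V), ∃ c,
      toSecs Z W c = secsRes Z h z ∧ a.map (res h) = ρ.extend hW c) : ρ.IsValue V z a := by
  intro W hW hWV c hc
  obtain ⟨c', hc', h'⟩ := h W hW hWV
  rw [h', hZ.extend_eq hW (hc.trans hc'.symm)]

/-- The homomorphism on functions on `Z` defined by a representation which factors. -/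
def Kills.toAlgHom {ρ : Rep U Y n} (hZ : ρ.Kills Z) : AlgHomOver Z n where
  app V :=
    { toFun z := (hZ.exists_isValue V z).choose
      map_zero' := (hZ.exists_isValue V 0).choose_spec.unique (hZ.isValue_of_forall fun W hW h ↦
        ⟨0, by simp, by simp⟩)
      map_add' z z' := (hZ.exists_isValue V (z + z')).choose_spec.unique
        (hZ.isValue_of_forall fun W hW h ↦ by
          obtain ⟨c, hc⟩ := toSecs_surjective Z hW (secsRes Z h z)
          obtain ⟨c', hc'⟩ := toSecs_surjective Z hW (secsRes Z h z')
          refine ⟨c + c', by rw [map_add, map_add, hc, hc'], ?_⟩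
          rw [map_add, ← (hZ.exists_isValue V z).choose_spec W hW h c hc,
            ← (hZ.exists_isValue V z').choose_spec W hW h c' hc']
          exact Matrix.map_add _ (map_add _) _ _)
      map_mul' z z' := (hZ.exists_isValue V (z * z')).choose_spec.unique
        (hZ.isValue_of_forall fun W hW h ↦ by
          obtain ⟨c, hc⟩ := toSecs_surjective Z hW (secsRes Z h z)
          obtain ⟨c', hc'⟩ := toSecs_surjective Z hW (secsRes Z h z')
          refine ⟨c * c', by rw [map_mul, map_mul, hc, hc'], ?_⟩
          rw [map_mul, ← (hZ.exists_isValue V z).choose_spec W hW h c hc,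
            ← (hZ.exists_isValue V z').choose_spec W hW h c' hc']
          exact Matrix.map_mul) }
  map_smul V a z := (hZ.exists_isValue V _).choose_spec.unique
    (hZ.isValue_of_forall fun W hW h ↦ by
      obtain ⟨c, hc⟩ := toSecs_surjective Z hW (secsRes Z h z)
      refine ⟨fstFun U Y W (res h a) * c, ?_, ?_⟩
      · rw [map_mul, map_mul, hc, ← prodRes_fstFun, toSecs_prodRes, toSecs_fstFun]
      · rw [extend_fstFun_mul, ← (hZ.exists_isValue V z).choose_spec W hW h c hc]
        ext i j
        simp only [Matrix.map_apply, Matrix.smul_apply, smul_eq_mul, map_mul]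
        rfl)
  naturality {V' V} hV z := (hZ.exists_isValue V' _).choose_spec.unique
    (hZ.isValue_of_forall fun W hW h ↦ by
      obtain ⟨c, hc⟩ := toSecs_surjective Z hW (secsRes Z (h.trans hV) z)
      refine ⟨c, ?_, ?_⟩
      · rw [hc]
        exact (presheaf_map_map _ _ _ _).symm
      · rw [← (hZ.exists_isValue V z).choose_spec W hW (h.trans hV) c hc]
        ext i j
        simp only [Matrix.map_apply]
        exact presheaf_map_map _ _ _ _)

lemma Kills.rep_toAlgHom {ρ : Rep U Y n} (hZ : ρ.Kills Z) : hZ.toAlgHom.rep = ρ := by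
  refine Rep.ext (NonUnitalRingHom.ext fun b ↦ ?_)
  rw [AlgHomOver.rep_toHom]
  refine (hZ.exists_isValue ⊤ _).choose_spec.unique (hZ.isValue_of_forall fun W hW h ↦
    ⟨sndFun U Y W b, ?_, ?_⟩)
  · rw [← toSecs_prodRes, prodRes_sndFun]
  · rw [extend_sndFun]

end Rep

end

end KCorr

/-! ### The category of matrix representations -/

namespace KCorr

noncomputable section

variable {S : Scheme.{u}} {U Y : Over S}

variable (U Y) in
/-- Matrix representations, of arbitrary size, of functions on `Y` over `U`. -/
structure MatRep where
  /-- the size of the matrices -/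
  n : ℕ
  /-- the representation -/
  rep : Rep U Y n

namespace MatRep

/-- A matrix intertwining two matrix representations. -/
@[ext]
structure Hom (A B : MatRep U Y) where
  /-- the matrix -/
  mat : Matrix (Fin B.n) (Fin A.n) Γ(U.left, ⊤)
  one_mul : B.rep.toHom 1 * mat = mat
  mul_one : mat * A.rep.toHom 1 = mat
  comm (b) : mat * A.rep.toHom b = B.rep.toHom b * mat

instance : Category (MatRep U Y) where
  Hom A B := Hom A B
  -- The identity is the idempotent of the representation and not the unit matrix: matrices
  -- normalised on both sides by the idempotents stand for maps between their images.
  id A := ⟨A.rep.toHom 1, by rw [← map_mul, _root_.one_mul], by rw [← map_mul, _root_.one_mul],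
    fun b ↦ by rw [← map_mul, ← map_mul, mul_comm]⟩
  comp {A B C} f g := ⟨g.mat * f.mat, by rw [← Matrix.mul_assoc, g.one_mul],
    by rw [Matrix.mul_assoc, f.mul_one],
    fun b ↦ by rw [Matrix.mul_assoc, f.comm, ← Matrix.mul_assoc, g.comm, Matrix.mul_assoc]⟩
  id_comp f := Hom.ext f.mul_one
  comp_id f := Hom.ext f.one_mul
  assoc f g h := Hom.ext (Matrix.mul_assoc _ _ _).symm

variable {A B C : MatRep U Y}

/-- The matrix of a morphism. -/
def mat (f : A ⟶ B) : Matrix (Fin B.n) (Fin A.n) Γ(U.left, ⊤) := Hom.mat f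

@[ext]
lemma hom_ext {f g : A ⟶ B} (h : mat f = mat g) : f = g := Hom.ext h

lemma one_mul_mat (f : A ⟶ B) : B.rep.toHom 1 * mat f = mat f := Hom.one_mul f
lemma mat_mul_one (f : A ⟶ B) : mat f * A.rep.toHom 1 = mat f := Hom.mul_one f
lemma mat_comm (f : A ⟶ B) (b) : mat f * A.rep.toHom b = B.rep.toHom b * mat f := Hom.comm f b

@[simp] lemma mat_id : mat (𝟙 A) = A.rep.toHom 1 := rfl
@[simp] lemma mat_comp (f : A ⟶ B) (g : B ⟶ C) : mat (f ≫ g) = mat g * mat f := rfl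

instance : Zero (A ⟶ B) := ⟨(⟨0, by simp, by simp, by simp⟩ : Hom A B)⟩
instance : Add (A ⟶ B) := ⟨fun f g ↦ (⟨mat f + mat g,
  by rw [Matrix.mul_add, one_mul_mat, one_mul_mat], by rw [Matrix.add_mul, mat_mul_one, mat_mul_one],
  fun b ↦ by rw [Matrix.add_mul, Matrix.mul_add, mat_comm, mat_comm]⟩ : Hom A B)⟩
instance : Neg (A ⟶ B) := ⟨fun f ↦ (⟨-mat f, by rw [Matrix.mul_neg, one_mul_mat],
  by rw [Matrix.neg_mul, mat_mul_one], fun b ↦ by rw [Matrix.neg_mul, Matrix.mul_neg, mat_comm]⟩ : Hom A B)⟩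

@[simp] lemma mat_zero : mat (0 : A ⟶ B) = 0 := rfl
@[simp] lemma mat_add (f g : A ⟶ B) : mat (f + g) = mat f + mat g := rfl
@[simp] lemma mat_neg (f : A ⟶ B) : mat (-f) = -mat f := rfl

instance : AddCommGroup (A ⟶ B) where
  add_assoc f g h := by ext1; simp [add_assoc]
  zero_add f := by ext1; simp
  add_zero f := by ext1; simp
  add_comm f g := by ext1; simp [add_comm]
  neg_add_cancel f := by ext1; simp
  nsmul := nsmulRec
  zsmul := zsmulRec

instance : Preadditive (MatRep U Y) where
  add_comp _ _ _ f g h := by ext1; simp [Matrix.mul_add]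
  comp_add _ _ _ f g h := by ext1; simp [Matrix.add_mul]

/-- Strict equality of functors requires comparing morphisms between propositionally equal objects.
Indices are matched by their numerical values, so that no transport along equal sizes is needed. -/
lemma hom_heq {A' B' : MatRep U Y} (hA : A = A') (hB : B = B') (f : A ⟶ B) (g : A' ⟶ B')
    (h : ∀ i j i' j', i'.val = i.val → j'.val = j.val → mat f i j = mat g i' j') : f ≍ g := by
  subst hA hB
  refine heq_of_eq (hom_ext ?_)
  ext i j
  exact h i j i j rfl rfl

/-- Pullback of matrix representations. -/
def pull {U' : Over S} (f : U' ⟶ U) (Y : Over S) : MatRep U Y ⥤ MatRep U' Y where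
  obj A := ⟨A.n, A.rep.map f⟩
  map {A B} a := (⟨(mat a).map f.left.appTop, by
      rw [Rep.map_toHom, ← Matrix.map_mul, one_mul_mat], by
      rw [Rep.map_toHom, ← Matrix.map_mul, mat_mul_one], fun b ↦ by
      rw [Rep.map_toHom, ← Matrix.map_mul, mat_comm, Rep.map_toHom, Matrix.map_mul]⟩ :
        Hom ⟨A.n, A.rep.map f⟩ ⟨B.n, B.rep.map f⟩)
  map_id A := rfl
  map_comp a b := hom_ext Matrix.map_mul

instance {U' : Over S} (f : U' ⟶ U) : (pull f Y).Additive where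
  map_add := hom_ext (Matrix.map_add _ (map_add _) _ _)

lemma pull_id (U Y : Over S) : pull (𝟙 U) Y = 𝟭 (MatRep U Y) := by
  refine Functor.hext (fun A ↦ congr_arg (MatRep.mk A.n) A.rep.map_id) fun A B a ↦ ?_
  refine hom_heq (congr_arg (MatRep.mk A.n) A.rep.map_id) (congr_arg (MatRep.mk B.n) B.rep.map_id)
    _ _ fun i j i' j' hi hj ↦ ?_
  obtain rfl : i' = i := Fin.ext hi
  obtain rfl : j' = j := Fin.ext hj
  rfl

lemma pull_comp {U'' U' : Over S} (f₁ : U'' ⟶ U') (f : U' ⟶ U) (Y : Over S) :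
    pull (f₁ ≫ f) Y = pull f Y ⋙ pull f₁ Y := by
  refine Functor.hext (fun A ↦ congr_arg (MatRep.mk A.n) (A.rep.map_comp f₁ f)) fun A B a ↦ ?_
  refine hom_heq (congr_arg (MatRep.mk A.n) (A.rep.map_comp f₁ f))
    (congr_arg (MatRep.mk B.n) (B.rep.map_comp f₁ f)) _ _ fun i j i' j' hi hj ↦ ?_
  obtain rfl : i' = i := Fin.ext hi
  obtain rfl : j' = j := Fin.ext hj
  rfl

end MatRep

/-! ### Biproducts of matrix representations -/

namespace MatRep

variable {A B : MatRep U Y}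

/-- The first inclusion matrix of a direct sum. -/
def inlM (A B : MatRep U Y) : Matrix (Fin (A.n + B.n)) (Fin A.n) Γ(U.left, ⊤) :=
  Matrix.of fun i j ↦ if i = Fin.castAdd B.n j then 1 else 0

/-- The second inclusion matrix of a direct sum. -/
def inrM (A B : MatRep U Y) : Matrix (Fin (A.n + B.n)) (Fin B.n) Γ(U.left, ⊤) :=
  Matrix.of fun i j ↦ if i = Fin.natAdd A.n j then 1 else 0

/-- The first projection matrix of a direct sum. -/
def fstM (A B : MatRep U Y) : Matrix (Fin A.n) (Fin (A.n + B.n)) Γ(U.left, ⊤) :=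
  Matrix.of fun i j ↦ if Fin.castAdd B.n i = j then 1 else 0

/-- The second projection matrix of a direct sum. -/
def sndM (A B : MatRep U Y) : Matrix (Fin B.n) (Fin (A.n + B.n)) Γ(U.left, ⊤) :=
  Matrix.of fun i j ↦ if Fin.natAdd A.n i = j then 1 else 0

section

variable {p : ℕ}

/-- The trailing factor `M` makes this and the next three identities usable for rewriting inside
right-associated products. -/
lemma fstM_inlM (M : Matrix (Fin A.n) (Fin p) Γ(U.left, ⊤)) :
    fstM A B * (inlM A B * M) = M := by
  have : fstM A B * inlM A B = 1 := by
    ext i j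
    simp [fstM, inlM, Matrix.mul_apply, Matrix.one_apply]
  rw [← Matrix.mul_assoc, this, Matrix.one_mul]

lemma sndM_inrM (M : Matrix (Fin B.n) (Fin p) Γ(U.left, ⊤)) :
    sndM A B * (inrM A B * M) = M := by
  have : sndM A B * inrM A B = 1 := by
    ext i j
    simp [sndM, inrM, Matrix.mul_apply, Matrix.one_apply]
  rw [← Matrix.mul_assoc, this, Matrix.one_mul]

lemma fstM_inrM (M : Matrix (Fin B.n) (Fin p) Γ(U.left, ⊤)) :
    fstM A B * (inrM A B * M) = 0 := by
  have : fstM A B * inrM A B = 0 := by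
    ext i j
    have h : ¬ Fin.castAdd B.n i = Fin.natAdd A.n j := fun h ↦ by
      have := congr_arg Fin.val h
      simp only [Fin.val_castAdd, Fin.val_natAdd] at this
      omega
    simp [fstM, inrM, Matrix.mul_apply, h]
  rw [← Matrix.mul_assoc, this, Matrix.zero_mul]

lemma sndM_inlM (M : Matrix (Fin A.n) (Fin p) Γ(U.left, ⊤)) :
    sndM A B * (inlM A B * M) = 0 := by
  have : sndM A B * inlM A B = 0 := by
    ext i j
    have h : ¬ Fin.natAdd A.n i = Fin.castAdd B.n j := fun h ↦ by
      have := congr_arg Fin.val h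
      simp only [Fin.val_castAdd, Fin.val_natAdd] at this
      omega
    simp [sndM, inlM, Matrix.mul_apply, h]
  rw [← Matrix.mul_assoc, this, Matrix.zero_mul]

end

lemma rep_mul_assoc (A : MatRep U Y) (b b') {p : ℕ} (M : Matrix (Fin A.n) (Fin p) Γ(U.left, ⊤)) :
    A.rep.toHom b * (A.rep.toHom b' * M) = A.rep.toHom (b * b') * M := by
  rw [← Matrix.mul_assoc, ← map_mul]

/-- The matrices of the direct sum of matrix representations. -/
def directSumM (A B : MatRep U Y) (b : Γ(Y.left, ⊤)) :
    Matrix (Fin (A.n + B.n)) (Fin (A.n + B.n)) Γ(U.left, ⊤) :=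
  inlM A B * (A.rep.toHom b * fstM A B) + inrM A B * (B.rep.toHom b * sndM A B)

/-- The direct sum of matrix representations. -/
def directSum (A B : MatRep U Y) : MatRep U Y where
  n := A.n + B.n
  rep :=
    { toHom :=
        { toFun := directSumM A B
          map_zero' := by simp [directSumM]
          map_add' a b := by
            simp only [directSumM, map_add, Matrix.add_mul, Matrix.mul_add]
            abel
          map_mul' a b := by
            simp only [directSumM, Matrix.add_mul, Matrix.mul_add, Matrix.mul_assoc, fstM_inlM,
              sndM_inrM, fstM_inrM, sndM_inlM, Matrix.mul_zero, add_zero, zero_add,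
              rep_mul_assoc] }
      map_smul s b := by
        change directSumM A B _ = _ • directSumM A B _
        rw [directSumM, A.rep.map_smul, B.rep.map_smul]
        simp only [directSumM, Matrix.smul_mul, Matrix.mul_smul, smul_add] }

/-- The first projection from the direct sum. -/
def fst (A B : MatRep U Y) : directSum A B ⟶ A := by
  -- The plain block projection is not normalised; the idempotent has to be multiplied in.
  refine Hom.mk (A := directSum A B) (A.rep.toHom 1 * fstM A B) ?_ ?_ fun b ↦ ?_
  · exact (rep_mul_assoc ..).trans (by rw [mul_one])
  · change A.rep.toHom 1 * fstM A B * directSumM A B 1 = A.rep.toHom 1 * fstM A B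
    simp only [directSumM, Matrix.mul_add, Matrix.mul_assoc, fstM_inlM, fstM_inrM, rep_mul_assoc,
      Matrix.mul_zero, add_zero, mul_one]
  · change A.rep.toHom 1 * fstM A B * directSumM A B b = A.rep.toHom b * (A.rep.toHom 1 * fstM A B)
    simp only [directSumM, Matrix.mul_add, Matrix.mul_assoc, fstM_inlM, fstM_inrM, rep_mul_assoc,
      Matrix.mul_zero, add_zero, mul_one, one_mul]

/-- The second projection from the direct sum. -/
def snd (A B : MatRep U Y) : directSum A B ⟶ B := by
  refine Hom.mk (A := directSum A B) (B.rep.toHom 1 * sndM A B) ?_ ?_ fun b ↦ ?_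
  · exact (rep_mul_assoc ..).trans (by rw [mul_one])
  · change B.rep.toHom 1 * sndM A B * directSumM A B 1 = B.rep.toHom 1 * sndM A B
    simp only [directSumM, Matrix.mul_add, Matrix.mul_assoc, sndM_inlM, sndM_inrM, rep_mul_assoc,
      Matrix.mul_zero, zero_add, mul_one]
  · change B.rep.toHom 1 * sndM A B * directSumM A B b = B.rep.toHom b * (B.rep.toHom 1 * sndM A B)
    simp only [directSumM, Matrix.mul_add, Matrix.mul_assoc, sndM_inlM, sndM_inrM, rep_mul_assoc,
      Matrix.mul_zero, zero_add, mul_one, one_mul]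

/-- The first inclusion into the direct sum. -/
def inl (A B : MatRep U Y) : A ⟶ directSum A B := by
  refine Hom.mk (B := directSum A B) (inlM A B * A.rep.toHom 1) ?_ ?_ fun b ↦ ?_
  · change directSumM A B 1 * (inlM A B * A.rep.toHom 1) = inlM A B * A.rep.toHom 1
    simp only [directSumM, Matrix.add_mul, Matrix.mul_assoc, fstM_inlM, sndM_inlM, ← map_mul,
      Matrix.mul_zero, add_zero, mul_one]
  · change inlM A B * A.rep.toHom 1 * A.rep.toHom 1 = inlM A B * A.rep.toHom 1
    rw [Matrix.mul_assoc, ← map_mul, mul_one]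
  · change inlM A B * A.rep.toHom 1 * A.rep.toHom b = directSumM A B b * (inlM A B * A.rep.toHom 1)
    simp only [directSumM, Matrix.add_mul, Matrix.mul_assoc, fstM_inlM, sndM_inlM, ← map_mul,
      Matrix.mul_zero, add_zero, mul_one, one_mul]

/-- The second inclusion into the direct sum. -/
def inr (A B : MatRep U Y) : B ⟶ directSum A B := by
  refine Hom.mk (B := directSum A B) (inrM A B * B.rep.toHom 1) ?_ ?_ fun b ↦ ?_
  · change directSumM A B 1 * (inrM A B * B.rep.toHom 1) = inrM A B * B.rep.toHom 1
    simp only [directSumM, Matrix.add_mul, Matrix.mul_assoc, fstM_inrM, sndM_inrM, ← map_mul,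
      Matrix.mul_zero, zero_add, mul_one]
  · change inrM A B * B.rep.toHom 1 * B.rep.toHom 1 = inrM A B * B.rep.toHom 1
    rw [Matrix.mul_assoc, ← map_mul, mul_one]
  · change inrM A B * B.rep.toHom 1 * B.rep.toHom b = directSumM A B b * (inrM A B * B.rep.toHom 1)
    simp only [directSumM, Matrix.add_mul, Matrix.mul_assoc, fstM_inrM, sndM_inrM, ← map_mul,
      Matrix.mul_zero, zero_add, mul_one, one_mul]

/-- The direct sum as a bicone. -/
def bicone (A B : MatRep U Y) : BinaryBicone A B where
  pt := directSum A B
  fst := fst A B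
  snd := snd A B
  inl := inl A B
  inr := inr A B
  inl_fst := hom_ext (by
    change A.rep.toHom 1 * fstM A B * (inlM A B * A.rep.toHom 1) = A.rep.toHom 1
    rw [Matrix.mul_assoc, fstM_inlM, ← map_mul, mul_one])
  inl_snd := hom_ext (by
    change B.rep.toHom 1 * sndM A B * (inlM A B * A.rep.toHom 1) = 0
    rw [Matrix.mul_assoc, sndM_inlM, Matrix.mul_zero])
  inr_fst := hom_ext (by
    change A.rep.toHom 1 * fstM A B * (inrM A B * B.rep.toHom 1) = 0
    rw [Matrix.mul_assoc, fstM_inrM, Matrix.mul_zero])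
  inr_snd := hom_ext (by
    change B.rep.toHom 1 * sndM A B * (inrM A B * B.rep.toHom 1) = B.rep.toHom 1
    rw [Matrix.mul_assoc, sndM_inrM, ← map_mul, mul_one])

instance : HasBinaryBiproducts (MatRep U Y) where
  has_binary_biproduct A B := hasBinaryBiproduct_of_total (bicone A B) (hom_ext (by
    change inlM A B * A.rep.toHom 1 * (A.rep.toHom 1 * fstM A B) +
      inrM A B * B.rep.toHom 1 * (B.rep.toHom 1 * sndM A B) = directSumM A B 1
    simp only [directSumM, Matrix.mul_assoc, rep_mul_assoc, mul_one]))

instance : HasZeroObject (MatRep U Y) where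
  zero := ⟨⟨0, ⟨0, fun s b ↦ by ext i; exact i.elim0⟩⟩, (IsZero.iff_id_eq_zero _).mpr
    (hom_ext (by ext i; exact i.elim0))⟩

instance : HasFiniteBiproducts (MatRep U Y) :=
  have : HasFiniteProducts (MatRep U Y) := hasFiniteProducts_of_has_binary_and_terminal
  HasFiniteBiproducts.of_hasFiniteProducts

end MatRep

end

end KCorr

/-! ### The functor from `𝒜(U, Y)` to matrix representations -/

namespace KCorr

noncomputable section

variable {S : Scheme.{u}} {U Y : Over S}

lemma res_top (x : Γ(U.left, ⊤)) : res (U := U) (le_refl ⊤) x = x :=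
  congr($(U.left.presheaf.map_id _) x)

lemma map_res_top {n m : ℕ} (M : Matrix (Fin n) (Fin m) Γ(U.left, ⊤)) :
    M.map (res (U := U) (le_refl ⊤)) = M := by
  ext i j
  exact res_top _

/-- Functions on V × Y are combinations of functions on `Y` with scalars from `V`, and scalars
commute with matrices. Intertwining is thus only a condition on functions on `Y`. -/
lemma Rep.extend_comm [IsAffine S] [IsAffine Y.left] {n m : ℕ} (ρ : Rep U Y n) (σ : Rep U Y m)
    (M : Matrix (Fin m) (Fin n) Γ(U.left, ⊤)) (h : ∀ b, M * ρ.toHom b = σ.toHom b * M)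
    {V : U.left.Opens} (hV : IsAffineOpen V) (c) :
    (M.map (res (le_top : V ≤ ⊤)) : Matrix (Fin m) (Fin n) Γ(U.left, V)) *
        (ρ.extend hV c : Matrix (Fin n) (Fin n) Γ(U.left, V)) =
      (σ.extend hV c : Matrix (Fin m) (Fin m) Γ(U.left, V)) *
        (M.map (res (le_top : V ≤ ⊤)) : Matrix (Fin m) (Fin n) Γ(U.left, V)) := by
  obtain ⟨r, x, b, rfl⟩ := exists_sum hV c
  simp only [map_sum, Rep.extend_mul, Matrix.sum_mul, Matrix.mul_sum]
  refine Finset.sum_congr rfl fun l _ ↦ ?_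
  rw [Matrix.mul_smul, Matrix.smul_mul, ← Matrix.map_mul, ← Matrix.map_mul, h]

namespace Corr

/-- The matrix representation of functions on `Y` defined by an object of `𝒜(U, Y)`. -/
def rep (Φ : Corr U Y) : Rep U Y Φ.n :=
  Quotient.lift (fun T : Triple U Y Φ.n ↦ T.φ.rep) (by
    rintro T T' ⟨T'', h, h', e, e'⟩
    rw [← T.φ.rep_extend h, ← e, e', AlgHomOver.rep_extend]) Φ.cls

lemma Represents.rep_eq {Φ : Corr U Y} {Z : (prod U Y).IdealSheafData} {hZ : Z ∈ SubSch U Y}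
    {φ : AlgHomOver Z Φ.n} (h : Φ.Represents hZ φ) : φ.rep = Φ.rep := by
  rw [Corr.rep, h]
  rfl

lemma idem_eq (Φ : Corr U Y) (V : U.left.Opens) :
    Φ.idem V = (Φ.rep.toHom 1).map (res le_top) := by
  obtain ⟨Z, hZ, φ, h⟩ := Φ.exists_represents
  rw [← h.rep_eq, AlgHomOver.rep_toHom, map_one, map_one, ← φ.naturality, map_one, idem, h]
  rfl

lemma idem_top (Φ : Corr U Y) : Φ.idem ⊤ = Φ.rep.toHom 1 := by
  rw [idem_eq, map_res_top]

lemma idem_mul_idem (Φ : Corr U Y) (V : U.left.Opens) : Φ.idem V * Φ.idem V = Φ.idem V := by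
  rw [idem_eq, ← Matrix.map_mul, ← map_mul, mul_one]

lemma idem_mulVec {Φ : Corr U Y} {V : U.left.Opens} (x : Φ.P V) :
    (Φ.idem V).mulVec x.1 = x.1 := by
  obtain ⟨_, y, rfl⟩ := x
  change (Φ.idem V).mulVec ((Φ.idem V).mulVec y) = (Φ.idem V).mulVec y
  rw [Matrix.mulVec_mulVec, idem_mul_idem]

/-- The matrix representation, with its size, defined by an object of `𝒜(U, Y)`. -/
def matRep (Φ : Corr U Y) : MatRep U Y := ⟨Φ.n, Φ.rep⟩

/-- The projection of the standard basis vectors to `P(Φ)`. -/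
def basis (Φ : Corr U Y) (V : U.left.Opens) (j : Fin Φ.n) : Φ.P V :=
  ⟨(Φ.idem V).mulVec (Pi.single j 1), ⟨Pi.single j 1, rfl⟩⟩

lemma basis_apply (Φ : Corr U Y) (V : U.left.Opens) (i j : Fin Φ.n) :
    (Φ.basis V j).1 i = Φ.idem V i j := by
  simp [basis]

lemma sum_smul_basis (Φ : Corr U Y) (V : U.left.Opens) (x : Φ.P V) :
    ∑ j, x.1 j • Φ.basis V j = x := by
  refine Subtype.ext (funext fun i ↦ ?_)
  conv_rhs => rw [← idem_mulVec x]
  simp [basis_apply, Matrix.mulVec, dotProduct, mul_comm]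

variable {Φ Ψ Ω : Corr U Y}

/-- The matrix of a morphism of `𝒜(U, Y)`. -/
def mat (α : Φ ⟶ Ψ) : Matrix (Fin Ψ.n) (Fin Φ.n) Γ(U.left, ⊤) :=
  Matrix.of fun i j ↦ (homApp α ⊤ (Φ.basis ⊤ j)).1 i

/-- P(Φ)(V) is spanned by projected basis vectors, which are restrictions of global sections even if
`U` is not affine. Naturality then forces the matrix over `V` to be the restriction of the global
one. -/
lemma homApp_apply (α : Φ ⟶ Ψ) (V : U.left.Opens) (x : Φ.P V) :
    (homApp α V x).1 = ((mat α).map (res le_top)).mulVec x.1 := by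
  ext i
  conv_lhs => rw [← sum_smul_basis Φ V x]
  have key (j : Fin Φ.n) : (homApp α V (Φ.basis V j)).1 i = res le_top (mat α i j) := by
    refine α.2.1 (le_top : V ≤ ⊤) (Φ.basis ⊤ j) (Φ.basis V j) (fun i ↦ ?_) i
    rw [basis_apply, basis_apply, idem_eq, idem_eq]
    simp only [Matrix.map_apply]
    refine congr_arg _ ?_
    exact (congr($(U.left.presheaf.map_id _) _)).symm
  simp [key, Matrix.mulVec, dotProduct, mul_comm]

lemma mat_injective : Function.Injective (mat : (Φ ⟶ Ψ) → _) := fun α β h ↦ by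
  refine Subtype.ext (funext fun V ↦ LinearMap.ext fun x ↦ Subtype.ext ?_)
  refine (homApp_apply α V x).trans (Eq.trans ?_ (homApp_apply β V x).symm)
  rw [h]

lemma homApp_top (α : Φ ⟶ Ψ) (x : Φ.P ⊤) : (homApp α ⊤ x).1 = (mat α).mulVec x.1 := by
  rw [homApp_apply, map_res_top]

lemma mat_mul_idem (α : Φ ⟶ Ψ) : mat α * Φ.rep.toHom 1 = mat α := by
  refine Matrix.ext_of_mulVec_single fun j ↦ ?_
  rw [← Matrix.mulVec_mulVec, ← idem_top]
  refine (homApp_top α (Φ.basis ⊤ j)).symm.trans ?_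
  ext i
  simp [mat]

lemma idem_mul_mat (α : Φ ⟶ Ψ) : Ψ.rep.toHom 1 * mat α = mat α := by
  refine Matrix.ext_of_mulVec_single fun j ↦ ?_
  rw [← Matrix.mulVec_mulVec, ← idem_top]
  have : (mat α).mulVec (Pi.single j 1) = (homApp α ⊤ (Φ.basis ⊤ j)).1 := by
    ext i
    simp [mat]
  rw [this, idem_mulVec]

lemma mat_comm (α : Φ ⟶ Ψ) (b) : mat α * Φ.rep.toHom b = Ψ.rep.toHom b * mat α := by
  obtain ⟨Z, hZ, φ, ψ, hφ, hψ, h⟩ := α.2.2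
  -- Linearity over the support is known only on P(Φ), so the identity is first proved on the image
  -- of the idempotent, which both sides absorb afterwards.
  have key : mat α * Φ.rep.toHom b * Φ.rep.toHom 1 = Ψ.rep.toHom b * mat α * Φ.rep.toHom 1 := by
    refine Matrix.ext_of_mulVec_single fun j ↦ ?_
    have hb : Φ.rep.toHom b * Φ.rep.toHom 1 = Φ.rep.toHom 1 * Φ.rep.toHom b := by
      rw [← map_mul, ← map_mul, mul_comm]
    let x' : Φ.P ⊤ := ⟨(Φ.rep.toHom b * Φ.rep.toHom 1).mulVec (Pi.single j 1), by
      refine ⟨(Φ.rep.toHom b).mulVec (Pi.single j 1), ?_⟩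
      rw [hb, idem_top, ← Matrix.mulVec_mulVec]
      rfl⟩
    have hx : (Φ.basis ⊤ j).1 = (Φ.rep.toHom 1).mulVec (Pi.single j 1) := by
      rw [← idem_top]; rfl
    have := h ⊤ (toSecs Z ⊤ (sndFun U Y ⊤ b)) (Φ.basis ⊤ j) x' (by
      rw [← AlgHomOver.rep_toHom, hφ.rep_eq, hx, Matrix.mulVec_mulVec])
    rw [← AlgHomOver.rep_toHom, hψ.rep_eq] at this
    have h' := (homApp_top α x').symm.trans (this.trans
      (congr_arg (Ψ.rep.toHom b).mulVec (homApp_top α (Φ.basis ⊤ j))))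
    rw [hx, Matrix.mulVec_mulVec, Matrix.mulVec_mulVec, Matrix.mulVec_mulVec,
      ← Matrix.mul_assoc] at h'
    exact h'
  rw [Matrix.mul_assoc, ← map_mul, mul_one, Matrix.mul_assoc, mat_mul_idem] at key
  exact key

lemma mat_id (Φ : Corr U Y) : mat (𝟙 Φ) = Φ.rep.toHom 1 := by
  ext i j
  rw [← idem_top]
  exact basis_apply _ _ _ _

lemma mat_comp (α : Φ ⟶ Ψ) (β : Ψ ⟶ Ω) : mat (α ≫ β) = mat β * mat α := by
  ext i j
  have : (mat α).col j = (homApp α ⊤ (Φ.basis ⊤ j)).1 := by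
    ext i
    simp [mat]
  change (homApp β ⊤ (homApp α ⊤ (Φ.basis ⊤ j))).1 i = _
  rw [homApp_top, ← this]
  rfl

variable (U Y) in
/-- The functor from `𝒜(U, Y)` to matrix representations. -/
def toMat : Corr U Y ⥤ MatRep U Y where
  obj Φ := Φ.matRep
  map {Φ Ψ} α := (⟨mat α, idem_mul_mat α, mat_mul_idem α, mat_comm α⟩ :
    MatRep.Hom Φ.matRep Ψ.matRep)
  map_id Φ := MatRep.hom_ext (mat_id Φ)
  map_comp α β := MatRep.hom_ext (mat_comp α β)

instance : (toMat U Y).Faithful where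
  map_injective h := mat_injective congr(MatRep.mat $h)

instance : (toMat U Y).Additive where
  map_add := rfl

variable [IsAffine S] [IsAffine Y.left]

/-- Two triples with the same representation become homomorphisms on a common larger closed
subscheme that agree by `ext_rep`. This is exactly the equivalence relation on triples. -/
lemma toMat_obj_injective : Function.Injective (toMat U Y).obj := by
  rintro ⟨n, c⟩ ⟨m, d⟩ h
  obtain rfl : n = m := congr_arg MatRep.n h
  have h' : (⟨n, c⟩ : Corr U Y).rep = (⟨n, d⟩ : Corr U Y).rep := by
    simpa [toMat, matRep] using h
  congr 1
  obtain ⟨⟨Z, hZ, φ⟩, rfl⟩ := Quotient.exists_rep c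
  obtain ⟨⟨Z', hZ', φ'⟩, rfl⟩ := Quotient.exists_rep d
  obtain ⟨W, hW, h₁, h₂⟩ := SubSch.directed hZ hZ'
  refine Quotient.sound ⟨⟨W, hW, φ.extend h₁⟩, h₁, h₂, rfl, AlgHomOver.ext_rep ?_⟩
  rw [AlgHomOver.rep_extend, AlgHomOver.rep_extend]
  exact h'

lemma exists_mat_eq (M : Matrix (Fin Ψ.n) (Fin Φ.n) Γ(U.left, ⊤)) (h₁ : Ψ.rep.toHom 1 * M = M)
    (h₂ : M * Φ.rep.toHom 1 = M) (h₃ : ∀ b, M * Φ.rep.toHom b = Ψ.rep.toHom b * M) :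
    ∃ α : Φ ⟶ Ψ, mat α = M := by
  have hP (V : U.left.Opens) (x : Φ.P V) :
      (M.map (res (le_top : V ≤ ⊤))).mulVec x.1 ∈ Ψ.P V := by
    refine ⟨(M.map (res (le_top : V ≤ ⊤))).mulVec x.1, ?_⟩
    change (Ψ.idem V).mulVec _ = _
    rw [Matrix.mulVec_mulVec, idem_eq, ← Matrix.map_mul, h₁]
  let α : PreHom Φ Ψ := fun V ↦
    ((Matrix.mulVecLin (M.map (res (le_top : V ≤ ⊤)))).restrict fun x hx ↦
      hP V ⟨x, hx⟩)
  have hnat : α.IsNatural := by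
    intro V' V h x x' hx j
    change (M.map (res (le_top : V' ≤ ⊤))).mulVec x'.1 j =
      res h ((M.map (res (le_top : V ≤ ⊤))).mulVec x.1 j)
    simp only [Matrix.mulVec, dotProduct, map_sum, map_mul, hx, Matrix.map_apply]
    refine Finset.sum_congr rfl fun i _ ↦ congr_arg (· * res h (x.1 i)) ?_
    exact (presheaf_map_map _ _ _ _).symm
  have hlin : α.IsSupportLinear := by
    obtain ⟨Z₁, hZ₁, φ, hφ⟩ := Φ.exists_represents
    obtain ⟨Z₂, hZ₂, ψ, hψ⟩ := Ψ.exists_represents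
    obtain ⟨Z, hZ, l₁, l₂⟩ := SubSch.directed hZ₁ hZ₂
    refine ⟨Z, hZ, φ.extend l₁, ψ.extend l₂, hφ.extend hZ _, hψ.extend hZ _, ?_⟩
    intro V z x x' hx
    change (M.map (res (le_top : V ≤ ⊤))).mulVec x'.1 =
      ((ψ.extend l₂).app V z).mulVec ((M.map (res (le_top : V ≤ ⊤))).mulVec x.1)
    rw [hx, Matrix.mulVec_mulVec, Matrix.mulVec_mulVec]
    congr 1
    -- Linearity over functions on `Z` is tested locally: over an affine `W` the section lifts to W
    -- × Y, where `Rep.extend_comm` applies.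
    ext i j
    refine section_ext fun y hy ↦ ?_
    obtain ⟨W, hW, hyW, hWV⟩ := exists_isAffineOpen_mem_and_subset (x := y) (U := V) hy
    refine ⟨W, hWV, hyW, ?_⟩
    obtain ⟨c, hc⟩ := toSecs_surjective Z hW (secsRes Z hWV z)
    have e₁ := (φ.extend l₁).naturality hWV z
    have e₂ := (ψ.extend l₂).naturality hWV z
    rw [← hc, AlgHomOver.app_toSecs _ hW, AlgHomOver.rep_extend] at e₁ e₂
    rw [hφ.rep_eq] at e₁
    rw [hψ.rep_eq] at e₂
    have e₃ : (M.map (res (le_top : V ≤ ⊤))).map (res hWV) =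
        M.map (res le_top) := by
      ext i j
      exact presheaf_map_map _ _ _ _
    have := Rep.extend_comm Φ.rep Ψ.rep M h₃ hW c
    rw [e₁, e₂, ← e₃, ← Matrix.map_mul, ← Matrix.map_mul] at this
    exact congr_fun₂ this i j
  refine ⟨⟨α, hnat, hlin⟩, Matrix.ext_of_mulVec_single fun j ↦ ?_⟩
  have e : (mat (⟨α, hnat, hlin⟩ : Φ ⟶ Ψ)).mulVec (Pi.single j 1) = (α ⊤ (Φ.basis ⊤ j)).1 := by
    ext i
    simp [mat]
    rfl
  refine e.trans ?_
  change (M.map (res (le_refl ⊤))).mulVec ((Φ.idem ⊤).mulVec (Pi.single j 1)) = _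
  rw [map_res_top, Matrix.mulVec_mulVec, idem_top, h₂]

instance : (toMat U Y).Full where
  map_surjective {Φ Ψ} a := by
    obtain ⟨α, hα⟩ := exists_mat_eq (Φ := Φ) (Ψ := Ψ) (MatRep.mat a) (MatRep.one_mul_mat a)
      (MatRep.mat_mul_one a) (MatRep.mat_comm a)
    exact ⟨α, MatRep.hom_ext hα⟩

end Corr

end

end KCorr

/-! ### Pullback functors and the strict inverse of `toMat` -/

namespace KCorr

noncomputable section

lemma exists_pow_le_of_le_radical {X : Scheme.{u}} [IsLocallyNoetherian X] [CompactSpace X]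
    (I J : X.IdealSheafData) (h : I ≤ J.radical) : ∃ m : ℕ, I ^ m ≤ J := by
  have key (V : X.affineOpens) : ∃ m : ℕ, I.ideal V ^ m ≤ J.ideal V := by
    have := IsLocallyNoetherian.component_noetherian V
    obtain ⟨m, hm⟩ := Ideal.exists_radical_pow_le_of_fg (J.ideal V) (IsNoetherian.noetherian _)
    exact ⟨m, (Ideal.pow_right_mono (h V) m).trans hm⟩
  choose m hm using key
  have hc (x : X) := exists_isAffineOpen_mem_and_subset (x := x) (U := ⊤) trivial
  obtain ⟨t, ht⟩ := CompactSpace.elim_nhds_subcover (fun x : X ↦ ((hc x).choose : Set X))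
    fun x ↦ IsOpen.mem_nhds (Opens.isOpen _) (hc x).choose_spec.2.1
  let W (x : X) : X.affineOpens := ⟨(hc x).choose, (hc x).choose_spec.1⟩
  refine ⟨t.sup fun x ↦ m (W x), Scheme.IdealSheafData.le_of_iSup_eq_top (ι := t)
    (fun x ↦ W x.1) ?_ fun x ↦ ?_⟩
  · refine eq_top_iff.mpr fun x _ ↦ ?_
    have hx : x ∈ ⋃ y ∈ t, ((W y).1 : Set X) := ht.ge (Set.mem_univ x)
    simp only [Set.mem_iUnion] at hx
    obtain ⟨y, hy, hxy⟩ := hx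
    exact Opens.mem_iSup.mpr ⟨⟨y, hy⟩, hxy⟩
  · rw [Scheme.IdealSheafData.ideal_pow]
    exact (Ideal.pow_le_pow_right (Finset.le_sup (f := fun x ↦ m (W x)) x.2)).trans (hm _)

lemma ker_app_SpecMap_fromSpec {X : Scheme.{u}} {V : X.Opens} (hV : IsAffineOpen V)
    {A : CommRingCat.{u}} (φ : Γ(X, V) ⟶ A) (c : Γ(X, V))
    (hc : (Spec.map φ ≫ hV.fromSpec).app V c = 0) : φ c = 0 := by
  have h : ⊤ ≤ (Spec.map φ ≫ hV.fromSpec) ⁻¹ᵁ V := by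
    rw [Scheme.Hom.comp_preimage, hV.fromSpec_preimage_self]
    exact le_rfl
  have e₀ : hV.fromSpec.appLE V ⊤ (hV.fromSpec_preimage_self.ge) = (Scheme.ΓSpecIso _).inv := by
    rw [Scheme.Hom.appLE, hV.fromSpec_app_self, Category.assoc, ← Functor.map_comp]
    refine (congr_arg _ ?_).trans (Category.comp_id _)
    exact (Spec _).presheaf.map_id _
  have e : (Spec.map φ ≫ hV.fromSpec).app V ≫ (Spec _).presheaf.map (homOfLE h).op =
      φ ≫ (Scheme.ΓSpecIso _).inv := by
    rw [Scheme.ΓSpecIso_inv_naturality, ← e₀, Scheme.Hom.appTop, Scheme.Hom.app_eq_appLE]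
    exact (Scheme.Hom.appLE_comp_appLE (Spec.map φ) hV.fromSpec V ⊤ ⊤ _ le_rfl).symm
  have h₀ := congr($e c)
  rw [CommRingCat.comp_apply, CommRingCat.comp_apply, hc, map_zero] at h₀
  refine (ConcreteCategory.bijective_of_isIso (Scheme.ΓSpecIso A).inv).1 ?_
  rw [map_zero]
  exact h₀.symm

/-- The closed subscheme of `V'` cut out by the extended ideal maps into `Z`, so it factors through
the preimage of `Z`. The ideal of the preimage thus vanishes on it. -/
lemma ideal_comap_le {X' X : Scheme.{u}} (g : X' ⟶ X) (Z : X.IdealSheafData) {V : X.Opens}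
    (hV : IsAffineOpen V) {V' : X'.Opens} (hV' : IsAffineOpen V') (h : V' ≤ g ⁻¹ᵁ V) :
    (Z.comap g).ideal ⟨V', hV'⟩ ≤ (Z.ideal ⟨V, hV⟩).map (g.appLE V V' h).hom := by
  let K := (Z.ideal ⟨V, hV⟩).map (g.appLE V V' h).hom
  let q := CommRingCat.ofHom (Ideal.Quotient.mk K)
  let j := Spec.map q ≫ hV'.fromSpec
  let l : CommRingCat.of (Γ(X, V) ⧸ Z.ideal ⟨V, hV⟩) ⟶ .of (Γ(X', V') ⧸ K) :=
    CommRingCat.ofHom (Ideal.quotientMap K (g.appLE V V' h).hom Ideal.le_comap_map)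
  have e : j ≫ g = (Spec.map l ≫ Z.subschemeCover.f ⟨V, hV⟩) ≫ Z.subschemeι := by
    have h₁ : (Spec.map l ≫ Z.subschemeCover.f ⟨V, hV⟩) ≫ Z.subschemeι = Spec.map l ≫
        Spec.map (CommRingCat.ofHom (Ideal.Quotient.mk (Z.ideal ⟨V, hV⟩))) ≫ hV.fromSpec :=
      (Category.assoc _ _ _).trans (congr_arg (Spec.map l ≫ ·)
        (Z.subschemeCover_map_subschemeι ⟨V, hV⟩))
    have h₂ : j ≫ g = Spec.map q ≫ Spec.map (g.appLE V V' h) ≫ hV.fromSpec := by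
      rw [IsAffineOpen.SpecMap_appLE_fromSpec g hV hV' h]
      exact Category.assoc _ _ _
    rw [h₁, h₂, ← Spec.map_comp_assoc, ← Spec.map_comp_assoc]
    rfl
  have hle : Z.comap g ≤ j.ker := by
    rw [← Scheme.IdealSheafData.le_map_iff_comap_le, Scheme.IdealSheafData.map_ker, e]
    conv_lhs => rw [← Z.ker_subschemeι]
    exact Scheme.Hom.le_ker_comp _ _
  intro c hc
  have := Scheme.IdealSheafData.ideal_ofIdeals_le _ ⟨V', hV'⟩ (hle ⟨V', hV'⟩ hc)
  exact Ideal.Quotient.eq_zero_iff_mem.mp (ker_app_SpecMap_fromSpec hV' q c this)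

variable {S : Scheme.{u}} {U' U Y : Over S}

lemma MatRep.mat_apply_of_heq {A B A' B' : MatRep U Y} (hA : A = A') (hB : B = B') (f : A ⟶ B)
    (g : A' ⟶ B') (h : f ≍ g) (i j i' j') (hi : i'.val = i.val) (hj : j'.val = j.val) :
    mat f i j = mat g i' j' := by
  subst hA hB
  obtain rfl := eq_of_heq h
  obtain rfl := Fin.ext hi
  obtain rfl := Fin.ext hj
  rfl

namespace Corr

variable {Φ : Corr U Y} {Φ' : Corr U' Y} {f : U' ⟶ U}

lemma matRep_eq_of_isPullbackObj (h : IsPullbackObj f Φ Φ') :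
    Φ'.matRep = (MatRep.pull f Y).obj Φ.matRep := by
  obtain ⟨n, Z, hZ, φ, Z', hZ', φ', ⟨hT, h⟩, rfl, rfl⟩ := h
  have key : φ'.rep = φ.rep.map f := by
    refine Rep.ext (NonUnitalRingHom.ext fun b ↦ ?_)
    have hf : (⊤ : U'.left.Opens) ≤ f.left ⁻¹ᵁ ⊤ := le_rfl
    -- The base change formula is used with one summand and coefficient 1: a function on `Y` pulls
    -- back to itself, so the formula says that the matrices are pulled back entrywise.
    have := h ⊤ ⊤ hf 1 (fun _ ↦ 1)
      (fun _ ↦ toSecs Z ⊤ (sndFun U Y ⊤ b)) (toSecs Z' ⊤ (sndFun U' Y ⊤ b)) (by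
        simp only [Finset.univ_unique, Finset.sum_singleton, map_one, one_mul]
        rw [can_toSecs, pullSecs_toSecs f Z ⊤ ⊤ hf, prodPull_sndFun f Y hf])
    simp only [Finset.univ_unique, Finset.sum_singleton, one_smul] at this
    rw [Rep.map_toHom, AlgHomOver.rep_toHom, AlgHomOver.rep_toHom, this, Scheme.Hom.appTop,
      Scheme.Hom.app_eq_appLE]
    rfl
  change (⟨n, φ'.rep⟩ : MatRep U' Y) = ⟨n, φ.rep.map f⟩
  rw [key]

lemma idem_apply_of_matRep_eq (h : Φ'.matRep = (MatRep.pull f Y).obj Φ.matRep)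
    (i j i' j') (hi : i'.val = i.val) (hj : j'.val = j.val) :
    Φ'.idem ⊤ i' j' = f.left.appTop (Φ.idem ⊤ i j) := by
  obtain ⟨n', c'⟩ := Φ'
  obtain ⟨n, c⟩ := Φ
  obtain rfl : n' = n := congr_arg MatRep.n h
  obtain rfl := Fin.ext hi
  obtain rfl := Fin.ext hj
  have h' : (⟨n', c'⟩ : Corr U' Y).rep = (⟨n', c⟩ : Corr U Y).rep.map f := by
    simpa [matRep, MatRep.pull] using h
  rw [idem_top, idem_top, h']
  rfl

variable {Ψ : Corr U Y} {Ψ' : Corr U' Y}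

lemma mat_apply_of_isPullbackHom {α : Φ ⟶ Ψ} {α' : Φ' ⟶ Ψ'}
    (hΦ : Φ'.matRep = (MatRep.pull f Y).obj Φ.matRep) (h : IsPullbackHom f α α')
    (i j i' j') (hi : i'.val = i.val) (hj : j'.val = j.val) :
    mat α' i' j' = f.left.appTop (mat α i j) := by
  have := h ⊤ ⊤ le_rfl (Φ.basis ⊤ j) (Φ'.basis ⊤ j') (fun l l' hl ↦ by
    rw [basis_apply, basis_apply, idem_apply_of_matRep_eq hΦ l j l' j' hl hj, Scheme.Hom.appTop,
      Scheme.Hom.app_eq_appLE]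
    rfl) i i' hi
  refine this.trans ?_
  rw [Scheme.Hom.appTop, Scheme.Hom.app_eq_appLE]
  rfl

lemma isPullbackHom_of_mat_apply {α : Φ ⟶ Ψ} {α' : Φ' ⟶ Ψ'} (hn : Φ'.n = Φ.n)
    (h : ∀ i j i' j', i'.val = i.val → j'.val = j.val →
      mat α' i' j' = f.left.appTop (mat α i j)) : IsPullbackHom f α α' := by
  intro V V' hV m m' hm j j' hj
  rw [homApp_apply, homApp_apply, Matrix.mulVec, Matrix.mulVec, dotProduct, dotProduct, map_sum,
    ← (finCongr hn).sum_comp]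
  refine Finset.sum_congr rfl fun i _ ↦ ?_
  rw [map_mul, ← hm (finCongr hn i) i rfl, Matrix.map_apply, Matrix.map_apply,
    h j (finCongr hn i) j' i hj rfl]
  refine congr_arg (· * m'.1 i) ?_
  have : f.left.appTop ≫ res le_top = res le_top ≫ f.left.appLE V V' hV := by
    rw [Scheme.Hom.map_appLE]
    rfl
  exact congr($this _)

/-- The defining conditions of a pullback functor, tested on functions on `Y` and on basis vectors,
determine it after `toMat`. This gives the naturality of F for every presheaf with the required
functors, and not only for the one constructed below. -/
lemma comp_toMat_eq_of_isPullbackFunctor {G : Corr U Y ⥤ Corr U' Y} (h : IsPullbackFunctor f G) :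
    G ⋙ toMat U' Y = toMat U Y ⋙ MatRep.pull f Y := by
  have hobj (Φ : Corr U Y) := matRep_eq_of_isPullbackObj (h.obj Φ)
  refine Functor.hext hobj fun Φ Ψ α ↦ MatRep.hom_heq (hobj Φ) (hobj Ψ) _ _ fun i j i' j' hi hj ↦ ?_
  exact mat_apply_of_isPullbackHom (hobj Φ) (h.map α) i' j' i j hi.symm hj.symm

end Corr

variable [IsAffine S] [IsAffine Y.left]

lemma Rep.Kills.comap {n : ℕ} {ρ : Rep U Y n} {Z : (prod U Y).IdealSheafData} (hZ : ρ.Kills Z)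
    (f : U' ⟶ U) : (ρ.map f).Kills (baseChange f Z) := by
  refine Rep.kills_of_cover _ _ fun x ↦ ?_
  obtain ⟨V, hV, hxV, -⟩ := exists_isAffineOpen_mem_and_subset (x := f.left x) (U := ⊤) trivial
  obtain ⟨V', hV', hxV', h⟩ := exists_isAffineOpen_mem_and_subset (x := x) (U := f.left ⁻¹ᵁ V) hxV
  refine ⟨V', hV', hxV', (ideal_comap_le (prodMap f Y) Z (prodOpen U Y hV).2 (prodOpen U' Y hV').2
    (preimage_prodFst_le f Y h)).trans ?_⟩
  rw [Ideal.map_le_iff_le_comap]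
  intro c hc
  change (ρ.map f).extend hV' (prodPull f Y h c) = 0
  rw [ρ.extend_pull f hV hV' h, Rep.mem_kerIdeal.mp (hZ hV hc)]
  simp

/-- The role of `J` is to find members of SubSch that contain a prescribed subscheme, such as a base
change. If `J` is supported in the support of the representation, then the ideal of that support
lies in the radical of `J`, and a power of it lies in `J`. -/
lemma Rep.exists_mem_subSch [_root_.AlgebraicGeometry.IsReduced U.left] [CompactSpace U.left]
    [IsLocallyNoetherian U.left] [LocallyOfFiniteType (prodFst U Y)] {n : ℕ} (ρ : Rep U Y n)
    (J : (prod U Y).IdealSheafData) (hJ : J.support ≤ ρ.closedSupport) :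
    ∃ Z ∈ SubSch U Y, ρ.Kills Z ∧ Z.support ≤ ρ.closedSupport ∧ Z ≤ J := by
  have : IsLocallyNoetherian (prod U Y) := LocallyOfFiniteType.isLocallyNoetherian (prodFst U Y)
  have : CompactSpace (prod U Y) := QuasiCompact.compactSpace_of_compactSpace (prodFst U Y)
  obtain ⟨m, hm⟩ := ρ.exists_kills
  obtain ⟨l, hl⟩ := exists_pow_le_of_le_radical
    (Scheme.IdealSheafData.vanishingIdeal ρ.closedSupport) J (by
      rw [← Scheme.IdealSheafData.vanishingIdeal_support]
      exact Scheme.IdealSheafData.vanishingIdeal_antimono hJ)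
  -- The exponent `m` makes the power killed and `l` puts it below `J`. The extra 1 makes the
  -- exponent positive, so that the power has the same support as the ideal.
  refine ⟨_, ⟨_, ρ.closedSupport_mem_supp, m + l + 1, rfl⟩, fun V hV ↦ le_trans ?_ (hm hV), ?_,
    le_trans (fun V ↦ ?_) hl⟩
  · rw [Scheme.IdealSheafData.ideal_pow, Scheme.IdealSheafData.ideal_pow]
    exact Ideal.pow_le_pow_right (by omega)
  · rw [Scheme.IdealSheafData.support_pow_succ]
    exact (Scheme.IdealSheafData.coe_support_vanishingIdeal _).le
  · rw [Scheme.IdealSheafData.ideal_pow, Scheme.IdealSheafData.ideal_pow]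
    exact Ideal.pow_le_pow_right (by omega)

/-- The formula is an equality of sections, checked over affine opens of `U'` lying over affine
opens of `U`. There all sections lift to functions on products, and `Rep.extend_pull` applies.
Different lifts give the same value since the pulled back representation kills the base change of
`Z`. -/
lemma AlgHomOver.isBaseChange {n : ℕ} {Z : (prod U Y).IdealSheafData} {φ : AlgHomOver Z n}
    (f : U' ⟶ U) {Z' : (prod U' Y).IdealSheafData} {φ' : AlgHomOver Z' n}
    (hZ' : Z' ≤ baseChange f Z) (h : φ'.rep = φ.rep.map f) : φ.IsBaseChange f φ' := by
  refine ⟨hZ', fun V V' hV r a b c hc ↦ ?_⟩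
  ext i j
  refine section_ext fun x hx ↦ ?_
  obtain ⟨W, hW, hxW, hWV⟩ := exists_isAffineOpen_mem_and_subset (x := f.left x) (U := V) (hV hx)
  replace hWV : W ≤ V := hWV
  obtain ⟨W', hW', hxW', hWV'⟩ := exists_isAffineOpen_mem_and_subset (x := x)
    (U := V' ⊓ f.left ⁻¹ᵁ W) ⟨hx, hxW⟩
  replace hWV' : W' ≤ V' ⊓ f.left ⁻¹ᵁ W := hWV'
  have hW₁ := hWV'.trans inf_le_left
  have hW₂ := hWV'.trans inf_le_right
  refine ⟨W', hW₁, hxW', ?_⟩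
  obtain ⟨c', hc'⟩ := toSecs_surjective Z' hW' (secsRes Z' hW₁ c)
  choose b' hb' using fun i ↦ toSecs_surjective Z hW (secsRes Z hWV (b i))
  have hpull (s : secs Z V) : secsRes (baseChange f Z) hW₁ (pullSecs f Z V V' hV s) =
      pullSecs f Z W W' hW₂ (secsRes Z hWV s) := by
    have : pullSecs f Z V V' hV ≫ secsRes (baseChange f Z) hW₁ =
        secsRes Z hWV ≫ pullSecs f Z W W' hW₂ := by
      rw [pullSecs, secsRes, Scheme.Hom.appLE_map, secsRes, pullSecs, Scheme.Hom.map_appLE]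
    exact congr($this s)
  have hproj (a : Γ(U'.left, V')) : secsRes (baseChange f Z) hW₁ ((proj (baseChange f Z)).app V' a) =
      (proj (baseChange f Z)).app W' (res hW₁ a) :=
    (congr($((proj (baseChange f Z)).naturality (homOfLE hW₁).op) a)).symm
  have key : toSecs (baseChange f Z) W' c' =
      toSecs (baseChange f Z) W' (∑ i, fstFun U' Y W' (res hW₁ (a i)) * prodPull f Y hW₂ (b' i)) := by
    rw [← can_toSecs hZ', hc', can_res, hc]
    simp only [map_sum, map_mul, toSecs_fstFun, ← pullSecs_toSecs, hb', hpull, hproj]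
  have e₁ := φ'.naturality hW₁ c
  rw [← hc', app_toSecs _ hW', h, (φ.kills.comap f).extend_eq hW' key] at e₁
  refine (congr_fun₂ e₁ i j).symm.trans ?_
  simp only [map_sum, Matrix.sum_apply, Rep.extend_fstFun_mul]
  refine Finset.sum_congr rfl fun l _ ↦ ?_
  rw [Rep.extend_pull _ f hW hW' hW₂, ← app_toSecs, hb', φ.naturality]
  simp only [Matrix.smul_apply, Matrix.map_apply, smul_eq_mul, map_mul]
  refine congr_arg _ ?_
  have : res hWV ≫ f.left.appLE W W' hW₂ = f.left.appLE V V' hV ≫ res hW₁ := by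
    rw [Scheme.Hom.map_appLE, Scheme.Hom.appLE_map]
  exact congr($this _)

lemma Rep.support_baseChange_le {n : ℕ} (ρ : Rep U Y n) {Z : (prod U Y).IdealSheafData}
    (h : Z.support ≤ ρ.closedSupport) (f : U' ⟶ U) :
    (baseChange f Z).support ≤ (ρ.map f).closedSupport := by
  rw [Scheme.IdealSheafData.support_comap]
  exact fun z hz ↦ ρ.prodMap_mem_support f (h hz)

namespace Corr

variable {Φ : Corr U Y} {Φ' : Corr U' Y} {f : U' ⟶ U}

lemma exists_eq_mk (Φ : Corr U Y) {Z : (prod U Y).IdealSheafData} (hZ : Z ∈ SubSch U Y)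
    (h : Φ.rep.Kills Z) : Φ = ⟨Φ.n, Quotient.mk _ ⟨Z, hZ, h.toAlgHom⟩⟩ := by
  refine toMat_obj_injective ?_
  change (⟨Φ.n, Φ.rep⟩ : MatRep U Y) = ⟨Φ.n, h.toAlgHom.rep⟩
  rw [h.rep_toAlgHom]

section

variable [_root_.AlgebraicGeometry.IsReduced U.left] [CompactSpace U.left]
  [IsLocallyNoetherian U.left] [LocallyOfFiniteType (prodFst U Y)]

lemma exists_matRep_eq (A : MatRep U Y) : ∃ Φ : Corr U Y, (toMat U Y).obj Φ = A := by
  obtain ⟨n, ρ⟩ := A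
  obtain ⟨Z, hZ, h, -⟩ := ρ.exists_mem_subSch ⊤ (by
    rw [Scheme.IdealSheafData.support_top]
    exact bot_le)
  refine ⟨⟨n, Quotient.mk _ ⟨Z, hZ, h.toAlgHom⟩⟩, ?_⟩
  change (⟨n, h.toAlgHom.rep⟩ : MatRep U Y) = ⟨n, ρ⟩
  rw [h.rep_toAlgHom]

variable [_root_.AlgebraicGeometry.IsReduced U'.left] [CompactSpace U'.left]
  [IsLocallyNoetherian U'.left] [LocallyOfFiniteType (prodFst U' Y)]

/-- Take `Z` supported in the support of the representation. Since eigenvectors survive base change,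
its preimage is supported in the support of the pulled back representation, so some member of SubSch
contains this preimage and carries the pulled back homomorphism. -/
lemma isPullbackObj_of_matRep_eq (h : Φ'.matRep = (MatRep.pull f Y).obj Φ.matRep) :
    IsPullbackObj f Φ Φ' := by
  obtain ⟨Z, hZ, hk, hs, -⟩ := Φ.rep.exists_mem_subSch ⊤ (by
    rw [Scheme.IdealSheafData.support_top]
    exact bot_le)
  obtain ⟨n', c'⟩ := Φ'
  obtain rfl : n' = Φ.n := congr_arg MatRep.n h
  have h' : (⟨Φ.n, c'⟩ : Corr U' Y).rep = Φ.rep.map f := by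
    simpa [matRep, MatRep.pull] using h
  obtain ⟨Z', hZ', hk', -, hle⟩ := (Φ.rep.map f).exists_mem_subSch (baseChange f Z)
    (Φ.rep.support_baseChange_le hs f)
  rw [← h'] at hk'
  refine ⟨Φ.n, Z, hZ, hk.toAlgHom, Z', hZ', hk'.toAlgHom, AlgHomOver.isBaseChange f hle ?_,
    Φ.exists_eq_mk hZ hk, exists_eq_mk _ hZ' hk'⟩
  rw [hk'.rep_toAlgHom, hk.rep_toAlgHom, h']

lemma isPullbackObj_iff :
    IsPullbackObj f Φ Φ' ↔ (toMat U' Y).obj Φ' = (MatRep.pull f Y).obj ((toMat U Y).obj Φ) :=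
  ⟨matRep_eq_of_isPullbackObj, isPullbackObj_of_matRep_eq⟩

end

lemma isPullbackFunctor_of_comp_toMat_eq [_root_.AlgebraicGeometry.IsReduced U.left]
    [CompactSpace U.left] [IsLocallyNoetherian U.left] [LocallyOfFiniteType (prodFst U Y)]
    [_root_.AlgebraicGeometry.IsReduced U'.left] [CompactSpace U'.left]
    [IsLocallyNoetherian U'.left] [LocallyOfFiniteType (prodFst U' Y)] {G : Corr U Y ⥤ Corr U' Y}
    (h : G ⋙ toMat U' Y = toMat U Y ⋙ MatRep.pull f Y) : IsPullbackFunctor f G where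
  obj Φ := isPullbackObj_iff.mpr (Functor.congr_obj h Φ)
  map {Φ Ψ} α := by
    have hΦ := Functor.congr_obj h Φ
    have hΨ := Functor.congr_obj h Ψ
    refine isPullbackHom_of_mat_apply (congr_arg MatRep.n hΦ) fun i j i' j' hi hj ↦ ?_
    have := MatRep.mat_apply_of_heq hΦ hΨ _ _ (Functor.hcongr_hom h α) i' j' i j hi.symm hj.symm
    exact this

section

variable [_root_.AlgebraicGeometry.IsReduced U.left] [CompactSpace U.left]
  [IsLocallyNoetherian U.left] [LocallyOfFiniteType (prodFst U Y)]

/-- The object of `𝒜(U, Y)` defined by a matrix representation. -/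
def ofMatObj (A : MatRep U Y) : Corr U Y := (exists_matRep_eq A).choose

lemma toMat_ofMatObj (A : MatRep U Y) : (toMat U Y).obj (ofMatObj A) = A :=
  (exists_matRep_eq A).choose_spec

variable (U Y) in
/-- The inverse functor of `toMat`. -/
def ofMat : MatRep U Y ⥤ Corr U Y where
  obj A := ofMatObj A
  map {A B} a := (toMat U Y).preimage
    (eqToHom (toMat_ofMatObj A) ≫ a ≫ eqToHom (toMat_ofMatObj B).symm)
  map_id A := (toMat U Y).map_injective (by simp)
  map_comp a b := (toMat U Y).map_injective (by simp)

/-- Being fully faithful and bijective on objects, `toMat` has an inverse up to equality. An inverse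
up to isomorphism would not suffice to transport the strict presheaf structure. -/
lemma ofMat_comp_toMat : ofMat U Y ⋙ toMat U Y = 𝟭 _ :=
  CategoryTheory.Functor.ext toMat_ofMatObj fun A B a ↦ by simp [ofMat]

lemma toMat_comp_ofMat : toMat U Y ⋙ ofMat U Y = 𝟭 _ := by
  have hobj (Φ : Corr U Y) : ofMatObj ((toMat U Y).obj Φ) = Φ :=
    toMat_obj_injective (toMat_ofMatObj _)
  refine CategoryTheory.Functor.ext hobj fun A B a ↦ (toMat U Y).map_injective ?_
  have e {Φ Ψ : Corr U Y} (h : Φ = Ψ) : (toMat U Y).map (eqToHom h) =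
      eqToHom (congr_arg (toMat U Y).obj h) := eqToHom_map _ _
  refine ((toMat U Y).map_preimage _).trans (Eq.symm ?_)
  rw [(toMat U Y).map_comp, (toMat U Y).map_comp]
  exact congr_arg₂ (· ≫ ·) (e _) (congr_arg₂ (· ≫ ·) rfl (e _))

instance : (ofMat U Y).Additive where
  map_add {A B a b} := (toMat U Y).map_injective (by
    rw [(toMat U Y).map_add]
    simp [ofMat, Preadditive.add_comp, Preadditive.comp_add]
    rfl)

instance : (toMat U Y).EssSurj where
  mem_essImage A := ⟨_, ⟨eqToIso (toMat_ofMatObj A)⟩⟩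

instance : (toMat U Y).IsEquivalence where

lemma hasFiniteBiproducts : HasFiniteBiproducts (Corr U Y) :=
  have : HasFiniteProducts (Corr U Y) :=
    ⟨fun _ ↦ Adjunction.hasLimitsOfShape_of_equivalence (toMat U Y)⟩
  HasFiniteBiproducts.of_hasFiniteProducts

end

end Corr

/-! ### Smooth schemes -/

section Sm

variable {k : Type u} [Field k] (X Y : Sm k)

instance : LocallyOfFiniteType X.obj.hom := X.property.2.2.1

instance : QuasiCompact X.obj.hom := X.property.2.2.2

instance : CompactSpace X.obj.left := QuasiCompact.compactSpace_of_compactSpace X.obj.hom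

instance : IsLocallyNoetherian X.obj.left := LocallyOfFiniteType.isLocallyNoetherian X.obj.hom

instance (U : Over (Spec (CommRingCat.of k))) : LocallyOfFiniteType (prodFst U Y.obj) :=
  MorphismProperty.of_isPullback (P := @LocallyOfFiniteType)
    (IsPullback.of_hasPullback U.hom Y.obj.hom).flip inferInstance

instance : _root_.AlgebraicGeometry.IsReduced X.obj.left where
  component_reduced U := by
    refine ⟨fun s hs ↦ section_ext fun x hx ↦ ?_⟩
    obtain ⟨W, hW, hxW, hWU⟩ := exists_isAffineOpen_mem_and_subset (x := x) (U := U) hx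
    refine ⟨W, hWU, hxW, ?_⟩
    have := X.property.1
    have h := X.obj.hom.smooth_appLE (isAffineOpen_top _) hW (V := W) le_top
    have h' := RingHom.Smooth.respectsIso.2 _ (Scheme.ΓSpecIso (.of k)).symm.commRingCatIsoToRingEquiv h
    let _ : Algebra k Γ(X.obj.left, W) := RingHom.toAlgebra ((X.obj.hom.appLE ⊤ W le_top).hom.comp
      (Scheme.ΓSpecIso (.of k)).symm.commRingCatIsoToRingEquiv.toRingHom)
    have : Algebra.Smooth k Γ(X.obj.left, W) := h'
    have := isReduced_of_smooth k Γ(X.obj.left, W)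
    rw [map_zero]
    exact (hs.map (res hWU).hom).eq_zero

variable {Y}

/-- The presheaf `𝒜(-, Y)`. -/
def corrPresheaf [IsAffine Y.obj.left] :
    AdditivePresheaf (fun X : Sm k ↦ Corr X.obj Y.obj) where
  map {X' X} f := Corr.toMat X.obj Y.obj ⋙ MatRep.pull f.hom Y.obj ⋙ Corr.ofMat X'.obj Y.obj
  additive f := inferInstance
  map_id X := by
    change Corr.toMat X.obj Y.obj ⋙ MatRep.pull (𝟙 X.obj) Y.obj ⋙ Corr.ofMat X.obj Y.obj = _
    rw [MatRep.pull_id, Functor.id_comp, Corr.toMat_comp_ofMat]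
  map_comp {X'' X' X} f₁ f := by
    change Corr.toMat X.obj Y.obj ⋙ MatRep.pull (f₁.hom ≫ f.hom) Y.obj ⋙ Corr.ofMat X''.obj Y.obj = _
    rw [MatRep.pull_comp]
    simp only [Functor.assoc]
    rw [← Functor.assoc (Corr.ofMat X'.obj Y.obj), Corr.ofMat_comp_toMat, Functor.id_comp]

lemma isCorrPresheaf_corrPresheaf [IsAffine Y.obj.left] :
    IsCorrPresheaf (corrPresheaf (Y := Y)) := fun {X' X} f ↦
  Corr.isPullbackFunctor_of_comp_toMat_eq (by
    change (Corr.toMat X.obj Y.obj ⋙ MatRep.pull f.hom Y.obj ⋙ Corr.ofMat X'.obj Y.obj) ⋙ _ = _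
    simp only [Functor.assoc]
    rw [Corr.ofMat_comp_toMat, Functor.comp_id])

end Sm

end

end KCorr

namespace KCorr

noncomputable section

/-! ### Modules presented by generators and relations -/

section Presented

variable {X : Scheme.{u}}

/-- The free module `𝒪_X ^ (I)`. -/
def freeMod (X : Scheme.{u}) (I : Type u) : X.Modules :=
  (SheafOfModules.free I : SheafOfModules.{u} X.ringCatSheaf)

/-- The morphism `𝒪_X ^ (I) ⟶ M` given by global sections. -/
def freeHom {M : X.Modules} {I : Type u} (s : I → Γ(M, ⊤)) : freeMod X I ⟶ M :=
  (SheafOfModules.freeHomEquiv M).symm fun i ↦ PresheafOfModules.sectionsMk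
    (fun V ↦ M.presheaf.map (homOfLE (le_top (a := V.unop))).op (s i)) fun V W f ↦ by
      change M.presheaf.map f (M.presheaf.map _ (s i)) = M.presheaf.map _ (s i)
      rw [← ConcreteCategory.comp_apply, ← Functor.map_comp]
      rfl

/-- The tautological global sections of `𝒪_X ^ (I)`. -/
def freeGen (X : Scheme.{u}) {I : Type u} (i : I) :
    Γ(freeMod X I, ⊤) :=
  (SheafOfModules.freeSection (R := X.ringCatSheaf) i).1 (.op ⊤)

lemma freeHom_freeGen {M : X.Modules} {I : Type u} (s : I → Γ(M, ⊤)) (i : I) :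
    Scheme.Modules.Hom.app (freeHom s) ⊤ (freeGen X i) = s i := by
  have h := SheafOfModules.sectionsMap_freeHomEquiv_symm_freeSection (M := M)
    (fun i ↦ PresheafOfModules.sectionsMk
    (fun V ↦ M.presheaf.map (homOfLE (le_top (a := V.unop))).op (s i)) fun V W f ↦ by
      change M.presheaf.map f (M.presheaf.map _ (s i)) = M.presheaf.map _ (s i)
      rw [← ConcreteCategory.comp_apply, ← Functor.map_comp]
      rfl) i
  have h' := congr(($h).1 (.op ⊤))
  refine h'.trans ?_
  change M.presheaf.map (𝟙 _) (s i) = s i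
  rw [CategoryTheory.Functor.map_id]
  rfl

lemma free_hom_ext {M : X.Modules} {I : Type u}
    {f g : freeMod X I ⟶ M}
    (h : ∀ i, f.app ⊤ (freeGen X i) = g.app ⊤ (freeGen X i)) : f = g := by
  apply (SheafOfModules.freeHomEquiv M).injective
  funext i
  refine PresheafOfModules.sections_ext _ _ fun V ↦ ?_
  have hs := fun k : freeMod X I ⟶ M ↦
    PresheafOfModules.sections_property (SheafOfModules.freeHomEquiv M k i)
      (homOfLE (le_top (a := V.unop))).op
  have hf := hs f
  have hg := hs g
  refine hf.symm.trans (Eq.trans ?_ hg)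
  exact congrArg _ (h i)

variable {J : Type u} {n : ℕ} (c : J → Fin n → Γ(X, ⊤))

/-- The presentation of `presented c`. -/
def relHom : freeMod X J ⟶
    freeMod X (ULift.{u} (Fin n)) :=
  freeHom fun j ↦ ∑ i, c j i • freeGen X (ULift.up i)

/-- The module with `n` generators and the relations `∑ i, c j i • e i = 0`. -/
def presented : X.Modules := cokernel (relHom c)

/-- The projection onto the presented module. -/
def presentedπ : freeMod X (ULift.{u} (Fin n)) ⟶ presented c :=
  cokernel.π (relHom c)

/-- The generators of the presented module. -/
def presentedGen (i : Fin n) : Γ(presented c, ⊤) :=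
  (presentedπ c).app ⊤ (freeGen X (ULift.up i))

lemma relHom_freeGen (j : J) :
    (relHom c).app ⊤ (freeGen X j) = ∑ i, c j i • freeGen X (ULift.up i) :=
  freeHom_freeGen _ _

lemma relHom_presentedπ : relHom c ≫ presentedπ c = 0 := cokernel.condition (relHom c)

instance : Epi (presentedπ c) := inferInstanceAs (Epi (cokernel.π (relHom c)))

lemma presented_rel (j : J) : ∑ i, c j i • presentedGen c i = 0 := by
  have h := congr(Scheme.Modules.Hom.app $(relHom_presentedπ c) ⊤ (freeGen X j))
  rw [Scheme.Modules.Hom.comp_app, ConcreteCategory.comp_apply, relHom_freeGen, map_sum] at h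
  simp only [Scheme.Modules.Hom.app_smul] at h
  exact h

variable {c}

lemma presented_hom_ext {M : X.Modules} {f g : presented c ⟶ M}
    (h : ∀ i, f.app ⊤ (presentedGen c i) = g.app ⊤ (presentedGen c i)) : f = g := by
  rw [← cancel_epi (presentedπ c)]
  exact free_hom_ext fun i ↦ h i.down

lemma relHom_freeHom {M : X.Modules} (s : Fin n → Γ(M, ⊤)) (hs : ∀ j, ∑ i, c j i • s i = 0) :
    relHom c ≫ freeHom (fun i ↦ s i.down) = 0 := free_hom_ext fun j ↦ by
    rw [Scheme.Modules.Hom.comp_app, ConcreteCategory.comp_apply]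
    erw [freeHom_freeGen]
    rw [map_sum]
    refine Eq.trans (Finset.sum_congr rfl fun i _ ↦ ?_) (hs j)
    rw [Scheme.Modules.Hom.app_smul]
    erw [freeHom_freeGen]

/-- The morphism from the presented module given by sections that satisfy the relations. -/
def presentedDesc {M : X.Modules} (s : Fin n → Γ(M, ⊤)) (hs : ∀ j, ∑ i, c j i • s i = 0) :
    presented c ⟶ M :=
  cokernel.desc (relHom c) (freeHom fun i ↦ s i.down) (relHom_freeHom s hs)

lemma presentedDesc_gen {M : X.Modules} (s : Fin n → Γ(M, ⊤)) (hs : ∀ j, ∑ i, c j i • s i = 0)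
    (i : Fin n) : (presentedDesc s hs).app ⊤ (presentedGen c i) = s i := by
  have h := congr(Scheme.Modules.Hom.app $(cokernel.π_desc (relHom c) (freeHom fun i ↦ s i.down)
    (relHom_freeHom s hs)) ⊤ (freeGen X (ULift.up i)))
  exact h.trans (freeHom_freeGen _ _)

end Presented

end

end KCorr

/-! ### Base change of presentations and the module of a representation -/

namespace KCorr

noncomputable section

/-- By Yoneda the adjoint morphism is invertible exactly when `s` is universal among morphisms from
`A` to objects `G.obj N`. Thus τ can be proved invertible without computing inverse images of
modules. -/
lemma isIso_homEquiv_symm_iff {C D : Type*} [Category* C] [Category* D] {F : C ⥤ D} {G : D ⥤ C}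
    (adj : F ⊣ G) {A : C} {B : D} (s : A ⟶ G.obj B) :
    IsIso ((adj.homEquiv _ _).symm s) ↔
      ∀ N, Function.Bijective fun β : B ⟶ N ↦ s ≫ G.map β := by
  rw [isIso_iff_coyoneda_map_bijective]
  refine forall_congr' fun N ↦ ?_
  rw [← (adj.homEquiv A N).bijective.of_comp_iff']
  refine iff_of_eq (congrArg _ (funext fun β ↦ ?_))
  simp [Adjunction.homEquiv_naturality_right]

section

variable {X' X : Scheme.{u}} (g : X' ⟶ X) {J : Type u} {n : ℕ} {c : J → Fin n → Γ(X, ⊤)}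
  {c' : J → Fin n → Γ(X', ⊤)} (h : ∀ j i, c' j i = g.appTop (c j i))

/-- The canonical morphism from a presented module to the direct image of its base change. -/
def presentedσ : presented c ⟶ (Scheme.Modules.pushforward g).obj (presented c') :=
  presentedDesc (M := (Scheme.Modules.pushforward g).obj (presented c'))
    (fun i ↦ (show Γ(presented c', ⊤) from presentedGen c' i)) fun j ↦ by
      refine (Finset.sum_congr rfl fun i _ ↦ ?_).trans (presented_rel c' j)
      rw [h]
      rfl

lemma presentedσ_gen (i : Fin n) :
    (presentedσ g h).app ⊤ (presentedGen c i) = (show Γ(presented c', ⊤) from presentedGen c' i) :=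
  presentedDesc_gen _ _ i

/-- Both kinds of morphisms amount to `n` global sections of `N` that satisfy the pulled back
relations. -/
lemma bijective_presentedσ_comp (N : X'.Modules) : Function.Bijective
    fun β : presented c' ⟶ N ↦ presentedσ g h ≫ (Scheme.Modules.pushforward g).map β := by
  refine ⟨fun β β' e ↦ presented_hom_ext fun i ↦ ?_, fun γ ↦ ?_⟩
  · have := congr(Scheme.Modules.Hom.app $e ⊤ (presentedGen c i))
    simp only [Scheme.Modules.Hom.comp_app, ConcreteCategory.comp_apply, presentedσ_gen] at this
    exact this
  · have hs (j : J) : ∑ i, c' j i • (show Γ(N, ⊤) from γ.app ⊤ (presentedGen c i)) = 0 := by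
      have := congr(γ.app ⊤ $(presented_rel c j))
      rw [map_sum, map_zero] at this
      refine (Finset.sum_congr rfl fun i _ ↦ ?_).trans this
      rw [h, Scheme.Modules.Hom.app_smul]
      rfl
    refine ⟨presentedDesc _ hs, presented_hom_ext fun i ↦ ?_⟩
    simp only [Scheme.Modules.Hom.comp_app, ConcreteCategory.comp_apply, presentedσ_gen]
    exact presentedDesc_gen _ hs i

end

/-! ### Combinations of vectors -/

section Comb

variable {R A N : Type*} [CommRing R] [CommRing A] [AddCommGroup N] [Module A N] (g : R →+* A)
  {p q r : ℕ}

/-- The combinations of the vectors `s j` with coefficients in the columns of a matrix. -/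
def comb (a : Matrix (Fin p) (Fin q) R) (s : Fin p → N) (i : Fin q) : N := ∑ j, g (a j i) • s j

lemma comb_mul (a : Matrix (Fin p) (Fin q) R) (b : Matrix (Fin q) (Fin r) R) (s : Fin p → N) :
    comb g (a * b) s = comb g b (comb g a s) := by
  funext i
  simp only [comb, Matrix.mul_apply, map_sum, map_mul, Finset.sum_smul, Finset.smul_sum, smul_smul]
  rw [Finset.sum_comm]
  exact Finset.sum_congr rfl fun _ _ ↦ Finset.sum_congr rfl fun _ _ ↦ by rw [mul_comm]

lemma comb_add (a b : Matrix (Fin p) (Fin q) R) (s : Fin p → N) :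
    comb g (a + b) s = comb g a s + comb g b s := by
  funext i
  simp [comb, add_smul, Finset.sum_add_distrib]

lemma comb_smul (a : Matrix (Fin p) (Fin q) R) (c : A) (s : Fin p → N) :
    comb g a (c • s) = c • comb g a s := by
  funext i
  simp [comb, Finset.smul_sum, smul_smul, mul_comm]

end Comb

/-! ### The module of a representation -/

namespace Rep

variable {S : Scheme.{u}} {U Y : Over S} {n : ℕ} (ρ : Rep U Y n)

/-- The coefficients of the relations `b e_i = ∑ j, ρ(b) j i e_j`. -/
def relCoeff (b : Γ(Y.left, ⊤) × Fin n) (j : Fin n) : Γ(prod U Y, ⊤) :=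
  (if j = b.2 then (prodSnd U Y).appTop b.1 else 0) - (prodFst U Y).appTop (ρ.toHom b.1 j b.2)

lemma relCoeff_sum {N : Type*} [AddCommGroup N] [Module Γ(prod U Y, ⊤) N] (s : Fin n → N) (b) :
    ∑ j, ρ.relCoeff b j • s j =
      (prodSnd U Y).appTop b.1 • s b.2 - comb (prodFst U Y).appTop.hom (ρ.toHom b.1) s b.2 := by
  simp [relCoeff, comb, sub_smul, Finset.sum_sub_distrib]

/-- The vectors `s` satisfy the relations `b s_i = ∑ j, ρ(b) j i s_j`. -/
def IsSolution {N : Type*} [AddCommGroup N] [Module Γ(prod U Y, ⊤) N] (s : Fin n → N) : Prop :=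
  ∀ b, (prodSnd U Y).appTop b • s = comb (prodFst U Y).appTop.hom (ρ.toHom b) s

lemma isSolution_iff {N : Type*} [AddCommGroup N] [Module Γ(prod U Y, ⊤) N] (s : Fin n → N) :
    ρ.IsSolution s ↔ ∀ b, ∑ j, ρ.relCoeff b j • s j = 0 := by
  simp only [relCoeff_sum, sub_eq_zero, Prod.forall, IsSolution, funext_iff, Pi.smul_apply]

/-- The `𝒪_{U × Y}`-module with generators `e_i` and relations `b e_i = ∑ j, ρ(b) j i e_j`. -/
def mod : (prod U Y).Modules := presented ρ.relCoeff

/-- The generators of `ρ.mod`. -/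
def gen : Fin n → Γ(ρ.mod, ⊤) := presentedGen ρ.relCoeff

lemma isSolution_gen : ρ.IsSolution ρ.gen := (ρ.isSolution_iff _).2 (presented_rel ρ.relCoeff)

variable {ρ}

lemma mod_hom_ext {N : (prod U Y).Modules} {f g : ρ.mod ⟶ N}
    (h : ∀ i, f.app ⊤ (ρ.gen i) = g.app ⊤ (ρ.gen i)) : f = g := presented_hom_ext h

/-- The morphism from `ρ.mod` given by a solution of the relations. -/
def desc {N : (prod U Y).Modules} {s : Fin n → Γ(N, ⊤)} (hs : ρ.IsSolution s) : ρ.mod ⟶ N :=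
  presentedDesc s ((ρ.isSolution_iff s).1 hs)

lemma desc_gen {N : (prod U Y).Modules} {s : Fin n → Γ(N, ⊤)} (hs : ρ.IsSolution s) (i : Fin n) :
    (desc hs).app ⊤ (ρ.gen i) = s i := presentedDesc_gen _ _ i

lemma relCoeff_map {U' : Over S} (f : U' ⟶ U) (b) (j : Fin n) :
    (ρ.map f).relCoeff b j = (prodMap f Y).appTop (ρ.relCoeff b j) := by
  have h₁ : (prodSnd U Y).appTop ≫ (prodMap f Y).appTop = (prodSnd U' Y).appTop := by
    rw [← Scheme.Hom.comp_appTop, prodMap_snd]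
  have h₂ : (prodFst U Y).appTop ≫ (prodMap f Y).appTop = f.left.appTop ≫ (prodFst U' Y).appTop := by
    rw [← Scheme.Hom.comp_appTop, ← Scheme.Hom.comp_appTop, prodMap_fst]
  have h₃ := congr($h₂ (ρ.toHom b.1 j b.2))
  have h₄ := congr($h₁ b.1)
  simp only [ConcreteCategory.comp_apply] at h₃ h₄
  rw [relCoeff, relCoeff, map_sub, h₃, ← h₄, apply_ite (prodMap f Y).appTop, map_zero]
  rfl

variable (ρ)

/-- The canonical morphism from `ρ.mod` to the direct image of the module of a pullback of `ρ`. -/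
def σ {U' : Over S} {ρ' : Rep U' Y n} (f : U' ⟶ U) (h : ρ' = ρ.map f) :
    ρ.mod ⟶ (Scheme.Modules.pushforward (prodMap f Y)).obj ρ'.mod :=
  presentedσ (prodMap f Y) fun b j ↦ by rw [h, relCoeff_map]

variable {ρ}

lemma σ_gen {U' : Over S} {ρ' : Rep U' Y n} (f : U' ⟶ U) (h : ρ' = ρ.map f) (i : Fin n) :
    (ρ.σ f h).app ⊤ (ρ.gen i) = (show Γ(ρ'.mod, ⊤) from ρ'.gen i) :=
  presentedσ_gen _ _ i

lemma bijective_σ_comp {U' : Over S} {ρ' : Rep U' Y n} (f : U' ⟶ U) (h : ρ' = ρ.map f)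
    (N : (prod U' Y).Modules) : Function.Bijective
      fun β : ρ'.mod ⟶ N ↦ ρ.σ f h ≫ (Scheme.Modules.pushforward (prodMap f Y)).map β :=
  bijective_presentedσ_comp _ _ N

lemma isIso_τ {U' : Over S} {ρ' : Rep U' Y n} (f : U' ⟶ U) (h : ρ' = ρ.map f) :
    IsIso (((Scheme.Modules.pullbackPushforwardAdjunction (prodMap f Y)).homEquiv _ _).symm
      (ρ.σ f h)) :=
  (isIso_homEquiv_symm_iff _ _).2 (bijective_σ_comp f h)

/-- With vectors read as rows, a solution satisfies b s = s ρ'(b). Hence b(s a) = s ρ'(b) a = (s a)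
ρ(b). -/
lemma isSolution_comb {m : ℕ} {ρ' : Rep U Y m} {N : Type*} [AddCommGroup N]
    [Module Γ(prod U Y, ⊤) N] {s : Fin m → N} (hs : ρ'.IsSolution s)
    (a : Matrix (Fin m) (Fin n) Γ(U.left, ⊤)) (h : ∀ b, a * ρ.toHom b = ρ'.toHom b * a) :
    ρ.IsSolution (comb (prodFst U Y).appTop.hom a s) := fun b ↦ by
  rw [← comb_smul, hs, ← comb_mul, ← comb_mul, h]

/-- The relation for b = 1 takes the place of unitality: it cuts the free module down to the image
of the idempotent. -/
lemma IsSolution.comb_one {N : Type*} [AddCommGroup N]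
    [Module Γ(prod U Y, ⊤) N] {s : Fin n → N} (hs : ρ.IsSolution s) :
    comb (prodFst U Y).appTop.hom (ρ.toHom 1) s = s := by
  rw [← hs, map_one, one_smul]

lemma app_comb {m p : ℕ} {M N : (prod U Y).Modules} (f : M ⟶ N) (s : Fin m → Γ(M, ⊤))
    (a : Matrix (Fin m) (Fin p) Γ(U.left, ⊤)) (i : Fin p) :
    f.app ⊤ (comb (prodFst U Y).appTop.hom a s i) =
      comb (prodFst U Y).appTop.hom a (fun j ↦ f.app ⊤ (s j)) i := by
  simp [comb, map_sum]

end Rep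

end

end KCorr

namespace KCorr

noncomputable section

/-! ### Restriction of modules to affine open subschemes -/

section Over

variable {X : Scheme.{u}} {V W : X.Opens}

open Scheme.Modules

/-- Modules on the spectrum of `Γ(X, V)`, as modules on `V`. -/
def overOfSpec (hV : IsAffineOpen V) :
    SheafOfModules.{u} (Spec Γ(X, V)).ringCatSheaf ⥤
      SheafOfModules.{u} (X.ringCatSheaf.over V) :=
  restrictFunctor hV.isoSpec.hom ⋙ (overEquiv V).inverse

instance (hV : IsAffineOpen V) : PreservesColimitsOfSize.{u, u} (overOfSpec hV) := by
  exact inferInstanceAs (PreservesColimitsOfSize.{u, u}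
    (restrictFunctor hV.isoSpec.hom ⋙ (overEquiv V).inverse))

/-- The structure sheaf of `Spec Γ(X, V)` is sent to the structure sheaf of `V`. -/
def unitOverOfSpec (hV : IsAffineOpen V) :
    SheafOfModules.unit (X.ringCatSheaf.over V) ≅
      (overOfSpec hV).obj (SheafOfModules.unit (Spec Γ(X, V)).ringCatSheaf) :=
  (overEquiv V).unitIso.app _ ≪≫ (overEquiv V).inverse.mapIso
    ((overFunctorEquiv V).app (SheafOfModules.unit X.ringCatSheaf) ≪≫ restrictUnitIso V.ι ≪≫
      (restrictUnitIso hV.isoSpec.hom).symm)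

/-- The restriction of a module to `V`, through the spectrum. -/
def overOfSpecIso (hV : IsAffineOpen V) (M : X.Modules) :
    (overOfSpec hV).obj (M.restrict hV.fromSpec) ≅ SheafOfModules.over M V :=
  (overEquiv V).inverse.mapIso
    ((restrictFunctorComp hV.isoSpec.hom hV.fromSpec).symm.app M ≪≫
      (restrictFunctorCongr (by simp)).app M ≪≫ (overFunctorEquiv V).symm.app M) ≪≫
    (overEquiv V).unitIso.symm.app _

/-- Modules on `W`, restricted to the spectrum of `Γ(X, V)`. -/
def specOfOver (hV : IsAffineOpen V) (h : V ≤ W) :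
    SheafOfModules.{u} (X.ringCatSheaf.over W) ⥤
      SheafOfModules.{u} (Spec Γ(X, V)).ringCatSheaf :=
  (overEquiv W).functor ⋙ restrictFunctor (hV.isoSpec.inv ≫ X.homOfLE h)

instance (hV : IsAffineOpen V) (h : V ≤ W) : PreservesColimitsOfSize.{u, u} (specOfOver hV h) := by
  exact inferInstanceAs (PreservesColimitsOfSize.{u, u}
    ((overEquiv W).functor ⋙ restrictFunctor (hV.isoSpec.inv ≫ X.homOfLE h)))

/-- The structure sheaf of `W` is sent to the structure sheaf of `Spec Γ(X, V)`. -/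
def unitSpecOfOver (hV : IsAffineOpen V) (h : V ≤ W) :
    SheafOfModules.unit (Spec Γ(X, V)).ringCatSheaf ≅
      (specOfOver hV h).obj (SheafOfModules.unit (X.ringCatSheaf.over W)) :=
  (restrictUnitIso _).symm ≪≫ (restrictFunctor (hV.isoSpec.inv ≫ X.homOfLE h)).mapIso
    ((restrictUnitIso W.ι).symm ≪≫
      (overFunctorEquiv W).symm.app (SheafOfModules.unit X.ringCatSheaf))

/-- The restriction of a module on `W` to `Spec Γ(X, V)`. -/
def specOfOverIso (hV : IsAffineOpen V) (h : V ≤ W) (M : X.Modules) :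
    (show (Spec Γ(X, V)).Modules from (specOfOver hV h).obj (SheafOfModules.over M W)) ≅
      M.restrict hV.fromSpec :=
  (restrictFunctor (hV.isoSpec.inv ≫ X.homOfLE h)).mapIso ((overFunctorEquiv W).app M) ≪≫
    (restrictFunctorComp _ _).symm.app M ≪≫ (restrictFunctorCongr (by simp)).app M

end Over

end

end KCorr

/-! ### Quasi-coherence in terms of localization of sections -/

namespace KCorr

noncomputable section

section Loc

open Scheme.Modules

variable {X : Scheme.{u}}

/-- Restriction of sections of a module. -/
abbrev mres (M : X.Modules) {W V : X.Opens} (h : W ≤ V) : Γ(M, V) ⟶ Γ(M, W) :=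
  M.presheaf.map (homOfLE h).op

/-- Restriction of functions. -/
abbrev fres (X : Scheme.{u}) {W V : X.Opens} (h : W ≤ V) : Γ(X, V) ⟶ Γ(X, W) :=
  X.presheaf.map (homOfLE h).op

lemma mres_mres (M : X.Modules) {W' W V : X.Opens} (h : W ≤ V) (h' : W' ≤ W) (x : Γ(M, V)) :
    mres M h' (mres M h x) = mres M (h'.trans h) x := by
  rw [← ConcreteCategory.comp_apply, ← Functor.map_comp]
  rfl

lemma mres_self (M : X.Modules) {V : X.Opens} (h : V ≤ V) (x : Γ(M, V)) : mres M h x = x := by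
  have : mres M h = 𝟙 _ := M.presheaf.map_id _
  exact congr($this x)

lemma mres_smul (M : X.Modules) {W V : X.Opens} (h : W ≤ V) (r : Γ(X, V)) (x : Γ(M, V)) :
    mres M h (r • x) = fres X h r • mres M h x := map_smul M _ r x

/-- Sections of `M` over the principal open subsets of `V` are the localizations of the sections
over `V`. -/
structure IsLoc (M : X.Modules) (V : X.Opens) : Prop where
  -- The principal open is a variable with an equation, so that the condition applies to preimages
  -- of principal opens without transport.
  exists_lift (r : Γ(X, V)) {W : X.Opens} (h : W ≤ V) (hW : W = X.basicOpen r) (s : Γ(M, W)) :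
    ∃ (n : ℕ) (t : Γ(M, V)), mres M h t = fres X h r ^ n • s
  exists_pow (r : Γ(X, V)) {W : X.Opens} (h : W ≤ V) (hW : W = X.basicOpen r) (t : Γ(M, V)) :
    mres M h t = 0 → ∃ n : ℕ, r ^ n • t = 0

/-- The principal open subset of a spectrum. -/
def specBasicOpen {R : CommRingCat.{u}} (f : R) : (Spec R).Opens := PrimeSpectrum.basicOpen f

/-- Of the three conditions for a localized module, the invertibility of `f` is automatic over its
principal open. Lifting of sections and annihilation by a power remain. -/
lemma isLocalizing_iff {R : CommRingCat.{u}} (M : (Spec R).Modules) :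
    IsLocalizing (modulesSpecToSheaf.obj M) ↔ ∀ f : R,
      (∀ s : Γ(M, specBasicOpen f), ∃ (n : ℕ) (t : Γ(M, ⊤)),
        mres M le_top t = f ^ n • s) ∧
      ∀ t : Γ(M, ⊤), mres M (le_top (a := specBasicOpen f)) t = 0 →
        ∃ n : ℕ, f ^ n • t = 0 := by
  let φ (f : R) := ((modulesSpecToSheaf.obj M).obj.map (PrimeSpectrum.basicOpen f).leTop.op).hom
  refine ⟨fun h f ↦ ?_, fun h f ↦ IsLocalizedModule.Away.mk_of_addCommGroup ?_ ?_ ?_⟩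
  · have hf : IsLocalizedModule.Away f (φ f) := h f
    refine ⟨fun s ↦ ?_, fun s hs ↦ ?_⟩
    · obtain ⟨n, y, hy⟩ := hf.surj _ _ s
      exact ⟨n, y, hy.symm⟩
    · obtain ⟨⟨_, n, rfl⟩, hn⟩ := (IsLocalizedModule.eq_zero_iff (.powers f) (φ f)).mp hs
      exact ⟨n, hn⟩
  · exact isUnit_algebraMap_end_of_le_basicOpen f le_rfl
  · intro x
    obtain ⟨n, t, ht⟩ := (h f).1 x
    exact ⟨n, t, ht.symm⟩
  · intro x hx
    exact (h f).2 x hx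

variable {V : X.Opens} (hV : IsAffineOpen V) (M : X.Modules)

lemma fromSpec_image_top' : hV.fromSpec ''ᵁ ⊤ = V := by
  rw [Scheme.Hom.image_top_eq_opensRange, hV.opensRange_fromSpec]

lemma fromSpec_image_le (U : (Spec Γ(X, V)).Opens) : hV.fromSpec ''ᵁ U ≤ V :=
  (hV.fromSpec.image_mono le_top).trans (fromSpec_image_top' hV).le

lemma fromSpec_appIso_inv (U : (Spec Γ(X, V)).Opens) (r : Γ(X, V)) :
    (hV.fromSpec.appIso U).inv ((Spec Γ(X, V)).presheaf.map U.leTop.op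
      ((Scheme.ΓSpecIso Γ(X, V)).inv r)) = fres X (fromSpec_image_le hV U) r := by
  apply (ConcreteCategory.bijective_of_isIso (hV.fromSpec.appIso U).hom).1
  rw [Iso.inv_hom_id_apply]
  have : fres X (fromSpec_image_le hV U) ≫ (hV.fromSpec.appIso U).hom =
      (Scheme.ΓSpecIso Γ(X, V)).inv ≫ (Spec Γ(X, V)).presheaf.map U.leTop.op := by
    rw [Scheme.Hom.appIso_hom', Scheme.Hom.map_appLE, Scheme.Hom.appLE, hV.fromSpec_app_self,
      Category.assoc, ← Functor.map_comp]
    rfl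
  exact congr($this r).symm

lemma restrictAppIso_smul_fromSpec (U : (Spec Γ(X, V)).Opens) (r : Γ(X, V))
    (x : Γ(M.restrict hV.fromSpec, U)) :
    (M.restrictAppIso hV.fromSpec U).hom (r • x) =
      fres X (fromSpec_image_le hV U) r • (M.restrictAppIso hV.fromSpec U).hom x := by
  rw [smul_Spec_def, smul_restrictAppIso_hom_apply]
  exact congr($(fromSpec_appIso_inv hV U r) • _)

/-- Sections over `W`, as sections on the spectrum of `Γ(X, V)`. -/
def specSec {U : (Spec Γ(X, V)).Opens} {W : X.Opens} (h : hV.fromSpec ''ᵁ U = W) :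
    Γ(M.restrict hV.fromSpec, U) ≃+ Γ(M, W) where
  toFun x := mres M h.ge ((M.restrictAppIso hV.fromSpec U).hom x)
  invFun y := (M.restrictAppIso hV.fromSpec U).inv (mres M h.le y)
  left_inv x := by
    dsimp only
    rw [mres_mres, mres_self, Iso.hom_inv_id_apply]
  right_inv y := by
    dsimp only
    rw [Iso.inv_hom_id_apply, mres_mres, mres_self]
  map_add' x y := by simp

variable {M}

lemma specSec_smul {U : (Spec Γ(X, V)).Opens} {W : X.Opens} (h : hV.fromSpec ''ᵁ U = W)
    (hW : W ≤ V) (r : Γ(X, V)) (x : Γ(M.restrict hV.fromSpec, U)) :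
    specSec hV M h (r • x) = fres X hW r • specSec hV M h x := by
  change mres M h.ge _ = _ • mres M h.ge _
  rw [restrictAppIso_smul_fromSpec, mres_smul, presheaf_map_map _ _ (homOfLE hW).op]

lemma specSec_mres {U U' : (Spec Γ(X, V)).Opens} {W W' : X.Opens} (h : hV.fromSpec ''ᵁ U = W)
    (h' : hV.fromSpec ''ᵁ U' = W') (hU : U' ≤ U) (hW : W' ≤ W) (x : Γ(M.restrict hV.fromSpec, U)) :
    specSec hV M h' (mres _ hU x) = mres M hW (specSec hV M h x) := by
  change mres M h'.ge _ = mres M hW (mres M h.ge _)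
  rw [map_restrictAppIso_hom_apply, mres_mres]
  exact (mres_mres _ _ _ _).symm

variable (M)

/-- Sections over `V`, as global sections on the spectrum of `Γ(X, V)`. -/
def specSecTop : Γ(M.restrict hV.fromSpec, ⊤) ≃ₗ[Γ(X, V)] Γ(M, V) :=
  { specSec hV M (fromSpec_image_top' hV) with
    map_smul' r x := by
      refine (specSec_smul hV (fromSpec_image_top' hV) le_rfl r x).trans ?_
      congr 1
      exact congr($(X.presheaf.map_id (.op V)) r) }

/-- Restriction to the spectrum is a matter of renaming sections (`specSec`), so the criterion on a
spectrum becomes an elementary one about sections on `X`. This form passes easily to direct images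
and direct sums. -/
lemma isIso_fromTildeΓ_iff_isLoc :
    IsIso (M.restrict hV.fromSpec).fromTildeΓ ↔ IsLoc M V := by
  rw [isIso_fromTildeΓ_iff_isLocalizing, isLocalizing_iff]
  have key (r : Γ(X, V)) : hV.fromSpec ''ᵁ specBasicOpen r = X.basicOpen r :=
    hV.fromSpec_image_basicOpen r
  constructor
  · refine fun H ↦ ⟨fun r W h hW s ↦ ?_, fun r W h hW t ht ↦ ?_⟩
    · obtain ⟨n, t, ht⟩ := (H r).1 ((specSec hV M ((key r).trans hW.symm)).symm s)
      refine ⟨n, specSec hV M (fromSpec_image_top' hV) t, ?_⟩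
      rw [← specSec_mres hV (fromSpec_image_top' hV) ((key r).trans hW.symm) le_top h, ht,
        specSec_smul hV _ h, AddEquiv.apply_symm_apply, map_pow]
    · obtain ⟨n, hn⟩ := (H r).2 ((specSecTop hV M).symm t) (by
        apply (specSec hV M ((key r).trans hW.symm)).injective
        rw [specSec_mres hV (fromSpec_image_top' hV) ((key r).trans hW.symm) le_top h, map_zero]
        rw [← ht]
        exact congrArg _ ((specSecTop hV M).apply_symm_apply t))
      refine ⟨n, ?_⟩
      have := congr(specSecTop hV M $hn)
      rwa [LinearEquiv.map_smul, LinearEquiv.apply_symm_apply, map_zero] at this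
  · refine fun H r ↦ ⟨fun s ↦ ?_, fun t ht ↦ ?_⟩
    · obtain ⟨n, t, ht⟩ := H.exists_lift r (X.basicOpen_le r) rfl (specSec hV M (key r) s)
      refine ⟨n, (specSecTop hV M).symm t, (specSec hV M (key r)).injective ?_⟩
      rw [specSec_mres hV (fromSpec_image_top' hV) (key r) le_top (X.basicOpen_le r),
        specSec_smul hV _ (X.basicOpen_le r), map_pow, ← ht]
      exact congrArg (mres M _) ((specSecTop hV M).apply_symm_apply t)
    · obtain ⟨n, hn⟩ := H.exists_pow r (X.basicOpen_le r) rfl (specSecTop hV M t) (by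
        have := congr(specSec hV M (key r) $ht)
        rwa [specSec_mres hV (fromSpec_image_top' hV) (key r) le_top (X.basicOpen_le r),
          map_zero] at this)
      refine ⟨n, (specSecTop hV M).injective ?_⟩
      rw [LinearEquiv.map_smul, hn, map_zero]

lemma isLoc_of_isQuasicoherent (hV : IsAffineOpen V) (M : X.Modules) [M.IsQuasicoherent] : IsLoc M V := by
  rw [← isIso_fromTildeΓ_iff_isLoc hV]
  have : (M.restrict hV.fromSpec).IsQuasicoherent :=
    Scheme.Modules.isQuasicoherent_restrictFunctor hV.fromSpec M
  infer_instance

variable {M}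

/-- A module with localizing sections is associated to its module of sections. -/
def IsLoc.iso (hV : IsAffineOpen V) (h : IsLoc M V) :
    tilde (ModuleCat.of Γ(X, V) Γ(M, V)) ≅ M.restrict hV.fromSpec :=
  (tilde.functor _).mapIso (specSecTop hV M).symm.toModuleIso ≪≫
    @asIso _ _ _ _ _ ((isIso_fromTildeΓ_iff_isLoc hV M).2 h)

end Loc

end

end KCorr

/-! ### Local criteria for quasi-coherence, finite type and local freeness -/

namespace KCorr

noncomputable section

section Site

universe v' u' v₁ u₁

variable {C : Type u'} [Category.{v'} C] {J : GrothendieckTopology C} {R : Sheaf J RingCat.{u}}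

lemma isIso_π_map_ofEpi [HasWeakSheafify J AddCommGrpCat.{u}]
    [J.WEqualsLocallyBijective AddCommGrpCat.{u}] {C' : Type u₁} [Category.{v₁} C'] {J' : GrothendieckTopology C'}
    {R' : Sheaf J' RingCat.{u}} [HasSheafify J' AddCommGrpCat.{u}]
    [J'.WEqualsLocallyBijective AddCommGrpCat.{u}] {M : SheafOfModules.{u} R}
    (G : M.GeneratingSections) (F : SheafOfModules.{u} R ⥤ SheafOfModules.{u} R')
    [PreservesColimitsOfSize.{u, u} F] (η : SheafOfModules.unit R' ≅ F.obj (SheafOfModules.unit R))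
    {N : SheafOfModules.{u} R'} (e : F.obj M ≅ N) [IsIso G.π] :
    IsIso ((G.map F η).ofEpi e.hom).π := by
  have := preservesColimitsOfSize_shrink.{0, u, 0, u} F
  have := Functor.map_isIso F G.π
  rw [SheafOfModules.GeneratingSections.ofEpi_π, SheafOfModules.GeneratingSections.map_π_eq]
  exact inferInstanceAs (IsIso (((SheafOfModules.mapFreeIso F G.I η).hom ≫ F.map G.π) ≫ e.hom))

variable [∀ (X : C), HasSheafify (J.over X) AddCommGrpCat.{u}]
  [∀ (X : C), (J.over X).WEqualsLocallyBijective AddCommGrpCat.{u}]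

lemma isFiniteType_of_generators {M : SheafOfModules.{u} R} {I : Type u'} {V : I → C}
    (hV : J.CoversTop V) (G : ∀ i, (M.over (V i)).GeneratingSections) (h : ∀ i, Finite (G i).I) :
    M.IsFiniteType :=
  ⟨⟨I, V, hV, G⟩, ⟨fun i ↦ ⟨h i⟩⟩⟩

lemma isLocallyFree_of_generators {M : SheafOfModules.{u} R} {I : Type u'} {V : I → C}
    (hV : J.CoversTop V) (G : ∀ i, (M.over (V i)).GeneratingSections) (h : ∀ i, IsIso (G i).π) :
    M.IsLocallyFree :=
  ⟨⟨I, V, hV, G⟩, ⟨h⟩⟩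

lemma isQuasicoherent_of_presentation {M : SheafOfModules.{u} R} {I : Type u'} {V : I → C}
    (hV : J.CoversTop V) (P : ∀ i, (M.over (V i)).Presentation) : M.IsQuasicoherent :=
  ⟨⟨⟨I, V, hV, P⟩⟩⟩

lemma exists_generators_of_isFiniteType (M : SheafOfModules.{u} R) [hM : M.IsFiniteType] :
    ∃ (I : Type u') (V : I → C) (_ : J.CoversTop V) (G : ∀ i, (M.over (V i)).GeneratingSections),
      ∀ i, Finite (G i).I := by
  obtain ⟨σ, hσ⟩ := hM.exists_localGeneratorsData
  exact ⟨σ.I, σ.X, σ.coversTop, σ.generators, fun i ↦ (hσ.isFiniteType i).finite⟩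

lemma exists_generators_of_isLocallyFree (M : SheafOfModules.{u} R) [hM : M.IsLocallyFree] :
    ∃ (I : Type u') (V : I → C) (_ : J.CoversTop V) (G : ∀ i, (M.over (V i)).GeneratingSections),
      ∀ i, IsIso (G i).π := by
  obtain ⟨σ, hσ⟩ := hM.exists_isLocallyFreeData
  exact ⟨σ.I, σ.X, σ.coversTop, σ.generators, hσ.isIso⟩

lemma isQuasicoherent_of_isLocallyFree (M : SheafOfModules.{u} R) [M.IsLocallyFree] :
    M.IsQuasicoherent := inferInstance

end Site

section Local

open Scheme.Modules

variable {X : Scheme.{u}}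

/-- The images of generating sections under an epimorphism. -/
def genOfEpi {M N : X.Modules} (G : M.GeneratingSections) (f : M ⟶ N) [h : Epi f] :
    N.GeneratingSections :=
  @SheafOfModules.GeneratingSections.ofEpi _ _ _ X.ringCatSheaf _ _ M N G f h

/-- The morphism from a free module given by generating sections. -/
def genπ {M : X.Modules} (G : M.GeneratingSections) : freeMod X G.I ⟶ M := G.π

instance {M : X.Modules} (G : M.GeneratingSections) : Epi (genπ G) := G.epi

lemma genπ_genOfEpi {M N : X.Modules} (G : M.GeneratingSections) (f : M ⟶ N) [h : Epi f] :
    genπ (genOfEpi G f) = genπ G ≫ f :=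
  @SheafOfModules.GeneratingSections.ofEpi_π _ _ _ X.ringCatSheaf _ _ M N G f h

lemma genπ_free (I : Type u) :
    genπ (M := freeMod X I) (SheafOfModules.free.generatingSections I) = 𝟙 (freeMod X I) :=
  SheafOfModules.free.generatingSections_π I

/-- The tautological sections of a free module. -/
def freeGenerators (X : Scheme.{u}) (I : Type u) : (freeMod X I).GeneratingSections :=
  SheafOfModules.free.generatingSections I

/-- The module associated to a free module. -/
def tildeFree (R : CommRingCat.{u}) (I : Type u) :
    tilde (ModuleCat.of R (I →₀ R)) ≅ freeMod (Spec R) I := tildeFinsupp I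

/-- The morphism from a free module to an associated module given by a family of elements. -/
def freeToTilde {R : CommRingCat.{u}} {N : ModuleCat.{u} R} {I : Type u} (s : I → N) :
    freeMod (Spec R) I ⟶ tilde N :=
  (tildeFree R I).inv ≫ tilde.map (ModuleCat.ofHom (Finsupp.linearCombination R s))

lemma epi_freeToTilde {R : CommRingCat.{u}} {N : ModuleCat.{u} R} {I : Type u} (s : I → N)
    (hs : Submodule.span R (Set.range s) = ⊤) : Epi (freeToTilde s) := by
  have : Epi (ModuleCat.ofHom (Finsupp.linearCombination R s)) := by
    rw [ModuleCat.epi_iff_range_eq_top]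
    exact (Finsupp.range_linearCombination R).trans hs
  have : Epi (tilde.map (ModuleCat.ofHom (Finsupp.linearCombination R s))) :=
    inferInstanceAs (Epi ((tilde.functor R).map _))
  exact epi_comp _ _

lemma isIso_freeToTilde {R : CommRingCat.{u}} {N : ModuleCat.{u} R} {I : Type u}
    (b : Module.Basis I R N) : IsIso (freeToTilde b) := by
  have : IsIso (ModuleCat.ofHom (Finsupp.linearCombination R b)) := by
    rw [ConcreteCategory.isIso_iff_bijective]
    have : (Finsupp.linearCombination R b : (I →₀ R) →ₗ[R] N) = b.repr.symm.toLinearMap := by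
      ext; simp
    change Function.Bijective (Finsupp.linearCombination R b)
    rw [this]
    exact b.repr.symm.bijective
  have : IsIso (tilde.map (ModuleCat.ofHom (Finsupp.linearCombination R b))) :=
    inferInstanceAs (IsIso ((tilde.functor R).map _))
  exact IsIso.comp_isIso

variable {M : X.Modules}

/-- Local generators obtained from generators of the associated module. -/
def overGenerators {V : X.Opens} (hV : IsAffineOpen V) (h : IsLoc M V)
    (G : (tilde (ModuleCat.of Γ(X, V) Γ(M, V))).GeneratingSections) :
    (SheafOfModules.over M V).GeneratingSections :=
  ((genOfEpi G (h.iso hV).hom).map (overOfSpec hV) (unitOverOfSpec hV)).ofEpi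
    (overOfSpecIso hV M).hom

lemma isIso_overGenerators {V : X.Opens} (hV : IsAffineOpen V) (h : IsLoc M V)
    (G : (tilde (ModuleCat.of Γ(X, V) Γ(M, V))).GeneratingSections) [IsIso (genπ G)] :
    IsIso (overGenerators hV h G).π := by
  have e : genπ (genOfEpi G (h.iso hV).hom) = genπ G ≫ (h.iso hV).hom := genπ_genOfEpi _ _
  have h₁ : IsIso (genπ (genOfEpi G (h.iso hV).hom)) := by
    rw [e]
    exact inferInstanceAs (IsIso (genπ G ≫ (h.iso hV).hom))
  exact @isIso_π_map_ofEpi _ _ _ (Spec Γ(X, V)).ringCatSheaf _ _ _ _ _ _ _ _ _ _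
    (overOfSpec hV) _ (unitOverOfSpec hV) _ (overOfSpecIso hV M) h₁

lemma coversTop_of_forall {V : X → X.Opens} (hV : ∀ x, x ∈ V x) :
    (Opens.grothendieckTopology X).CoversTop V := by
  rw [Opens.coversTop_iff, IsOpenCover, eq_top_iff]
  exact fun x _ ↦ Opens.mem_iSup.2 ⟨x, hV x⟩

/-- Transport of a presentation. -/
def presOfIso {M N : X.Modules} (e : M ≅ N) (P : M.Presentation) : N.Presentation :=
  have : IsIso (C := SheafOfModules.{u} X.ringCatSheaf) e.hom := inferInstanceAs (IsIso e.hom)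
  SheafOfModules.Presentation.ofIsIso.{u, u, u} (R := X.ringCatSheaf) e.hom P

/-- Generators of the associated module obtained from a basis. -/
def basisGenerators {R : CommRingCat.{u}} {N : ModuleCat.{u} R} {I : Type u}
    (b : Module.Basis I R N) : (tilde N).GeneratingSections :=
  have := isIso_freeToTilde b
  genOfEpi (freeGenerators _ _) (freeToTilde b)

lemma isIso_basisGenerators {R : CommRingCat.{u}} {N : ModuleCat.{u} R} {I : Type u}
    (b : Module.Basis I R N) : IsIso (genπ (basisGenerators b)) := by
  have := isIso_freeToTilde b
  have e : genπ (basisGenerators b) = 𝟙 (freeMod (Spec R) I) ≫ freeToTilde b :=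
    (genπ_genOfEpi _ _).trans (congrArg (· ≫ freeToTilde b) (genπ_free I))
  rw [e, Category.id_comp]
  exact this

lemma isQuasicoherent_of_isLoc (h : ∀ x, ∃ V : X.Opens, x ∈ V ∧ IsAffineOpen V ∧ IsLoc M V) :
    M.IsQuasicoherent := by
  choose V hx hV h using h
  exact isQuasicoherent_of_presentation (R := X.ringCatSheaf) (coversTop_of_forall hx) fun x ↦
    SheafOfModules.Presentation.ofIsIso.{u, u, u} (overOfSpecIso (hV x) M).hom
      ((presOfIso ((h x).iso (hV x))
        (presentationTilde.{u} _ .univ (by simp) _ (Submodule.span_eq _))).map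
          (overOfSpec (hV x)) (unitOverOfSpec (hV x)))

lemma isFiniteType_of_isLoc (h : ∀ x, ∃ V : X.Opens, x ∈ V ∧ IsAffineOpen V ∧ IsLoc M V ∧
    Module.Finite Γ(X, V) Γ(M, V)) : M.IsFiniteType := by
  choose V hx hV h hf using h
  choose s hs using fun x ↦ (hf x).fg_top
  have (x : X) : Epi (freeToTilde (N := ModuleCat.of Γ(X, V x) Γ(M, V x))
      (I := s x) Subtype.val) :=
    epi_freeToTilde _ (by rw [Subtype.range_val]; exact hs x)
  exact isFiniteType_of_generators (R := X.ringCatSheaf) (coversTop_of_forall hx)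
    (fun x ↦ overGenerators (hV x) (h x)
      (genOfEpi (freeGenerators _ _) (freeToTilde (I := s x) Subtype.val)))
    fun x ↦ inferInstanceAs (Finite (s x))

lemma isLocallyFree_of_isLoc (h : ∀ x, ∃ V : X.Opens, x ∈ V ∧ IsAffineOpen V ∧ IsLoc M V ∧
    Module.Free Γ(X, V) Γ(M, V)) : M.IsLocallyFree := by
  choose V hx hV h hf using h
  let G (x : X) : (tilde (ModuleCat.of Γ(X, V x) Γ(M, V x))).GeneratingSections :=
    basisGenerators (N := ModuleCat.of Γ(X, V x) Γ(M, V x))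
      (Module.Free.chooseBasis Γ(X, V x) Γ(M, V x))
  have hG (x : X) : IsIso (genπ (G x)) := isIso_basisGenerators _
  exact isLocallyFree_of_generators (R := X.ringCatSheaf) (coversTop_of_forall hx) _
    fun x ↦ isIso_overGenerators (hV x) (h x) (G x)

/-- Generators of the associated module obtained from local generators. -/
def tildeGenerators {V W : X.Opens} (hV : IsAffineOpen V) (h : IsLoc M V) (hVW : V ≤ W)
    (G : (SheafOfModules.over M W).GeneratingSections) :
    (tilde (ModuleCat.of Γ(X, V) Γ(M, V))).GeneratingSections :=
  genOfEpi (M := (specOfOver hV hVW).obj (SheafOfModules.over M W))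
    (h := inferInstanceAs (Epi ((specOfOverIso hV hVW M) ≪≫ (h.iso hV).symm).hom)) (G.map (specOfOver hV hVW) (unitSpecOfOver hV hVW))
    ((specOfOverIso hV hVW M).hom ≫ (h.iso hV).inv)

lemma isIso_tildeGenerators {V W : X.Opens} (hV : IsAffineOpen V) (h : IsLoc M V) (hVW : V ≤ W)
    (G : (SheafOfModules.over M W).GeneratingSections) [IsIso G.π] :
    IsIso (genπ (tildeGenerators hV h hVW G)) := by
  have : IsIso (genπ (M := (specOfOver hV hVW).obj (SheafOfModules.over M W))
      (G.map (specOfOver hV hVW) (unitSpecOfOver hV hVW))) :=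
    inferInstanceAs (IsIso (G.map (specOfOver hV hVW) (unitSpecOfOver hV hVW)).π)
  have e : genπ (tildeGenerators hV h hVW G) = _ ≫ _ :=
    @genπ_genOfEpi _ _ _ _ _ (inferInstanceAs (Epi ((specOfOverIso hV hVW M) ≪≫
      (h.iso hV).symm).hom))
  rw [e]
  exact @IsIso.comp_isIso _ _ _ _ _ _ _ this
    (inferInstanceAs (IsIso ((specOfOverIso hV hVW M) ≪≫ (h.iso hV).symm).hom))

lemma exists_mem_of_coversTop {I : Type*} {V : I → X.Opens}
    (h : (Opens.grothendieckTopology X).CoversTop V) (x : X) : ∃ i, x ∈ V i := by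
  rw [Opens.coversTop_iff] at h
  exact Opens.mem_iSup.1 (h.symm.le (Opens.mem_top x))

-- Finitely many local generators give an epimorphism from a finite free module to the module
-- associated to the sections over `V`. As the tilde functor is full and reflects epimorphisms, it
-- comes from a surjection of modules. The lemma `exists_free` uses isomorphisms in the same way.
variable (M) in
lemma exists_finite [M.IsQuasicoherent] [hM : M.IsFiniteType] (x : X) :
    ∃ V : X.Opens, x ∈ V ∧ IsAffineOpen V ∧ Module.Finite Γ(X, V) Γ(M, V) := by
  obtain ⟨I, W, hW, G, hG⟩ := exists_generators_of_isFiniteType (R := X.ringCatSheaf) M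
  obtain ⟨i, hi⟩ := exists_mem_of_coversTop hW x
  obtain ⟨V, hV, hxV, hVi⟩ := exists_isAffineOpen_mem_and_subset (x := x) (U := W i) hi
  replace hVi : V ≤ W i := hVi
  refine ⟨V, hxV, hV, ?_⟩
  let G' := tildeGenerators hV (isLoc_of_isQuasicoherent hV M) hVi (G i)
  have : Finite G'.I := hG i
  let f := (tilde.functor _).preimage ((tildeFree _ G'.I).hom ≫ genπ G')
  have : Epi f := (tilde.functor _).epi_of_epi_map (by
    rw [Functor.map_preimage]
    exact inferInstanceAs (Epi ((tildeFree _ G'.I).hom ≫ genπ G')))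
  exact Module.Finite.of_surjective f.hom ((ModuleCat.epi_iff_surjective f).1 this)

variable (M) in
lemma exists_free [hM : M.IsLocallyFree] (x : X) :
    ∃ V : X.Opens, x ∈ V ∧ IsAffineOpen V ∧ Module.Free Γ(X, V) Γ(M, V) := by
  obtain ⟨I, W, hW, G, hG⟩ := exists_generators_of_isLocallyFree (R := X.ringCatSheaf) M
  obtain ⟨i, hi⟩ := exists_mem_of_coversTop hW x
  obtain ⟨V, hV, hxV, hVi⟩ := exists_isAffineOpen_mem_and_subset (x := x) (U := W i) hi
  replace hVi : V ≤ W i := hVi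
  have hq : M.IsQuasicoherent := isQuasicoherent_of_isLocallyFree (R := X.ringCatSheaf) M
  have := hG i
  refine ⟨V, hxV, hV, ?_⟩
  let G' := tildeGenerators hV (isLoc_of_isQuasicoherent hV M) hVi (G i)
  have : IsIso (genπ G') := isIso_tildeGenerators _ _ _ _
  let f := (tilde.functor _).preimage ((tildeFree _ G'.I).hom ≫ genπ G')
  have : IsIso ((tilde.functor _).map f) := by
    rw [Functor.map_preimage]
    exact inferInstanceAs (IsIso ((tildeFree _ G'.I).hom ≫ genπ G'))
  have : IsIso f := isIso_of_reflects_iso f (tilde.functor _)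
  exact Module.Free.of_equiv (asIso f).toLinearEquiv

end Local

end

end KCorr

namespace KCorr

noncomputable section

open Scheme.Modules

/-! ### Sections of presented modules over affine open subsets -/

section Site

variable {C : Type*} [Category* C] {J : GrothendieckTopology C} {R : Sheaf J RingCat.{u}}
  [HasSheafify J AddCommGrpCat.{u}] [J.WEqualsLocallyBijective AddCommGrpCat.{u}]
  [∀ (X : C), HasSheafify (J.over X) AddCommGrpCat.{u}]
  [∀ (X : C), (J.over X).WEqualsLocallyBijective AddCommGrpCat.{u}] [HasBinaryProducts C]

lemma isFiniteType_of_generatingSections {M : SheafOfModules.{u} R} (G : M.GeneratingSections)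
    (h : Finite G.I) : M.IsFiniteType :=
  ⟨G.localGeneratorsData, ⟨fun _ ↦ ⟨h⟩⟩⟩

end Site

section Spec

variable {R : CommRingCat.{u}}

lemma smul_top_eq {M : (Spec R).Modules} (a : Γ(Spec R, ⊤)) (x : Γ(M, ⊤)) :
    a • x = (Scheme.ΓSpecIso R).hom a • x := by
  rw [smul_Spec_def, Iso.hom_inv_id_apply]
  exact congr($((Spec R).presheaf.map_id (.op ⊤)).hom a • x).symm

/-- An element of a module, as a global section of the associated sheaf. -/
def toTop (N : ModuleCat.{u} R) : N →ₗ[R] Γ(tilde N, ⊤) := (tilde.toOpen N ⊤).hom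

lemma toTop_injective (N : ModuleCat.{u} R) : Function.Injective (toTop N) :=
  (ConcreteCategory.bijective_of_isIso (tilde.toOpen N ⊤)).1

lemma fromTildeΓ_app_toTop (M : (Spec R).Modules) (x : Γ(M, ⊤)) :
    M.fromTildeΓ.app ⊤ (toTop ((modulesSpecToSheaf.obj M).presheaf.obj (.op ⊤)) x) = x := by
  have h := congr($(toOpen_fromTildeΓ_app M ⊤) x)
  refine h.trans ?_
  exact mres_self M le_top x

lemma tilde_map_app_toTop {N N' : ModuleCat.{u} R} (f : N ⟶ N') (x : N) :
    (tilde.map f).app ⊤ (toTop N x) = toTop N' (f x) :=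
  congr($(tilde.toOpen_map_app f ⊤) x)

/-- The module of global sections. -/
abbrev topMod (M : (Spec R).Modules) : ModuleCat.{u} R :=
  (modulesSpecToSheaf.obj M).presheaf.obj (.op ⊤)

lemma exists_hom_tilde_aux (M : (Spec R).Modules) [M.IsQuasicoherent] {N : ModuleCat.{u} R}
    (ψ : topMod M ⟶ N) :
    ∃ f : M ⟶ tilde N, ∀ x : topMod M, f.app ⊤ x = toTop N (ψ x) := by
  have : IsIso M.fromTildeΓ := inferInstance
  refine ⟨(asIso M.fromTildeΓ).inv ≫ tilde.map ψ, fun x ↦ ?_⟩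
  have h : (asIso M.fromTildeΓ).inv.app ⊤ x = toTop (topMod M) x := by
    apply (ConcreteCategory.bijective_of_isIso (M.fromTildeΓ.app ⊤)).1
    refine Eq.trans ?_ (fromTildeΓ_app_toTop M x).symm
    have e : (asIso M.fromTildeΓ).inv.app ⊤ ≫ M.fromTildeΓ.app ⊤ = 𝟙 _ := by
      rw [← Scheme.Modules.Hom.comp_app, asIso_inv, IsIso.inv_hom_id]
      rfl
    exact ConcreteCategory.congr_hom e x
  rw [← tilde_map_app_toTop, ← h]
  rfl

/-- Morphisms from a quasi-coherent module to the module associated to `N`. -/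
lemma exists_hom_tilde (M : (Spec R).Modules) [M.IsQuasicoherent] {N : ModuleCat.{u} R}
    (ψ : Γ(M, ⊤) →ₗ[R] N) : ∃ f : M ⟶ tilde N, ∀ x, f.app ⊤ x = toTop N (ψ x) :=
  have ψ' : { g : ModuleCat.of R Γ(M, ⊤) ⟶ N // ∀ x : Γ(M, ⊤), g x = ψ x } :=
    ⟨ModuleCat.ofHom ψ, fun _ ↦ rfl⟩
  (exists_hom_tilde_aux M (N := N) ψ'.1).imp fun _ hf x ↦
    (hf x).trans (congrArg (toTop N) (ψ'.2 x))

variable {J : Type u} {n : ℕ} {c : J → Fin n → Γ(Spec R, ⊤)}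

instance {X : Scheme.{u}} {J : Type u} {n : ℕ} (c : J → Fin n → Γ(X, ⊤)) :
    (presented c).IsQuasicoherent :=
  (SheafOfModules.presentationOfIsCokernelFree (R := X.ringCatSheaf) (relHom c) (presentedπ c)
    (relHom_presentedπ c) (cokernelIsCokernel (relHom c))).isQuasicoherent

instance {X : Scheme.{u}} {J : Type u} {n : ℕ} (c : J → Fin n → Γ(X, ⊤)) :
    (presented c).IsFiniteType :=
  isFiniteType_of_generatingSections (R := X.ringCatSheaf)
    (genOfEpi (freeGenerators X (ULift.{u} (Fin n))) (presentedπ c))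
    (inferInstanceAs (Finite (ULift.{u} (Fin n))))

/-- The quotient of the global sections by the span receives a morphism from the module that kills
the generators. This morphism is zero, so the quotient vanishes. -/
lemma span_presentedGen : Submodule.span R (Set.range (presentedGen c)) = ⊤ := by
  obtain ⟨f, hf⟩ := exists_hom_tilde (presented c)
    (N := ModuleCat.of R (Γ(presented c, ⊤) ⧸ Submodule.span R (Set.range (presentedGen c))))
    (Submodule.mkQ _)
  have h : f = 0 := presented_hom_ext fun i ↦ by
    rw [hf]
    have : Submodule.mkQ (Submodule.span R (Set.range (presentedGen c))) (presentedGen c i) = 0 :=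
      (Submodule.Quotient.mk_eq_zero _).2 (Submodule.subset_span ⟨i, rfl⟩)
    rw [this, map_zero]
    rfl
  rw [eq_top_iff]
  intro x _
  have hx := hf x
  rw [h] at hx
  exact (Submodule.Quotient.mk_eq_zero _).1 (toTop_injective _ (hx.symm.trans (map_zero _).symm))

/-- The classes of the basis vectors in R^n modulo the relations satisfy the relations, so they
define a morphism to the associated module. Applied to the vanishing combination it shows that the
class of `v` is zero, with no appeal to exactness of global sections. -/
lemma mem_span_of_sum_eq_zero (v : Fin n → R) (hv : ∑ i, v i • presentedGen c i = 0) :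
    v ∈ Submodule.span R (Set.range fun j i ↦ (Scheme.ΓSpecIso R).hom (c j i)) := by
  set Q := Submodule.span R (Set.range fun j i ↦ (Scheme.ΓSpecIso R).hom (c j i)) with hQ
  let N : ModuleCat.{u} R := ModuleCat.of R ((Fin n → R) ⧸ Q)
  let ψ : (Fin n → R) →ₗ[R] Γ(tilde N, ⊤) := (toTop N).comp Q.mkQ
  have key (w : Fin n → R) : ∑ i, w i • ψ (Pi.single i 1) = ψ w := by
    rw [LinearMap.pi_apply_eq_sum_univ ψ w]
    refine Finset.sum_congr rfl fun i _ ↦ ?_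
    congr 2
    funext k
    simp [Pi.single_apply, eq_comm]
  let f : presented c ⟶ tilde N := presentedDesc (fun i ↦ ψ (Pi.single i 1)) fun j ↦ by
    simp only [smul_top_eq]
    rw [key fun i ↦ (Scheme.ΓSpecIso R).hom (c j i)]
    have : Q.mkQ (fun i ↦ (Scheme.ΓSpecIso R).hom (c j i)) = 0 :=
      (Submodule.Quotient.mk_eq_zero _).2 (Submodule.subset_span ⟨j, rfl⟩)
    change toTop N (Q.mkQ _) = 0
    rw [this]
    exact map_zero _
  have h := congr(f.app ⊤ $hv)
  have h' : ψ v = 0 := by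
    rw [← key, ← map_zero (f.app ⊤).hom]
    refine Eq.trans ?_ h
    rw [map_sum]
    refine Finset.sum_congr rfl fun i _ ↦ ?_
    rw [smul_Spec_def, smul_Spec_def, Scheme.Modules.Hom.app_smul, presentedDesc_gen]
  exact (Submodule.Quotient.mk_eq_zero _).1 (toTop_injective _ (h'.trans (map_zero _).symm))

end Spec

section Affine

variable {X : Scheme.{u}} {V : X.Opens} (hV : IsAffineOpen V) {J : Type u} {n : ℕ}
  (c : J → Fin n → Γ(X, ⊤))

/-- Linear maps on global sections over a spectrum, given by a morphism of modules. -/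
def appTopₗ {R : CommRingCat.{u}} {M N : (Spec R).Modules} (f : M ⟶ N) :
    Γ(M, ⊤) →ₗ[R] Γ(N, ⊤) where
  toFun := f.app ⊤
  map_add' := map_add _
  map_smul' r x := by
    rw [smul_Spec_def, Scheme.Modules.Hom.app_smul, RingHom.id_apply, smul_Spec_def]

/-- The restriction of a presented module to an affine open subset is presented. -/
def presentedRestrict : (presented c).restrict hV.fromSpec ⟶
    presented (fun j i ↦ hV.fromSpec.appTop (c j i)) :=
  ((restrictAdjunction hV.fromSpec).homEquiv _ _).symm (presentedσ hV.fromSpec fun _ _ ↦ rfl)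

instance : IsIso (presentedRestrict hV c) :=
  (isIso_homEquiv_symm_iff _ _).2 (bijective_presentedσ_comp _ _)

lemma presentedRestrict_gen (i : Fin n) :
    (presentedRestrict hV c).app ⊤
      (((presented c).restrictAppIso hV.fromSpec ⊤).inv (mres _ le_top (presentedGen c i))) =
        presentedGen _ i := by
  have h := ((restrictAdjunction hV.fromSpec).homEquiv _ _).apply_symm_apply
    (presentedσ hV.fromSpec (c := c) fun _ _ ↦ rfl)
  rw [Adjunction.homEquiv_unit] at h
  exact congr(Scheme.Modules.Hom.app $h ⊤ (presentedGen c i)).trans (presentedσ_gen _ _ i)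

/-- Sections of a presented module over an affine open subset. -/
def presentedSec : Γ(presented c, V) ≃ₗ[Γ(X, V)]
    Γ(presented (fun j i ↦ hV.fromSpec.appTop (c j i)), ⊤) :=
  (specSecTop hV _).symm ≪≫ₗ LinearEquiv.ofBijective (appTopₗ (presentedRestrict hV c))
    (ConcreteCategory.bijective_of_isIso ((presentedRestrict hV c).app ⊤))

lemma presentedSec_gen (i : Fin n) :
    presentedSec hV c (mres _ le_top (presentedGen c i)) = presentedGen _ i := by
  refine Eq.trans ?_ (presentedRestrict_gen hV c i)
  change (presentedRestrict hV c).app ⊤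
    (((presented c).restrictAppIso hV.fromSpec ⊤).inv (mres _ _ (mres _ _ _))) = _
  rw [mres_mres]

lemma fromSpec_appTop (a : Γ(X, ⊤)) :
    (Scheme.ΓSpecIso Γ(X, V)).hom (hV.fromSpec.appTop a) = fres X le_top a := by
  have h := congr($(hV.fromSpec_app_of_le ⊤ le_top) a)
  refine (congrArg (Scheme.ΓSpecIso Γ(X, V)).hom h).trans ?_
  refine (congrArg (Scheme.ΓSpecIso Γ(X, V)).hom
    (congr($((Spec Γ(X, V)).presheaf.map_id (.op ⊤)) ((Scheme.ΓSpecIso Γ(X, V)).inv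
      (fres X le_top a))))).trans ?_
  exact (Scheme.ΓSpecIso Γ(X, V)).inv_hom_id_apply _

/-- The sections of a presented module over an affine open subset are generated by the
generators. -/
lemma span_mres_presentedGen (hV : IsAffineOpen V) :
    Submodule.span Γ(X, V) (Set.range fun i ↦ mres _ (le_top (a := V)) (presentedGen c i)) = ⊤ := by
  apply Submodule.map_injective_of_injective (presentedSec hV c).injective
  rw [Submodule.map_span, Submodule.map_top, LinearEquiv.range, ← Set.range_comp]
  refine Eq.trans ?_ (span_presentedGen (c := fun j i ↦ hV.fromSpec.appTop (c j i)))
  congr 2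
  funext i
  exact presentedSec_gen hV c i

/-- The relations between the generators of a presented module. -/
lemma mem_span_of_sum_mres_eq_zero (hV : IsAffineOpen V) (v : Fin n → Γ(X, V))
    (hv : ∑ i, v i • mres _ (le_top (a := V)) (presentedGen c i) = 0) :
    v ∈ Submodule.span Γ(X, V) (Set.range fun j i ↦ fres X (le_top (a := V)) (c j i)) := by
  have h := congr(presentedSec hV c $hv)
  rw [map_sum, map_zero] at h
  simp only [LinearEquiv.map_smul, presentedSec_gen] at h
  have := mem_span_of_sum_eq_zero v h
  simpa only [fromSpec_appTop] using this

end Affine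

end

end KCorr

/-! ### Finiteness and freeness under localization; sections over affine opens -/

namespace KCorr

noncomputable section

section Algebra

variable {R R' N N' : Type*} [CommRing R] [CommRing R'] [AddCommGroup N] [Module R N]
  [AddCommGroup N'] [Module R' N'] [Algebra R R'] (r : R) [IsLocalization.Away r R']

/-- A finitely generated projective module is free in a neighbourhood of every point. -/
lemma exists_free_localization [Module.FinitePresentation R N] [Module.Projective R N]
    (p : PrimeSpectrum R) : ∃ r : R, r ∉ p.asIdeal ∧
      Module.Free (Localization.Away r) (LocalizedModule.Away r N) := by
  have : p ∈ Module.freeLocus R N :=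
    Module.freeLocus_eq_univ_iff.2 ‹Module.Projective R N› ▸ Set.mem_univ p
  have : Module.Free _ _ := this
  obtain ⟨r, hr, hr', _⟩ := Module.FinitePresentation.exists_free_localizedModule_powers
    p.asIdeal.primeCompl (LocalizedModule.mkLinearMap p.asIdeal.primeCompl N)
    (Localization.AtPrime p.asIdeal)
  exact ⟨r, hr, hr'⟩

/-- Two localizations of a module have the same properties. -/
lemma free_and_finite_away_transfer {R₁ R₂ N₁ N₂ : Type*} [CommRing R₁] [CommRing R₂]
    [AddCommGroup N₁] [AddCommGroup N₂] [Algebra R R₁] [Algebra R R₂] [Module R N₁] [Module R N₂]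
    [Module R₁ N₁] [Module R₂ N₂] [IsScalarTower R R₁ N₁] [IsScalarTower R R₂ N₂]
    [IsLocalization.Away r R₁] [IsLocalization.Away r R₂] (f₁ : N →ₗ[R] N₁) (f₂ : N →ₗ[R] N₂)
    [IsLocalizedModule.Away r f₁] [IsLocalizedModule.Away r f₂] :
    (Module.Free R₁ N₁ → Module.Free R₂ N₂) ∧ (Module.Finite R₁ N₁ → Module.Finite R₂ N₂) := by
  let : Algebra R₁ R₂ := (IsLocalization.Away.lift (g := algebraMap R R₂) r
    (IsLocalization.Away.algebraMap_isUnit r)).toAlgebra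
  have : IsScalarTower R R₁ R₂ :=
    IsScalarTower.of_algebraMap_eq fun a ↦ (IsLocalization.Away.lift_eq (g := algebraMap R R₂) r
      (IsLocalization.Away.algebraMap_isUnit r) a).symm
  let e₂ : TensorProduct R R₂ N ≃ₗ[R₂] N₂ := (IsLocalizedModule.isBaseChange (.powers r) R₂ f₂).equiv
  let e₁ : TensorProduct R R₁ N ≃ₗ[R₁] N₁ := (IsLocalizedModule.isBaseChange (.powers r) R₁ f₁).equiv
  let e := TensorProduct.AlgebraTensorModule.cancelBaseChange R R₁ R₂ R₂ N ≪≫ₗ e₂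
  refine ⟨fun _ ↦ ?_, fun _ ↦ ?_⟩
  · have : Module.Free R₁ (TensorProduct R R₁ N) := Module.Free.of_equiv e₁.symm
    exact Module.Free.of_equiv e
  · have : Module.Finite R₁ (TensorProduct R R₁ N) := Module.Finite.equiv e₁.symm
    exact Module.Finite.equiv e

/-- Finiteness and freeness of a localized module. -/
lemma finite_and_free_of_away (f : N →+ N') (hf : ∀ (a : R) x, f (a • x) = algebraMap R R' a • f x)
    (h₁ : ∀ x : N', ∃ (n : ℕ) (y : N), f y = algebraMap R R' r ^ n • x)
    (h₂ : ∀ x : N, f x = 0 → ∃ n : ℕ, r ^ n • x = 0) :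
    (Module.Finite R N → Module.Finite R' N') ∧ (Module.Free R N → Module.Free R' N') ∧
      (Module.Free (Localization.Away r) (LocalizedModule.Away r N) → Module.Free R' N') ∧
      (Module.Free R' N' → Module.Free (Localization.Away r) (LocalizedModule.Away r N)) ∧
      (Module.Finite R' N' → Module.Finite (Localization.Away r) (LocalizedModule.Away r N)) := by
  let : Module R N' := Module.compHom N' (algebraMap R R')
  have : IsScalarTower R R' N' := ⟨fun a b x ↦ by
    rw [Algebra.smul_def, mul_smul]
    rfl⟩
  let g : N →ₗ[R] N' := { f with map_smul' := hf }
  have : IsLocalizedModule.Away r g := by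
    refine IsLocalizedModule.Away.mk_of_addCommGroup ?_ (fun x ↦ ?_) h₂
    · have hu : IsUnit (algebraMap R R' r) := IsLocalization.Away.algebraMap_isUnit r
      have := hu.map (algebraMap R' (Module.End R' N'))
      rw [Module.End.isUnit_iff] at this ⊢
      exact this
    · obtain ⟨n, y, hy⟩ := h₁ x
      refine ⟨n, y, ?_⟩
      rw [← map_pow] at hy
      exact hy.symm
  have t₁ := free_and_finite_away_transfer r (R₁ := Localization.Away r) (R₂ := R')
    (LocalizedModule.mkLinearMap (.powers r) N) g
  have t₂ := free_and_finite_away_transfer r (R₂ := Localization.Away r) (R₁ := R')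
    g (LocalizedModule.mkLinearMap (.powers r) N)
  exact ⟨fun _ ↦ Module.Finite.of_isLocalizedModule (.powers r) g,
    fun _ ↦ Module.free_of_isLocalizedModule (.powers r) g, t₁.1, t₂.1, t₂.2⟩

end Algebra

section Transfer

open Scheme.Modules

variable {X : Scheme.{u}} {M : X.Modules} {V W : X.Opens}

lemma IsLoc.finite_and_free (h : IsLoc M V) (hV : IsAffineOpen V) (r : Γ(X, V)) :
    (Module.Finite Γ(X, V) Γ(M, V) →
      Module.Finite Γ(X, X.basicOpen r) Γ(M, X.basicOpen r)) ∧
    (Module.Free Γ(X, V) Γ(M, V) → Module.Free Γ(X, X.basicOpen r) Γ(M, X.basicOpen r)) ∧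
    (Module.Free (Localization.Away r) (LocalizedModule.Away r Γ(M, V)) →
      Module.Free Γ(X, X.basicOpen r) Γ(M, X.basicOpen r)) ∧
    (Module.Free Γ(X, X.basicOpen r) Γ(M, X.basicOpen r) →
      Module.Free (Localization.Away r) (LocalizedModule.Away r Γ(M, V))) ∧
    (Module.Finite Γ(X, X.basicOpen r) Γ(M, X.basicOpen r) →
      Module.Finite (Localization.Away r) (LocalizedModule.Away r Γ(M, V))) := by
  have := hV.isLocalization_basicOpen r
  exact finite_and_free_of_away (R' := Γ(X, X.basicOpen r)) r
    (mres M (X.basicOpen_le r)).hom (fun a x ↦ mres_smul M _ a x)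
    (fun x ↦ h.exists_lift r (X.basicOpen_le r) rfl x) fun x ↦ h.exists_pow r _ rfl x

/-- Locally free modules have free sections on a neighbourhood contained in `W`. -/
lemma exists_free_le (M : X.Modules) [M.IsLocallyFree] (hW : IsAffineOpen W) {x : X} (hx : x ∈ W) :
    ∃ r : Γ(X, W), x ∈ X.basicOpen r ∧
      Module.Free Γ(X, X.basicOpen r) Γ(M, X.basicOpen r) := by
  have hq : M.IsQuasicoherent := isQuasicoherent_of_isLocallyFree (R := X.ringCatSheaf) M
  obtain ⟨V, hxV, hV, hM⟩ := exists_free M x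
  obtain ⟨f, g, hfg, hxf⟩ := exists_basicOpen_le_affine_inter hW hV x ⟨hx, hxV⟩
  exact ⟨f, hxf, hfg ▸ (((isLoc_of_isQuasicoherent hV M).finite_and_free hV g).2.1 hM)⟩

lemma exists_finite_le (M : X.Modules) [M.IsQuasicoherent] [M.IsFiniteType] (hW : IsAffineOpen W)
    {x : X} (hx : x ∈ W) :
    ∃ r : Γ(X, W), x ∈ X.basicOpen r ∧
      Module.Finite Γ(X, X.basicOpen r) Γ(M, X.basicOpen r) := by
  obtain ⟨V, hxV, hV, hM⟩ := exists_finite M x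
  obtain ⟨f, g, hfg, hxf⟩ := exists_basicOpen_le_affine_inter hW hV x ⟨hx, hxV⟩
  exact ⟨f, hxf, hfg ▸ (((isLoc_of_isQuasicoherent hV M).finite_and_free hV g).1 hM)⟩

/-- Sections of a quasi-coherent module of finite type over an affine open subset. -/
lemma finite_sections (M : X.Modules) [M.IsQuasicoherent] [M.IsFiniteType] (hV : IsAffineOpen V) :
    Module.Finite Γ(X, V) Γ(M, V) := by
  let s : Set Γ(X, V) := {r | Module.Finite Γ(X, X.basicOpen r) Γ(M, X.basicOpen r)}
  refine Module.Finite.of_localizationSpan s ((hV.self_le_iSup_basicOpen_iff).1 fun x hx ↦ ?_)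
    fun r ↦ ((isLoc_of_isQuasicoherent hV M).finite_and_free hV r.1).2.2.2.2 r.2
  obtain ⟨r, hxr, hr⟩ := exists_finite_le M hV hx
  exact Opens.mem_iSup.2 ⟨⟨r, hr⟩, hxr⟩

/-- Sections of a locally free module over an affine open subset. -/
lemma flat_sections (M : X.Modules) [M.IsLocallyFree] (hV : IsAffineOpen V) :
    Module.Flat Γ(X, V) Γ(M, V) := by
  have hq : M.IsQuasicoherent := isQuasicoherent_of_isLocallyFree (R := X.ringCatSheaf) M
  -- Freeness holds only on small principal opens, whereas flatness descends from a family
  -- generating the unit ideal. Projectivity follows later from flatness together with finiteness.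
  let s : Set Γ(X, V) := {r | Module.Free Γ(X, X.basicOpen r) Γ(M, X.basicOpen r)}
  refine Module.flat_of_localized_span _ _ s ((hV.self_le_iSup_basicOpen_iff).1 fun x hx ↦ ?_)
    fun r ↦ ?_
  · obtain ⟨r, hxr, hr⟩ := exists_free_le M hV hx
    exact Opens.mem_iSup.2 ⟨⟨r, hr⟩, hxr⟩
  · have := ((isLoc_of_isQuasicoherent hV M).finite_and_free hV r.1).2.2.2.1 r.2
    have : Module.Flat Γ(X, V) (Localization.Away r.1) :=
      IsLocalization.flat _ (Submonoid.powers r.1)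
    exact Module.Flat.trans Γ(X, V) (Localization.Away r.1) _

/-! ### Direct images under affine morphisms -/

/-- The preimage of a principal open is the principal open of the pulled back function, so both
conditions are instances of those upstairs. -/
lemma IsLoc.pushforward {X' : Scheme.{u}} (p : X' ⟶ X) {M : X'.Modules} (h : IsLoc M (p ⁻¹ᵁ V)) :
    IsLoc ((Scheme.Modules.pushforward p).obj M) V where
  exists_lift r W hW hr s := by
    obtain ⟨n, t, ht⟩ := h.exists_lift (p.app V r) (p.preimage_mono hW)
      (by rw [hr, Scheme.preimage_basicOpen]) s
    refine ⟨n, t, ht.trans ?_⟩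
    change _ = p.app W (fres X hW r ^ n) • (show Γ(M, p ⁻¹ᵁ W) from s)
    rw [map_pow]
    congr 2
    exact congr($(p.naturality (homOfLE hW).op) r).symm
  exists_pow r W hW hr t ht := by
    obtain ⟨n, hn⟩ := h.exists_pow (p.app V r) (p.preimage_mono hW)
      (by rw [hr, Scheme.preimage_basicOpen]) t ht
    refine ⟨n, ?_⟩
    change p.app V (r ^ n) • (show Γ(M, p ⁻¹ᵁ V) from t) = 0
    rw [map_pow]
    exact hn

/-! ### Biproducts -/

variable (M) (N : X.Modules)

@[simp] lemma fst_app_inl_app (x : Γ(M, V)) :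
    (biprod.fst : M ⊞ N ⟶ M).app V ((biprod.inl : M ⟶ M ⊞ N).app V x) = x :=
  congr(Scheme.Modules.Hom.app $(biprod.inl_fst (X := M) (Y := N)) V x)

@[simp] lemma snd_app_inl_app (x : Γ(M, V)) :
    (biprod.snd : M ⊞ N ⟶ N).app V ((biprod.inl : M ⟶ M ⊞ N).app V x) = 0 :=
  congr(Scheme.Modules.Hom.app $(biprod.inl_snd (X := M) (Y := N)) V x)

@[simp] lemma fst_app_inr_app (x : Γ(N, V)) :
    (biprod.fst : M ⊞ N ⟶ M).app V ((biprod.inr : N ⟶ M ⊞ N).app V x) = 0 :=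
  congr(Scheme.Modules.Hom.app $(biprod.inr_fst (X := M) (Y := N)) V x)

@[simp] lemma snd_app_inr_app (x : Γ(N, V)) :
    (biprod.snd : M ⊞ N ⟶ N).app V ((biprod.inr : N ⟶ M ⊞ N).app V x) = x :=
  congr(Scheme.Modules.Hom.app $(biprod.inr_snd (X := M) (Y := N)) V x)

lemma inl_fst_add_inr_snd (x : Γ(M ⊞ N, V)) :
    (biprod.inl : M ⟶ M ⊞ N).app V ((biprod.fst : M ⊞ N ⟶ M).app V x) +
      (biprod.inr : N ⟶ M ⊞ N).app V ((biprod.snd : M ⊞ N ⟶ N).app V x) = x :=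
  congr(Scheme.Modules.Hom.app $(biprod.total (X := M) (Y := N)) V x)

lemma mres_app {M N : X.Modules} (f : M ⟶ N) (h : W ≤ V) (x : Γ(M, V)) :
    mres N h (f.app V x) = f.app W (mres M h x) :=
  congr($(f.mapPresheaf.naturality (homOfLE h).op) x).symm

/-- Sections of a direct sum. -/
def biprodSec : Γ(M ⊞ N, V) ≃ₗ[Γ(X, V)] Γ(M, V) × Γ(N, V) where
  toFun x := ((biprod.fst : M ⊞ N ⟶ M).app V x, (biprod.snd : M ⊞ N ⟶ N).app V x)
  invFun x := (biprod.inl : M ⟶ M ⊞ N).app V x.1 + (biprod.inr : N ⟶ M ⊞ N).app V x.2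
  left_inv x := inl_fst_add_inr_snd M N x
  right_inv x := by
    ext <;> simp
  map_add' x y := by
    ext <;> simp
  map_smul' r x := by
    ext <;> simp

variable {M N}

lemma IsLoc.biprod (h : IsLoc M V) (h' : IsLoc N V) : IsLoc (M ⊞ N) V where
  exists_lift r W hW hr s := by
    obtain ⟨n, t, ht⟩ := h.exists_lift r hW hr ((biprod.fst : M ⊞ N ⟶ M).app W s)
    obtain ⟨n', t', ht'⟩ := h'.exists_lift r hW hr ((biprod.snd : M ⊞ N ⟶ N).app W s)
    -- Each lift is multiplied by the power of `r` needed for the other, which gives both components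
    -- the same exponent.
    refine ⟨n + n', (biprodSec M N).symm (r ^ n' • t, r ^ n • t'),
      (biprodSec M N).injective (Prod.ext ?_ ?_)⟩
    · have : (biprod.fst : M ⊞ N ⟶ M).app V ((biprodSec M N).symm (r ^ n' • t, r ^ n • t')) = _ :=
        congr($((biprodSec M N).apply_symm_apply _).1)
      change (biprod.fst : M ⊞ N ⟶ M).app W _ = (biprod.fst : M ⊞ N ⟶ M).app W _
      rw [← mres_app, this, mres_smul, ht, map_pow, smul_smul, ← pow_add, Hom.app_smul,
        add_comm n']
    · have : (biprod.snd : M ⊞ N ⟶ N).app V ((biprodSec M N).symm (r ^ n' • t, r ^ n • t')) = _ :=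
        congr($((biprodSec M N).apply_symm_apply _).2)
      change (biprod.snd : M ⊞ N ⟶ N).app W _ = (biprod.snd : M ⊞ N ⟶ N).app W _
      rw [← mres_app, this, mres_smul, ht', map_pow, smul_smul, ← pow_add, Hom.app_smul]
  exists_pow r W hW hr t ht := by
    obtain ⟨n, hn⟩ := h.exists_pow r hW hr ((biprod.fst : M ⊞ N ⟶ M).app V t) (by
      rw [mres_app, ht, map_zero])
    obtain ⟨n', hn'⟩ := h'.exists_pow r hW hr ((biprod.snd : M ⊞ N ⟶ N).app V t) (by
      rw [mres_app, ht, map_zero])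
    refine ⟨n + n', (biprodSec M N).injective ?_⟩
    rw [LinearEquiv.map_smul, map_zero]
    refine Prod.ext ?_ ?_
    · change r ^ (n + n') • (biprod.fst : M ⊞ N ⟶ M).app V t = 0
      rw [add_comm, pow_add, mul_smul, hn, smul_zero]
    · change r ^ (n + n') • (biprod.snd : M ⊞ N ⟶ N).app V t = 0
      rw [pow_add, mul_smul, hn', smul_zero]

instance isQuasicoherent_biprod [M.IsQuasicoherent] [N.IsQuasicoherent] :
    (M ⊞ N).IsQuasicoherent := isQuasicoherent_of_isLoc fun x ↦ by
  obtain ⟨V, hV, hxV, -⟩ := exists_isAffineOpen_mem_and_subset (x := x) (U := ⊤) trivial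
  exact ⟨V, hxV, hV, (isLoc_of_isQuasicoherent hV M).biprod (isLoc_of_isQuasicoherent hV N)⟩

lemma isFiniteType_biprod [M.IsQuasicoherent] [N.IsQuasicoherent] [M.IsFiniteType]
    [N.IsFiniteType] : (M ⊞ N).IsFiniteType := isFiniteType_of_isLoc fun x ↦ by
  obtain ⟨V, hxV, hV, hM⟩ := exists_finite M x
  obtain ⟨r, hr, hN⟩ := exists_finite_le N hV hxV
  have hM' := ((isLoc_of_isQuasicoherent hV M).finite_and_free hV r).1 hM
  exact ⟨_, hr, hV.basicOpen r, isLoc_of_isQuasicoherent (hV.basicOpen r) _,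
    Module.Finite.equiv (biprodSec M N).symm⟩

end Transfer

end

end KCorr

/-! ### The module of a representation is a bimodule -/

namespace KCorr

noncomputable section

open Scheme.Modules

/-- A quotient of `C` is finite if it is dominated by two finite quotients. -/
lemma finite_of_ker_inf_le {R C A B D : Type*} [CommRing R] [CommRing C] [CommRing A] [CommRing B]
    [CommRing D] [IsNoetherianRing R] (g : R →+* C) (a : C →+* A) (b : C →+* B) (d : C →+* D)
    (hd : Function.Surjective d) (h : ∀ c, a c = 0 → b c = 0 → d c = 0)
    (ha : (a.comp g).Finite) (hb : (b.comp g).Finite) : (d.comp g).Finite := by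
  algebraize [g, a.comp g, b.comp g, d.comp g]
  let L : C →ₗ[R] A × B :=
    { toFun c := (a c, b c)
      map_add' x y := by simp
      map_smul' r x := by
        simp only [Algebra.smul_def, map_mul, RingHom.id_apply]
        rfl }
  let d' : C →ₗ[R] D :=
    { d with
      map_smul' r x := by
        simp only [Algebra.smul_def]
        exact map_mul d _ _ }
  have : Module.Finite R A := ha
  have : Module.Finite R B := hb
  have : Module.Finite R (C ⧸ LinearMap.ker L) := Module.Finite.equiv L.quotKerEquivRange.symm
  exact Module.Finite.of_surjective ((LinearMap.ker L).liftQ d' fun c hc ↦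
    h c congr(Prod.fst $hc) congr(Prod.snd $hc))
    fun y ↦ (hd y).elim fun c hc ↦ ⟨Submodule.Quotient.mk c, hc⟩

namespace Rep

variable {S : Scheme.{u}} {U Y : Over S} {n : ℕ} (ρ : Rep U Y n)

/-- The restrictions of the generators of `ρ.mod`. -/
def genOn (V : U.left.Opens) (i : Fin n) : Γ(ρ.mod, prodFst U Y ⁻¹ᵁ V) :=
  mres ρ.mod le_top (ρ.gen i)

/-- The combinations of the generators, as sections of the direct image of `ρ.mod`. -/
def pushSec (V : U.left.Opens) : (Fin n → Γ(U.left, V)) →ₗ[Γ(U.left, V)]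
    Γ((pushforward (prodFst U Y)).obj ρ.mod, V) :=
  Fintype.linearCombination Γ(U.left, V) (M := Γ((pushforward (prodFst U Y)).obj ρ.mod, V))
    (ρ.genOn V)

lemma pushSec_apply (V : U.left.Opens) (v : Fin n → Γ(U.left, V)) :
    ρ.pushSec V v = (∑ i, fstFun U Y V (v i) • ρ.genOn V i : Γ(ρ.mod, prodFst U Y ⁻¹ᵁ V)) := rfl

lemma fres_appTop_fst (V : U.left.Opens) (a : Γ(U.left, ⊤)) :
    fres (prod U Y) (le_top (a := prodFst U Y ⁻¹ᵁ V)) ((prodFst U Y).appTop a) =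
      fstFun U Y V (res le_top a) :=
  congr($((prodFst U Y).naturality (homOfLE (le_top (a := V))).op) a).symm

lemma fres_appTop_snd (V : U.left.Opens) (b : Γ(Y.left, ⊤)) :
    fres (prod U Y) (le_top (a := prodFst U Y ⁻¹ᵁ V)) ((prodSnd U Y).appTop b) =
      sndFun U Y V b := rfl

variable [IsAffine S] [IsAffine Y.left] {V : U.left.Opens} (hV : IsAffineOpen V)

-- The relations hold for functions on `Y`; by linearity they hold for all functions on V × Y, with
-- the extended representation as coefficients.
include hV in
lemma smul_genOn (c : Γ(prod U Y, prodFst U Y ⁻¹ᵁ V)) (i : Fin n) :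
    c • ρ.genOn V i = ∑ j, fstFun U Y V (ρ.extend hV c j i) • ρ.genOn V j := by
  have key (b) : sndFun U Y V b • ρ.genOn V i =
      ∑ j, fstFun U Y V (res le_top (ρ.toHom b j i)) • ρ.genOn V j := by
    have h := congr(mres ρ.mod (le_top (a := prodFst U Y ⁻¹ᵁ V)) ($(ρ.isSolution_gen b) i))
    rw [Pi.smul_apply, mres_smul, fres_appTop_snd, comb, map_sum] at h
    refine h.trans (Finset.sum_congr rfl fun j _ ↦ ?_)
    rw [mres_smul]
    exact congr($(fres_appTop_fst V _) • _)
  obtain ⟨r, a, b, rfl⟩ := exists_sum hV c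
  have he (j : Fin n) : ρ.extend hV (∑ l, fstFun U Y V (a l) * sndFun U Y V (b l)) j i =
      ∑ l, a l * res le_top (ρ.toHom (b l) j i) := by
    rw [map_sum, Matrix.sum_apply]
    exact Finset.sum_congr rfl fun l _ ↦ by rw [extend_mul]; rfl
  simp only [he, map_sum, map_mul, Finset.sum_smul, mul_smul, key, Finset.smul_sum]
  rw [Finset.sum_comm]

include hV in
lemma pushSec_one_mulVec (v : Fin n → Γ(U.left, V)) :
    ρ.pushSec V ((ρ.extend hV 1).mulVec v) = ρ.pushSec V v := by
  rw [pushSec_apply, pushSec_apply]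
  have (i : Fin n) : ρ.genOn V i = ∑ j, fstFun U Y V (ρ.extend hV 1 j i) • ρ.genOn V j := by
    rw [← smul_genOn, one_smul]
  conv_rhs => enter [2, i]; rw [this i]
  simp only [Finset.smul_sum, smul_smul, Matrix.mulVec, dotProduct, map_sum, map_mul,
    Finset.sum_smul]
  rw [Finset.sum_comm]
  exact Finset.sum_congr rfl fun _ _ ↦ Finset.sum_congr rfl fun _ _ ↦ by rw [mul_comm]

include hV in
lemma span_genOn : Submodule.span Γ(prod U Y, prodFst U Y ⁻¹ᵁ V) (Set.range (ρ.genOn V)) = ⊤ :=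
  span_mres_presentedGen ρ.relCoeff (hV.preimage (prodFst U Y))

-- The generators span over functions on V × Y, and `smul_genOn` rewrites such coefficients by
-- functions on `V`.
include hV in
lemma pushSec_surjective : Function.Surjective (ρ.pushSec V) := by
  intro x
  have hx : (show Γ(ρ.mod, prodFst U Y ⁻¹ᵁ V) from x) ∈
      Submodule.span Γ(prod U Y, prodFst U Y ⁻¹ᵁ V) (Set.range (ρ.genOn V)) :=
    (ρ.span_genOn hV).ge trivial
  obtain ⟨c, hc⟩ := (Submodule.mem_span_range_iff_exists_fun _).1 hx
  refine ⟨∑ i, fun j ↦ ρ.extend hV (c i) j i, Eq.trans ?_ hc⟩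
  rw [map_sum]
  refine Finset.sum_congr rfl fun i _ ↦ ?_
  rw [pushSec_apply, smul_genOn ρ hV]

/-- The action of vectors of functions on `V × Y` through the representation. -/
def actVec : (Fin n → Γ(prod U Y, prodFst U Y ⁻¹ᵁ V)) →+ (Fin n → Γ(U.left, V)) where
  toFun w k := ∑ i, ρ.extend hV (w i) k i
  map_zero' := by
    funext k
    simp
  map_add' w w' := by
    funext k
    simp [Finset.sum_add_distrib]

lemma actVec_apply (w) (k : Fin n) : ρ.actVec hV w k = ∑ i, ρ.extend hV (w i) k i := rfl

lemma actVec_smul (c : Γ(prod U Y, prodFst U Y ⁻¹ᵁ V)) (w) :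
    ρ.actVec hV (c • w) = (ρ.extend hV c).mulVec (ρ.actVec hV w) := by
  funext k
  simp only [actVec_apply, Pi.smul_apply, smul_eq_mul, map_mul, Matrix.mul_apply, Matrix.mulVec,
    dotProduct, Finset.mul_sum]
  exact Finset.sum_comm

lemma extend_fstFun (a : Γ(U.left, V)) : ρ.extend hV (fstFun U Y V a) = a • ρ.extend hV 1 := by
  rw [← extend_fstFun_mul, mul_one]

lemma actVec_fstFun (v : Fin n → Γ(U.left, V)) :
    ρ.actVec hV (fun i ↦ fstFun U Y V (v i)) = (ρ.extend hV 1).mulVec v := by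
  funext k
  simp only [actVec_apply, extend_fstFun, Matrix.smul_apply, smul_eq_mul, Matrix.mulVec,
    dotProduct]
  exact Finset.sum_congr rfl fun _ _ ↦ mul_comm _ _

/-- The term `b e_i` contributes the i-th column of ρ(b), and the other term contributes ρ(1) times
that column. They cancel because ρ(1)ρ(b) = ρ(b). -/
lemma actVec_relCoeff (b : Γ(Y.left, ⊤) × Fin n) :
    ρ.actVec hV (fun i ↦ fres (prod U Y) le_top (ρ.relCoeff b i)) = 0 := by
  obtain ⟨b, i⟩ := b
  have h (j : Fin n) : fres (prod U Y) (le_top (a := prodFst U Y ⁻¹ᵁ V)) (ρ.relCoeff (b, i) j) =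
      (if j = i then sndFun U Y V b else 0) - fstFun U Y V (res le_top (ρ.toHom b j i)) := by
    rw [relCoeff, map_sub, apply_ite (fres (prod U Y) _), map_zero, fres_appTop_snd]
    exact congr(_ - $(fres_appTop_fst V _))
  simp only [h]
  have : (fun j ↦ (if j = i then sndFun U Y V b else 0) -
      fstFun U Y V (res le_top (ρ.toHom b j i))) =
      Pi.single i (sndFun U Y V b) - fun j ↦ fstFun U Y V (res le_top (ρ.toHom b j i)) := by
    funext j
    simp [Pi.single_apply]
  rw [this, map_sub, actVec_fstFun, sub_eq_zero]
  have h₁ : ρ.extend hV (sndFun U Y V b) = ρ.extend hV 1 * ρ.extend hV (sndFun U Y V b) := by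
    rw [← map_mul, one_mul]
  funext k
  rw [actVec_apply, Finset.sum_eq_single i, Pi.single_eq_same, h₁, extend_sndFun]
  · rfl
  · intro j _ hj
    rw [Pi.single_eq_of_ne hj, map_zero, Matrix.zero_apply]
  · simp

/-- A vanishing combination has its coefficient vector in the span of the defining relations. The
map `actVec` kills these, turns multiplication by `c` into the matrix of `c`, and sends the vector
to ρ(1)v. -/
lemma pushSec_eq_zero_iff (v : Fin n → Γ(U.left, V)) :
    ρ.pushSec V v = 0 ↔ (ρ.extend hV 1).mulVec v = 0 := by
  refine ⟨fun h ↦ ?_, fun h ↦ by rw [← ρ.pushSec_one_mulVec hV, h, map_zero]⟩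
  have hv := mem_span_of_sum_mres_eq_zero ρ.relCoeff (hV.preimage (prodFst U Y))
    (fun i ↦ fstFun U Y V (v i)) h
  rw [← actVec_fstFun]
  generalize (fun i ↦ fstFun U Y V (v i)) = w at hv
  induction hv using Submodule.span_induction with
  | mem x hx =>
    obtain ⟨b, rfl⟩ := hx
    exact ρ.actVec_relCoeff hV b
  | zero => exact map_zero _
  | add x y _ _ hx hy => rw [map_add, hx, hy, add_zero]
  | smul c x _ hx => rw [actVec_smul, hx, Matrix.mulVec_zero]

/-- The direct image over `V` is the free module modulo the kernel of the idempotent ρ(1). The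
idempotent itself induces a section, whence finite projectivity. -/
lemma exists_section_pushSec : ∃ s : Γ((pushforward (prodFst U Y)).obj ρ.mod, V)
    →ₗ[Γ(U.left, V)] (Fin n → Γ(U.left, V)),
      (∀ v, s (ρ.pushSec V v) = (ρ.extend hV 1).mulVec v) ∧ ∀ x, ρ.pushSec V (s x) = x := by
  have hs := ρ.pushSec_surjective hV
  have hk : LinearMap.ker (ρ.pushSec V) ≤ LinearMap.ker (ρ.extend hV 1).mulVecLin :=
    fun v hv ↦ (ρ.pushSec_eq_zero_iff hV v).1 hv
  let s := ((LinearMap.ker (ρ.pushSec V)).liftQ _ hk).comp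
    ((ρ.pushSec V).quotKerEquivOfSurjective hs).symm.toLinearMap
  have h (v) : s (ρ.pushSec V v) = (ρ.extend hV 1).mulVec v := by
    have : ((ρ.pushSec V).quotKerEquivOfSurjective hs).symm (ρ.pushSec V v) =
        Submodule.Quotient.mk v :=
      (LinearEquiv.symm_apply_eq _).2 rfl
    change (LinearMap.ker (ρ.pushSec V)).liftQ _ hk _ = _
    erw [this]
    rfl
  refine ⟨s, h, fun x ↦ ?_⟩
  obtain ⟨v, rfl⟩ := hs x
  rw [h, pushSec_one_mulVec ρ hV]

include hV in
lemma finite_pushforward : Module.Finite Γ(U.left, V) Γ((pushforward (prodFst U Y)).obj ρ.mod, V) :=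
  Module.Finite.of_surjective _ (ρ.pushSec_surjective hV)

include hV in
lemma projective_pushforward :
    Module.Projective Γ(U.left, V) Γ((pushforward (prodFst U Y)).obj ρ.mod, V) := by
  obtain ⟨s, -, hs⟩ := ρ.exists_section_pushSec hV
  exact Module.Projective.of_split s (ρ.pushSec V) (LinearMap.ext hs)

instance : ρ.mod.IsQuasicoherent := inferInstanceAs (presented ρ.relCoeff).IsQuasicoherent

instance : ρ.mod.IsFiniteType := inferInstanceAs (presented ρ.relCoeff).IsFiniteType

/-- A finite projective module is free on a principal neighbourhood of each point, and localizing
the sections agrees with restricting them. -/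
lemma isLocallyFree_pushforward :
    ((pushforward (prodFst U Y)).obj ρ.mod).IsLocallyFree := isLocallyFree_of_isLoc fun x ↦ by
  obtain ⟨V, hV, hxV, -⟩ := exists_isAffineOpen_mem_and_subset (x := x) (U := ⊤) trivial
  have := ρ.finite_pushforward hV
  have := ρ.projective_pushforward hV
  have := Module.finitePresentation_of_projective Γ(U.left, V)
    Γ((pushforward (prodFst U Y)).obj ρ.mod, V)
  have hloc (W : U.left.Opens) (hW : IsAffineOpen W) :
      IsLoc ((pushforward (prodFst U Y)).obj ρ.mod) W :=
    IsLoc.pushforward _ (isLoc_of_isQuasicoherent (hW.preimage (prodFst U Y)) ρ.mod)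
  obtain ⟨r, hr, hfree⟩ := exists_free_localization
    (N := Γ((pushforward (prodFst U Y)).obj ρ.mod, V)) (hV.primeIdealOf ⟨x, hxV⟩)
  refine ⟨U.left.basicOpen r, ?_, hV.basicOpen r, hloc _ (hV.basicOpen r),
    ((hloc V hV).finite_and_free hV r).2.2.1 hfree⟩
  have h₁ : hV.primeIdealOf ⟨x, hxV⟩ ∈ hV.fromSpec ⁻¹ᵁ U.left.basicOpen r := by
    rw [hV.fromSpec_preimage_basicOpen]
    exact hr
  have h₂ := hV.fromSpec_primeIdealOf ⟨x, hxV⟩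
  change hV.fromSpec (hV.primeIdealOf ⟨x, hxV⟩) ∈ U.left.basicOpen r at h₁
  rwa [h₂] at h₁

end Rep

/-! ### Supports -/

section Support

variable {X : Scheme.{u}} {M N : X.Modules} {V : X.Opens}

lemma germ_eq_zero_of_mres {W W' : X.Opens} {x : X} (hx : x ∈ W) (hx' : x ∈ W') (h : W' ≤ W)
    (s : Γ(M, W)) (hs : mres M h s = 0) : M.presheaf.germ W x hx s = 0 := by
  have := TopCat.Presheaf.germ_res_apply M.presheaf (homOfLE h) x hx' s
  rw [← this]
  erw [hs]
  exact map_zero _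

lemma isUnit_fres_basicOpen {W : X.Opens} (a : Γ(X, V)) (h : W ≤ X.basicOpen a) :
    IsUnit (fres X (h.trans (X.basicOpen_le a)) a) := by
  have := (X.toRingedSpace.isUnit_res_basicOpen a).map (fres X h).hom
  convert this using 1
  exact congr($(X.presheaf.map_comp (homOfLE (X.basicOpen_le a)).op (homOfLE h).op) a)

/-- A module killed by a function has no stalk where the function is invertible. -/
lemma not_nontrivial_stalk (hV : IsAffineOpen V) (h : IsLoc M V) (a : Γ(X, V))
    (ha : ∀ t : Γ(M, V), a • t = 0) {x : X} (hx : x ∈ X.basicOpen a) :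
    ¬ Nontrivial (M.presheaf.stalk x) := by
  rw [not_nontrivial_iff_subsingleton]
  refine subsingleton_of_forall_eq 0 fun t ↦ ?_
  obtain ⟨W, hxW, s, rfl⟩ := M.presheaf.exists_germ_eq t
  have hxV := X.basicOpen_le a hx
  obtain ⟨r, hrW, hxr⟩ := hV.exists_basicOpen_le (V := W) ⟨x, hxW⟩ hxV
  obtain ⟨n, t, ht⟩ := h.exists_lift r (X.basicOpen_le r) rfl (mres M hrW s)
  -- Up to a power of `r`, the section extends to one over `V` that is killed by `a`. Where `a` and
  -- `r` are both invertible it therefore vanishes.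
  have hx' : x ∈ X.basicOpen (a * r) := by
    rw [Scheme.basicOpen_mul]
    exact ⟨hx, hxr⟩
  have hle : X.basicOpen (a * r) ≤ X.basicOpen r := by
    rw [Scheme.basicOpen_mul]
    exact inf_le_right
  have hle' : X.basicOpen (a * r) ≤ X.basicOpen a := by
    rw [Scheme.basicOpen_mul]
    exact inf_le_left
  refine germ_eq_zero_of_mres hxW hx' (hle.trans hrW) s ?_
  have h₁ := congr(mres M (hle'.trans (X.basicOpen_le a)) $(ha t))
  rw [mres_smul, map_zero, (isUnit_fres_basicOpen a hle').smul_eq_zero] at h₁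
  have h₂ := congr(mres M hle $ht)
  rw [mres_mres, h₁, mres_smul, map_pow, mres_mres] at h₂
  have hu : IsUnit (fres X hle (fres X (X.basicOpen_le r) r)) :=
    (isUnit_fres_basicOpen r le_rfl).map (fres X hle).hom
  exact ((hu.pow n).smul_eq_zero).1 h₂.symm

lemma suppClosure_le {A : Closeds X} (h : ∀ x ∉ A, ¬ Nontrivial (M.presheaf.stalk x)) :
    suppClosure M ≤ A :=
  closure_minimal (fun x hx ↦ by_contra fun hxA ↦ h x hxA hx) A.isClosed

lemma germ_app_eq_zero {W : X.Opens} {x : X} (hx : x ∈ W) (f : M ⟶ N)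
    [Subsingleton (M.presheaf.stalk x)] (s : Γ(M, W)) :
    N.presheaf.germ W x hx (f.app W s) = 0 := by
  obtain ⟨W', hxW', i, i', h⟩ := M.presheaf.germ_eq x hx hx s 0 (Subsingleton.elim _ _)
  refine germ_eq_zero_of_mres hx hxW' i.le _ ?_
  rw [mres_app]
  refine (congrArg (f.app W') h).trans ?_
  erw [map_zero]
  exact map_zero _

lemma suppClosure_biprod_le : suppClosure (M ⊞ N) ≤ suppClosure M ⊔ suppClosure N := by
  refine suppClosure_le fun x hx ↦ ?_
  have hM : ¬ Nontrivial (M.presheaf.stalk x) := fun h ↦ hx (Or.inl (subset_closure h))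
  have hN : ¬ Nontrivial (N.presheaf.stalk x) := fun h ↦ hx (Or.inr (subset_closure h))
  rw [not_nontrivial_iff_subsingleton] at hM hN ⊢
  refine subsingleton_of_forall_eq 0 fun t ↦ ?_
  obtain ⟨W, hxW, s, rfl⟩ := (M ⊞ N).presheaf.exists_germ_eq t
  rw [← inl_fst_add_inr_snd M N s, map_add]
  rw [germ_app_eq_zero hxW biprod.inl, germ_app_eq_zero hxW biprod.inr, add_zero]

end Support

section Bimodule

variable {S : Scheme.{u}} {U Y : Over S}

lemma subschemeι_app_eq_zero_iff [IsAffineHom (prodFst U Y)] (Z : (prod U Y).IdealSheafData)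
    {V : U.left.Opens} (hV : IsAffineOpen V) (c : Γ(prod U Y, prodFst U Y ⁻¹ᵁ V)) :
    Z.subschemeι.app (prodFst U Y ⁻¹ᵁ V) c = 0 ↔ c ∈ Z.ideal (prodOpen U Y hV) := by
  rw [← Scheme.IdealSheafData.ker_subschemeι_app]
  rfl

lemma finite_comp_app (Z : (prod U Y).IdealSheafData)
    (h : IsFinite (Z.subschemeι ≫ prodFst U Y)) {V : U.left.Opens} (hV : IsAffineOpen V) :
    ((Z.subschemeι.app (prodFst U Y ⁻¹ᵁ V)).hom.comp (fstFun U Y V).hom).Finite := by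
  have := h.finite_app V hV
  rw [Scheme.Hom.comp_app] at this
  exact this

lemma ideal_inf_le_of_le_sup {X : Scheme.{u}} {A B C : Closeds X} (h : C ≤ A ⊔ B)
    (V : X.affineOpens) :
    (Scheme.IdealSheafData.vanishingIdeal A).ideal V ⊓
      (Scheme.IdealSheafData.vanishingIdeal B).ideal V ≤
        (Scheme.IdealSheafData.vanishingIdeal C).ideal V := by
  have key (D : Closeds X) : (Scheme.IdealSheafData.vanishingIdeal D).ideal V =
      PrimeSpectrum.vanishingIdeal (V.2.fromSpec ⁻¹' D) := rfl
  refine le_trans ?_ (Scheme.IdealSheafData.vanishingIdeal_antimono h V)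
  rw [key, key, key]
  exact (PrimeSpectrum.vanishingIdeal_union _ _).ge

/-- Functions vanishing on both `A` and `B` vanish on `C`. So the functions on `C` are a quotient of
a submodule of a finite module over a noetherian ring. -/
lemma isFinite_of_le_sup [IsAffineHom (prodFst U Y)] [IsLocallyNoetherian U.left]
    {A B C : Closeds (prod U Y)} (h : C ≤ A ⊔ B)
    (hA : IsFinite ((Scheme.IdealSheafData.vanishingIdeal A).subschemeι ≫ prodFst U Y))
    (hB : IsFinite ((Scheme.IdealSheafData.vanishingIdeal B).subschemeι ≫ prodFst U Y)) :
    IsFinite ((Scheme.IdealSheafData.vanishingIdeal C).subschemeι ≫ prodFst U Y) where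
  finite_app V hV := by
    have : IsNoetherianRing Γ(U.left, V) := IsLocallyNoetherian.component_noetherian ⟨V, hV⟩
    rw [Scheme.Hom.comp_app]
    refine finite_of_ker_inf_le (fstFun U Y V).hom _ _
      ((Scheme.IdealSheafData.vanishingIdeal C).subschemeι.app (prodFst U Y ⁻¹ᵁ V)).hom
      ((Scheme.IdealSheafData.vanishingIdeal C).subschemeι_app_surjective (prodOpen U Y hV))
      (fun c h₁ h₂ ↦ (subschemeι_app_eq_zero_iff _ hV c).2 ?_)
      (finite_comp_app _ hA hV) (finite_comp_app _ hB hV)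
    exact ideal_inf_le_of_le_sup h (prodOpen U Y hV)
      ⟨(subschemeι_app_eq_zero_iff _ hV c).1 h₁, (subschemeι_app_eq_zero_iff _ hV c).1 h₂⟩

/-- Sections of the direct image of a direct sum. -/
def pushforwardBiprodSec {X X' : Scheme.{u}} (p : X' ⟶ X) (M N : X'.Modules) (V : X.Opens) :
    Γ((pushforward p).obj (M ⊞ N), V) ≃ₗ[Γ(X, V)]
      Γ((pushforward p).obj M, V) × Γ((pushforward p).obj N, V) :=
  { (biprodSec M N (V := p ⁻¹ᵁ V)).toAddEquiv with
    map_smul' r x := (biprodSec M N (V := p ⁻¹ᵁ V)).map_smul (p.app V r) x }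

lemma IsBimodule.biprod [IsAffineHom (prodFst U Y)] [IsLocallyNoetherian U.left]
    {M N : (prod U Y).Modules} (hM : IsBimodule U Y M) (hN : IsBimodule U Y N) :
    IsBimodule U Y (M ⊞ N) := by
  have := hM.isQuasicoherent
  have := hN.isQuasicoherent
  have := hM.isFiniteType
  have := hN.isFiniteType
  have := hM.isLocallyFree
  have := hN.isLocallyFree
  refine ⟨isQuasicoherent_biprod, isFiniteType_biprod,
    isFinite_of_le_sup suppClosure_biprod_le hM.isFinite_supp hN.isFinite_supp, ?_⟩
  refine isLocallyFree_of_isLoc fun x ↦ ?_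
  have hloc (W : U.left.Opens) (hW : IsAffineOpen W) :
      IsLoc ((pushforward (prodFst U Y)).obj (M ⊞ N)) W :=
    IsLoc.pushforward _ (isLoc_of_isQuasicoherent (hW.preimage (prodFst U Y)) (M ⊞ N))
  obtain ⟨V, hxV, hV, h₁⟩ := exists_free ((pushforward (prodFst U Y)).obj M) x
  obtain ⟨r, hr, h₂⟩ := exists_free_le ((pushforward (prodFst U Y)).obj N) hV hxV
  have h₁' := ((IsLoc.pushforward (prodFst U Y)
    (isLoc_of_isQuasicoherent (hV.preimage (prodFst U Y)) M)).finite_and_free hV r).2.1 h₁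
  exact ⟨_, hr, hV.basicOpen r, hloc _ (hV.basicOpen r),
    Module.Free.of_equiv (pushforwardBiprodSec (prodFst U Y) M N _).symm⟩

/-- Away from the support of the representation some function with zero matrix is invertible. It
annihilates the generators, so the stalk is zero, and the support of the module lies in that of the
representation, which is finite over `U`. -/
lemma Rep.isBimodule [IsAffine S] [IsAffine Y.left] [IsLocallyNoetherian U.left] {n : ℕ}
    (ρ : Rep U Y n) : IsBimodule U Y ρ.mod := by
  refine ⟨inferInstance, inferInstance, ρ.isFinite_of_le_closedSupport (suppClosure_le
    fun x hx ↦ ?_), ρ.isLocallyFree_pushforward⟩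
  obtain ⟨V, hV, hxV, -⟩ :=
    exists_isAffineOpen_mem_and_subset (x := prodFst U Y x) (U := ⊤) trivial
  obtain ⟨c, hc, hc'⟩ : ∃ c, ρ.extend hV c = 0 ∧ x ∈ (prod U Y).basicOpen c := by
    have : ¬ x ∈ ρ.support := hx
    simpa [ρ.mem_support_iff hV (z := x) hxV] using this
  have hV' := hV.preimage (prodFst U Y)
  refine not_nontrivial_stalk hV' (isLoc_of_isQuasicoherent hV' ρ.mod) c (fun t ↦ ?_) hc'
  have ht := (ρ.span_genOn hV).ge (trivial : t ∈ ⊤)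
  induction ht using Submodule.span_induction with
  | mem x hx =>
    obtain ⟨i, rfl⟩ := hx
    rw [ρ.smul_genOn hV, hc]
    exact Finset.sum_eq_zero fun j _ ↦ by rw [Matrix.zero_apply, map_zero, zero_smul]
  | zero => exact smul_zero _
  | add x y _ _ hx hy => rw [smul_add, hx, hy, add_zero]
  | smul a x _ hx => rw [smul_comm, hx, smul_zero]

end Bimodule

end

end KCorr

/-! ### The functor from matrix representations to big bimodules -/

namespace KCorr

noncomputable section

open Scheme.Modules

lemma app_comp_pushforwardId {X : Scheme.{u}} {g : X ⟶ X} (hg : g = 𝟙 X) {M : X.Modules}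
    (s : M ⟶ (pushforward g).obj M) (x : Γ(M, ⊤)) :
    (s ≫ (pushforwardCongr hg).hom.app M ≫ (pushforwardId X).hom.app M).app ⊤ x =
      (show Γ(M, ⊤) from s.app ⊤ x) := by
  subst hg
  rw [Hom.comp_app, Hom.comp_app]
  exact mres_self M le_rfl _

namespace Rep

variable {S : Scheme.{u}} {U Y : Over S} {m n : ℕ}

/-- The morphism of modules given by a matrix. -/
def matHom (ρ : Rep U Y n) (ρ' : Rep U Y m) (a : Matrix (Fin m) (Fin n) Γ(U.left, ⊤))
    (h : ∀ b, a * ρ.toHom b = ρ'.toHom b * a) : ρ.mod ⟶ ρ'.mod :=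
  desc (isSolution_comb ρ'.isSolution_gen a h)

lemma matHom_gen (ρ : Rep U Y n) (ρ' : Rep U Y m) (a : Matrix (Fin m) (Fin n) Γ(U.left, ⊤))
    (h : ∀ b, a * ρ.toHom b = ρ'.toHom b * a) (i : Fin n) :
    (matHom ρ ρ' a h).app ⊤ (ρ.gen i) = comb (prodFst U Y).appTop.hom a ρ'.gen i :=
  desc_gen _ i

lemma matHom_congr {ρ₁ ρ₂ : Rep U Y n} (e : ρ₁ = ρ₂) {ρ₁' ρ₂' : Rep U Y m} (e' : ρ₁' = ρ₂')
    {a₁ a₂ : Matrix (Fin m) (Fin n) Γ(U.left, ⊤)} (ea : a₁ = a₂) (h₁ h₂) :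
    matHom ρ₁ ρ₁' a₁ h₁ ≍ matHom ρ₂ ρ₂' a₂ h₂ := by
  subst e e' ea
  rfl

lemma prodFst_appTop_prodMap {U' : Over S} (f : U' ⟶ U) (x : Γ(U.left, ⊤)) :
    (prodMap f Y).appTop ((prodFst U Y).appTop x) =
      (prodFst U' Y).appTop (f.left.appTop x) := by
  have h : (prodFst U Y).appTop ≫ (prodMap f Y).appTop = f.left.appTop ≫ (prodFst U' Y).appTop := by
    rw [← Scheme.Hom.comp_appTop, ← Scheme.Hom.comp_appTop, prodMap_fst]
  exact congr($h x)

/-- Both composites send a generator to the same combination of generators. The pulled back data are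
variables with equations because iterated pullbacks agree only propositionally. -/
lemma σ_matHom {U' : Over S} (f : U' ⟶ U) {ρ₁ : Rep U Y n} {ρ₂ : Rep U' Y n}
    {ρ₁' : Rep U Y m} {ρ₂' : Rep U' Y m} (h : ρ₂ = ρ₁.map f) (h' : ρ₂' = ρ₁'.map f)
    {a₁ : Matrix (Fin m) (Fin n) Γ(U.left, ⊤)} {a₂ : Matrix (Fin m) (Fin n) Γ(U'.left, ⊤)}
    (ha : a₂ = a₁.map f.left.appTop) (h₁ h₂) :
    ρ₁.σ f h ≫ (pushforward (prodMap f Y)).map (matHom ρ₂ ρ₂' a₂ h₂) =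
      matHom ρ₁ ρ₁' a₁ h₁ ≫ ρ₁'.σ f h' := mod_hom_ext fun i ↦ by
  have e₁ : (ρ₁'.σ f h').app ⊤ (comb (prodFst U Y).appTop.hom a₁ ρ₁'.gen i) =
      (show Γ(ρ₂'.mod, ⊤) from comb (prodFst U' Y).appTop.hom a₂ ρ₂'.gen i) := by
    subst ha
    rw [app_comb]
    refine Finset.sum_congr rfl fun j _ ↦ ?_
    refine (congrArg (fun y : Γ((pushforward (prodMap f Y)).obj ρ₂'.mod, ⊤) ↦
      (prodFst U Y).appTop (a₁ j i) • y) (σ_gen f h' j)).trans ?_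
    exact congrArg (fun y : Γ(prod U' Y, ⊤) ↦ y • ρ₂'.gen j) (prodFst_appTop_prodMap f (a₁ j i))
  have e₂ := (congrArg ((matHom ρ₂ ρ₂' a₂ h₂).app ⊤) (σ_gen f h i)).trans (matHom_gen ρ₂ ρ₂' a₂ h₂ i)
  have e₃ := (congrArg ((ρ₁'.σ f h').app ⊤) (matHom_gen ρ₁ ρ₁' a₁ h₁ i)).trans e₁
  exact e₂.trans e₃.symm

lemma σ_heq {U' : Over S} (f : U' ⟶ U) {ρ₁ ρ₂ : Rep U Y n} (e : ρ₁ = ρ₂)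
    {ρ₁' ρ₂' : Rep U' Y n} (e' : ρ₁' = ρ₂') (h₁ : ρ₁' = ρ₁.map f) (h₂ : ρ₂' = ρ₂.map f) :
    ρ₁.σ f h₁ ≍ ρ₂.σ f h₂ := by
  subst e e'
  rfl

/-- Here and in `σ_comp`, σ sends generators to generators and the comparison isomorphisms leave
sections unchanged, so the identity is seen on generators. -/
lemma σ_id {ρ : Rep U Y n} (h : ρ = ρ.map (𝟙 U)) :
    ρ.σ (𝟙 U) h ≫ (pushforwardCongr (prodMap_id U Y)).hom.app ρ.mod ≫
      (pushforwardId _).hom.app ρ.mod = 𝟙 ρ.mod := mod_hom_ext fun i ↦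
  (app_comp_pushforwardId (prodMap_id U Y) (ρ.σ (𝟙 U) h) (ρ.gen i)).trans (σ_gen (𝟙 U) h i)

lemma σ_comp {U'' U' : Over S} {ρ : Rep U Y n} {ρ' : Rep U' Y n} {ρ'' : Rep U'' Y n}
    (f₁ : U'' ⟶ U') (f : U' ⟶ U) (g : U'' ⟶ U) (e : f₁ ≫ f = g) (h : ρ' = ρ.map f)
    (h₁ : ρ'' = ρ'.map f₁) (h₂ : ρ'' = ρ.map g) :
    ρ.σ g h₂ = ρ.σ f h ≫ (pushforward (prodMap f Y)).map (ρ'.σ f₁ h₁) ≫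
        (pushforwardComp (prodMap f₁ Y) (prodMap f Y)).hom.app ρ''.mod ≫
        (pushforwardCongr (by rw [← e, prodMap_comp])).hom.app ρ''.mod := mod_hom_ext fun i ↦ by
  have e₁ := σ_gen g h₂ i
  have e₂ := σ_gen f h i
  have e₃ := σ_gen f₁ h₁ i
  rw [e₁]
  change _ = mres ρ''.mod _ (Hom.app (ρ'.σ f₁ h₁) _ (Hom.app (ρ.σ f h) ⊤ (ρ.gen i)))
  rw [e₂]
  exact (mres_self _ le_rfl _).symm.trans (congrArg _ e₃.symm)

end Rep

variable {S : Scheme.{u}} {X Y : Over S}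

instance [IsLocallyNoetherian X.left] (U : Sch X) : IsLocallyNoetherian U.left.left :=
  have := U.locallyOfFiniteType
  LocallyOfFiniteType.isLocallyNoetherian U.hom.left

namespace BigBimodule

section OfRep

lemma mat_map_mul {A B : MatRep X Y} (f : A ⟶ B) {U : Over S} (u : U ⟶ X) (b : Γ(Y.left, ⊤)) :
    (MatRep.mat f).map u.left.appTop * (A.rep.map u).toHom b =
      (B.rep.map u).toHom b * (MatRep.mat f).map u.left.appTop := by
  rw [Rep.map_toHom, Rep.map_toHom, ← Matrix.map_mul, ← Matrix.map_mul, MatRep.mat_comm]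

/-- The morphism of modules over `U` given by a morphism of matrix representations. -/
def ofMatHom {A B : MatRep X Y} (f : A ⟶ B) {U : Over S} (u : U ⟶ X) :
    (A.rep.map u).mod ⟶ (B.rep.map u).mod :=
  Rep.matHom _ _ ((MatRep.mat f).map u.left.appTop) (mat_map_mul f u)

lemma ofMatHom_gen {A B : MatRep X Y} (f : A ⟶ B) {U : Over S} (u : U ⟶ X) (i : Fin A.n) :
    (ofMatHom f u).app ⊤ ((A.rep.map u).gen i) =
      comb (prodFst U Y).appTop.hom ((MatRep.mat f).map u.left.appTop) (B.rep.map u).gen i :=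
  Rep.matHom_gen _ _ _ _ i

variable [IsAffine S] [IsAffine Y.left] [IsLocallyNoetherian X.left]

/-- The big bimodule of a matrix representation. -/
def ofMat (A : MatRep X Y) : BigBimodule X Y where
  obj U := (A.rep.map U.hom).mod
  isBimodule U := (A.rep.map U.hom).isBimodule
  σ {U' U} f w := (A.rep.map U.hom).σ f (by rw [← Rep.map_comp, w])
  σ_id U := Rep.σ_id _
  isIso_τ f w := Rep.isIso_τ f _
  σ_comp f₁ w₁ f w g e := Rep.σ_comp f₁ f g e _ _ _

variable (X Y) in
/-- The functor from matrix representations to big bimodules. -/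
def ofMatFunctor : MatRep X Y ⥤ BigBimodule X Y where
  obj A := ofMat A
  map f := ofMatHom f (𝟙 X)
  map_id A := Rep.mod_hom_ext (ρ := A.rep.map (𝟙 X)) fun i ↦ by
    refine (ofMatHom_gen (𝟙 A) (𝟙 X) i).trans ?_
    exact congr_fun (A.rep.map (𝟙 X)).isSolution_gen.comb_one i
  map_comp {A B C} f g := Rep.mod_hom_ext (ρ := A.rep.map (𝟙 X)) fun i ↦ by
    refine (ofMatHom_gen (f ≫ g) (𝟙 X) i).trans ?_
    change _ = (ofMatHom g (𝟙 X)).app ⊤ ((ofMatHom f (𝟙 X)).app ⊤ _)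
    rw [ofMatHom_gen, Rep.app_comb]
    simp only [ofMatHom_gen]
    rw [MatRep.mat_comp, Matrix.map_mul, comb_mul]

instance : (ofMatFunctor X Y).Additive where
  map_add {A B f g} := by
    refine Rep.mod_hom_ext (ρ := A.rep.map (𝟙 X)) (N := (B.rep.map (𝟙 X)).mod)
      (f := ofMatHom (f + g) (𝟙 X)) (g := ofMatHom f (𝟙 X) + ofMatHom g (𝟙 X)) fun i ↦ ?_
    refine (ofMatHom_gen (f + g) (𝟙 X) i).trans (Eq.trans ?_
      (congrArg₂ (· + ·) (ofMatHom_gen f (𝟙 X) i) (ofMatHom_gen g (𝟙 X) i)).symm)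
    rw [MatRep.mat_add, Matrix.map_add _ (map_add _), comb_add]
    rfl

/-- The induced morphism over `U` is characterised by compatibility with σ (`homAt_unique`), and the
morphism of the pulled back matrix has this compatibility. -/
lemma homAt_ofMatFunctor_map {A B : MatRep X Y} (f : A ⟶ B) (U : Sch X) :
    homAt ((ofMatFunctor X Y).map f) U = ofMatHom f U.hom := by
  symm
  exact homAt_unique (P := ofMat A) (Q := ofMat B) _ U _ (Rep.σ_matHom U.hom
    (by rw [← Rep.map_comp, Category.comp_id]) (by rw [← Rep.map_comp, Category.comp_id]) (by
    rw [Matrix.map_map]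
    rfl) (mat_map_mul f (𝟙 X)) (mat_map_mul f U.hom))

/-- Every component is built from the representation pulled back to `U`, and pulling back in two
steps equals pulling back along the composite. Hence the two functors are equal. -/
lemma pull_comp_ofMatFunctor {X' : Over S} [IsLocallyNoetherian X'.left] (g : X' ⟶ X)
    [LocallyOfFiniteType g.left] [QuasiCompact g.left] :
    MatRep.pull g Y ⋙ ofMatFunctor X' Y = ofMatFunctor X Y ⋙ pull g Y := by
  refine Functor.hext (fun A ↦ ext' (fun U ↦ ?_) fun U' U f w ↦ ?_) fun A B f ↦ ?_
  · exact congrArg Rep.mod (Rep.map_comp A.rep U.hom g).symm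
  · exact Rep.σ_heq f (Rep.map_comp A.rep U.hom g).symm (Rep.map_comp A.rep U'.hom g).symm
      (by rw [← w, Rep.map_comp]) (by rw [← Rep.map_comp, ← Category.assoc, w])
  · refine HEq.trans ?_ (heq_of_eq (homAt_ofMatFunctor_map f ((Sch.self X').map g)).symm)
    refine Rep.matHom_congr (Rep.map_comp A.rep (𝟙 X') g).symm
      (Rep.map_comp B.rep (𝟙 X') g).symm ?_
      (mat_map_mul ((MatRep.pull g Y).map f) (𝟙 X')) (mat_map_mul f (𝟙 X' ≫ g))
    exact (Matrix.map_map (M := MatRep.mat f) (f := g.left.appTop)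
      (g := (Over.Hom.left (𝟙 X')).appTop)).trans rfl

end OfRep

end BigBimodule

end

end KCorr

/-! ### Direct sums of big bimodules -/

namespace KCorr

noncomputable section

open Scheme.Modules

section SigmaBiprod

variable {X' X : Scheme.{u}} (g : X' ⟶ X) {P Q : X.Modules} {P' Q' : X'.Modules}
  (s : P ⟶ (pushforward g).obj P') (t : Q ⟶ (pushforward g).obj Q')

/-- The direct sum of two morphisms to direct images. -/
def biprodσ : P ⊞ Q ⟶ (pushforward g).obj (P' ⊞ Q') :=
  biprod.desc (s ≫ (pushforward g).map biprod.inl) (t ≫ (pushforward g).map biprod.inr)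

lemma inl_biprodσ : biprod.inl ≫ biprodσ g s t = s ≫ (pushforward g).map biprod.inl :=
  biprod.inl_desc _ _

lemma inr_biprodσ : biprod.inr ≫ biprodσ g s t = t ≫ (pushforward g).map biprod.inr :=
  biprod.inr_desc _ _

lemma inl_biprodσ_assoc {R : X.Modules} (r : (pushforward g).obj (P' ⊞ Q') ⟶ R) :
    biprod.inl ≫ biprodσ g s t ≫ r = s ≫ (pushforward g).map biprod.inl ≫ r := by
  rw [← Category.assoc, inl_biprodσ, Category.assoc]

lemma inr_biprodσ_assoc {R : X.Modules} (r : (pushforward g).obj (P' ⊞ Q') ⟶ R) :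
    biprod.inr ≫ biprodσ g s t ≫ r = t ≫ (pushforward g).map biprod.inr ≫ r := by
  rw [← Category.assoc, inr_biprodσ, Category.assoc]

/-- In the universal form of `isIso_homEquiv_symm_iff` the claim splits, since a morphism out of a
direct sum is a pair of morphisms. -/
lemma isIso_biprodσ (hs : IsIso (((pullbackPushforwardAdjunction g).homEquiv _ _).symm s))
    (ht : IsIso (((pullbackPushforwardAdjunction g).homEquiv _ _).symm t)) :
    IsIso (((pullbackPushforwardAdjunction g).homEquiv _ _).symm (biprodσ g s t)) := by
  rw [isIso_homEquiv_symm_iff] at hs ht ⊢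
  refine fun N ↦ ⟨fun β β' h ↦ biprod.hom_ext' _ _ ((hs N).1 ?_) ((ht N).1 ?_), fun γ ↦ ?_⟩
  · have := congr(biprod.inl ≫ $h)
    simpa [inl_biprodσ_assoc, inr_biprodσ_assoc] using this
  · have := congr(biprod.inr ≫ $h)
    simpa [inl_biprodσ_assoc, inr_biprodσ_assoc] using this
  · obtain ⟨β, hβ⟩ := (hs N).2 (biprod.inl ≫ γ)
    obtain ⟨β', hβ'⟩ := (ht N).2 (biprod.inr ≫ γ)
    refine ⟨biprod.desc β β', biprod.hom_ext' _ _ ?_ ?_⟩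
    · dsimp only at hβ ⊢
      rw [inl_biprodσ_assoc, ← Functor.map_comp, biprod.inl_desc, hβ]
    · dsimp only at hβ' ⊢
      rw [inr_biprodσ_assoc, ← Functor.map_comp, biprod.inr_desc, hβ']

end SigmaBiprod

variable {S : Scheme.{u}} {X Y : Over S}

namespace BigBimodule

variable [IsAffine S] [IsAffine Y.left] [IsLocallyNoetherian X.left]

/-- The direct sum of big bimodules. -/
def sum (P Q : BigBimodule X Y) : BigBimodule X Y where
  obj U := P.obj U ⊞ Q.obj U
  isBimodule U := (P.isBimodule U).biprod (Q.isBimodule U)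
  σ f w := biprodσ (prodMap f Y) (P.σ f w) (Q.σ f w)
  σ_id U := by
    apply biprod.hom_ext'
    · have n₁ := (pushforwardCongr (prodMap_id U.left Y)).hom.naturality
        (biprod.inl : P.obj U ⟶ P.obj U ⊞ Q.obj U)
      have n₂ := (pushforwardId _).hom.naturality (biprod.inl : P.obj U ⟶ P.obj U ⊞ Q.obj U)
      rw [inl_biprodσ_assoc, reassoc_of% n₁, n₂, reassoc_of% (P.σ_id U), Category.comp_id]
      rfl
    · have n₁ := (pushforwardCongr (prodMap_id U.left Y)).hom.naturality
        (biprod.inr : Q.obj U ⟶ P.obj U ⊞ Q.obj U)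
      have n₂ := (pushforwardId _).hom.naturality (biprod.inr : Q.obj U ⟶ P.obj U ⊞ Q.obj U)
      rw [inr_biprodσ_assoc, reassoc_of% n₁, n₂, reassoc_of% (Q.σ_id U), Category.comp_id]
      rfl
  isIso_τ f w := isIso_biprodσ _ _ _ (P.isIso_τ f w) (Q.isIso_τ f w)
  σ_comp {U'' U' U} f₁ w₁ f w h e := by
    apply biprod.hom_ext'
    · have n₁ := (pushforwardComp (prodMap f₁ Y) (prodMap f Y)).hom.naturality
        (biprod.inl : P.obj U'' ⟶ P.obj U'' ⊞ Q.obj U'')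
      have n₂ := (pushforwardCongr (f := prodMap f₁ Y ≫ prodMap f Y) (g := prodMap h Y)
        (by rw [← e, prodMap_comp])).hom.naturality
        (biprod.inl : P.obj U'' ⟶ P.obj U'' ⊞ Q.obj U'')
      dsimp only [Functor.comp_map] at n₁
      rw [inl_biprodσ, inl_biprodσ_assoc, ← Functor.map_comp_assoc, inl_biprodσ,
        Functor.map_comp_assoc, reassoc_of% n₁, n₂, P.σ_comp f₁ w₁ f w h e]
      simp only [Category.assoc]
    · have n₁ := (pushforwardComp (prodMap f₁ Y) (prodMap f Y)).hom.naturality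
        (biprod.inr : Q.obj U'' ⟶ P.obj U'' ⊞ Q.obj U'')
      have n₂ := (pushforwardCongr (f := prodMap f₁ Y ≫ prodMap f Y) (g := prodMap h Y)
        (by rw [← e, prodMap_comp])).hom.naturality
        (biprod.inr : Q.obj U'' ⟶ P.obj U'' ⊞ Q.obj U'')
      dsimp only [Functor.comp_map] at n₁
      rw [inr_biprodσ, inr_biprodσ_assoc, ← Functor.map_comp_assoc, inr_biprodσ,
        Functor.map_comp_assoc, reassoc_of% n₁, n₂, Q.σ_comp f₁ w₁ f w h e]
      simp only [Category.assoc]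

/-- The direct sum as a bicone. -/
def bicone (P Q : BigBimodule X Y) : BinaryBicone P Q where
  pt := sum P Q
  fst := (biprod.fst : P.obj (Sch.self X) ⊞ Q.obj (Sch.self X) ⟶ _)
  snd := (biprod.snd : P.obj (Sch.self X) ⊞ Q.obj (Sch.self X) ⟶ _)
  inl := (biprod.inl : _ ⟶ P.obj (Sch.self X) ⊞ Q.obj (Sch.self X))
  inr := (biprod.inr : _ ⟶ P.obj (Sch.self X) ⊞ Q.obj (Sch.self X))
  inl_fst := biprod.inl_fst (X := P.obj (Sch.self X)) (Y := Q.obj (Sch.self X))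
  inl_snd := biprod.inl_snd (X := P.obj (Sch.self X)) (Y := Q.obj (Sch.self X))
  inr_fst := biprod.inr_fst (X := P.obj (Sch.self X)) (Y := Q.obj (Sch.self X))
  inr_snd := biprod.inr_snd (X := P.obj (Sch.self X)) (Y := Q.obj (Sch.self X))

instance : HasBinaryBiproducts (BigBimodule X Y) where
  has_binary_biproduct P Q := hasBinaryBiproduct_of_total (bicone P Q)
    (biprod.total (X := P.obj (Sch.self X)) (Y := Q.obj (Sch.self X)))

instance : HasZeroObject (BigBimodule X Y) where
  zero := (HasZeroObject.zero (C := MatRep X Y)).imp' (ofMatFunctor X Y).obj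
    fun _ h ↦ (ofMatFunctor X Y).map_isZero h

lemma hasFiniteBiproducts : HasFiniteBiproducts (BigBimodule X Y) :=
  have : HasFiniteProducts (BigBimodule X Y) := hasFiniteProducts_of_has_binary_and_terminal
  HasFiniteBiproducts.of_hasFiniteProducts

end BigBimodule

end

end KCorr

/-! ### Isomorphisms and nilpotent actions detected on sections -/

namespace KCorr
noncomputable section
open Scheme.Modules

section IsoOfTop

variable {X : Scheme.{u}} {M N : X.Modules} {V : X.Opens}

/-- Over the principal open of `r` the map is the localization at `r` of the map over `V`, so
bijectivity is inherited. -/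
lemma IsLoc.bijective_app (hM : IsLoc M V) (hN : IsLoc N V) (f : M ⟶ N)
    (h : Function.Bijective (f.app V)) (r : Γ(X, V)) :
    Function.Bijective (f.app (X.basicOpen r)) := by
  have hu (n : ℕ) : IsUnit (fres X (X.basicOpen_le r) r ^ n) :=
    (isUnit_fres_basicOpen r le_rfl).pow n
  refine ⟨(injective_iff_map_eq_zero _).2 fun x hx ↦ ?_, fun y ↦ ?_⟩
  · obtain ⟨n, t, ht⟩ := hM.exists_lift r (X.basicOpen_le r) rfl x
    obtain ⟨m, hm⟩ := hN.exists_pow r (X.basicOpen_le r) rfl (f.app V t) (by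
      rw [mres_app, ht, Hom.app_smul, hx, smul_zero])
    rw [← Hom.app_smul, map_eq_zero_iff _ h.1] at hm
    have := congr(mres M (X.basicOpen_le r) $hm)
    rw [mres_smul, map_zero, map_pow, (hu m).smul_eq_zero, ht, (hu n).smul_eq_zero] at this
    exact this
  · obtain ⟨n, t, ht⟩ := hN.exists_lift r (X.basicOpen_le r) rfl y
    obtain ⟨t, rfl⟩ := h.2 t
    obtain ⟨u, hu⟩ := hu n
    refine ⟨(↑u⁻¹ : Γ(X, X.basicOpen r)) • mres M (X.basicOpen_le r) t, ?_⟩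
    rw [Hom.app_smul, ← mres_app, ht, ← hu, smul_smul, Units.inv_mul, one_smul]

/-- Morphisms of quasi-coherent modules on an affine scheme are detected on global sections. -/
lemma isIso_of_bijective_app_top [IsAffine X] [M.IsQuasicoherent] [N.IsQuasicoherent] (f : M ⟶ N)
    (h : Function.Bijective (f.app ⊤)) : IsIso f := by
  rw [← isIso_iff_of_reflects_iso _ (toPresheaf X)]
  let φ : (⟨M.presheaf, M.isSheaf⟩ : TopCat.Sheaf Ab.{u} X) ⟶ ⟨N.presheaf, N.isSheaf⟩ :=
    ⟨f.mapPresheaf⟩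
  have hφ : IsIso φ := TopCat.Sheaf.isIso_iff_isIso_basis (isBasis_basicOpen X) fun r ↦
    (ConcreteCategory.isIso_iff_bijective (f.app (X.basicOpen r))).2
      ((isLoc_of_isQuasicoherent (isAffineOpen_top X) M).bijective_app
        (isLoc_of_isQuasicoherent (isAffineOpen_top X) N) f h r)
  exact ((TopCat.Sheaf.forget Ab.{u} X).mapIso (@asIso _ _ _ _ φ hφ)).isIso_hom

lemma eq_zero_of_forall_not_nontrivial (s : Γ(M, V))
    (h : ∀ x ∈ V, ¬ Nontrivial (M.presheaf.stalk x)) : s = 0 :=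
  TopCat.Presheaf.section_ext (⟨M.presheaf, M.isSheaf⟩ : TopCat.Sheaf Ab.{u} X) V s 0 fun x hx ↦ by
    have := not_nontrivial_iff_subsingleton.1 (h x hx)
    exact Subsingleton.elim (α := M.presheaf.stalk x) _ _

lemma disjoint_basicOpen_of_mem (A : Closeds X) (V : X.affineOpens) {c : Γ(X, V.1)}
    (hc : c ∈ (Scheme.IdealSheafData.vanishingIdeal A).ideal V) {x : X} (hx : x ∈ X.basicOpen c) :
    x ∉ A := fun hxA ↦ by
  have h : x ∈ (Scheme.IdealSheafData.vanishingIdeal A).support :=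
    Scheme.IdealSheafData.le_support_iff_le_vanishingIdeal.2 le_rfl hxA
  rw [Scheme.IdealSheafData.mem_support_iff_of_mem (X.basicOpen_le c hx),
    Scheme.mem_zeroLocus_iff] at h
  exact h c hc hx

/-- Functions vanishing on the support act nilpotently. -/
lemma exists_pow_smul_eq_zero [M.IsQuasicoherent] (V : X.affineOpens) {c : Γ(X, V.1)}
    (hc : c ∈ (Scheme.IdealSheafData.vanishingIdeal (suppClosure M)).ideal V) (t : Γ(M, V.1)) :
    ∃ n : ℕ, c ^ n • t = 0 :=
  (isLoc_of_isQuasicoherent V.2 M).exists_pow c (X.basicOpen_le c) rfl t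
    (eq_zero_of_forall_not_nontrivial _ fun _ hx hn ↦
      disjoint_basicOpen_of_mem _ V hc hx (subset_closure hn))

end IsoOfTop

/-- The support carries its reduced structure, so functions vanishing on it act only nilpotently on
the module. Integrality still passes from functions on the support to the quotient of `C` by the
annihilator, which is of finite type and hence finite over `R`. -/
lemma finite_of_exists_pow {R C D N : Type*} [CommRing R] [CommRing C] [CommRing D] [Algebra R C]
    [Algebra.FiniteType R C] [AddCommGroup N] [Module R N] [Module C N] [IsScalarTower R C N]
    [Module.Finite C N] (q : C →+* D) (hq : (q.comp (algebraMap R C)).IsIntegral)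
    (h : ∀ c, q c = 0 → ∀ t : N, ∃ n : ℕ, c ^ n • t = 0) : Module.Finite R N := by
  obtain ⟨s, hs⟩ := Module.Finite.fg_top (R := C) (M := N)
  have hann (c : C) (hc : q c = 0) : ∃ n : ℕ, c ^ n ∈ Module.annihilator C N := by
    choose n hn using h c hc
    refine ⟨∑ t ∈ s, n t, Module.mem_annihilator.2 fun x ↦ ?_⟩
    have hx : x ∈ Submodule.span C (s : Set N) := hs ▸ trivial
    induction hx using Submodule.span_induction with
    | mem x hx =>
      obtain ⟨l, hl⟩ := Nat.exists_eq_add_of_le (Finset.single_le_sum (fun i _ ↦ Nat.zero_le (n i))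
        (Finset.mem_coe.1 hx))
      rw [hl, add_comm, pow_add, mul_smul, hn, smul_zero]
    | zero => exact smul_zero _
    | add x y _ _ hx hy => rw [smul_add, hx, hy, add_zero]
    | smul a x _ hx => rw [smul_comm, hx, smul_zero]
  let := Module.quotientAnnihilator (R := C) (M := N)
  have htower : IsScalarTower C (C ⧸ Module.annihilator C N) N :=
    ⟨fun a b x ↦ by
      obtain ⟨b, rfl⟩ := Ideal.Quotient.mk_surjective b
      exact mul_smul a b x⟩
  have htower' : IsScalarTower R (C ⧸ Module.annihilator C N) N := ⟨fun a b x ↦ by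
    rw [← algebraMap_smul C a b, ← algebraMap_smul C a (b • x), smul_assoc]⟩
  have hint : Algebra.IsIntegral R (C ⧸ Module.annihilator C N) := ⟨fun c ↦ by
    obtain ⟨c, rfl⟩ := Ideal.Quotient.mk_surjective c
    -- A monic equation for the image in `D` puts p(c) into the kernel of `q`. A power of p(c) then
    -- annihilates the module, and the same power of `p` is a monic equation for `c` modulo the
    -- annihilator.
    obtain ⟨p, hp, hpc⟩ := hq (q c)
    obtain ⟨n, hn⟩ := hann (Polynomial.eval₂ (algebraMap R C) c p) (by
      rw [Polynomial.hom_eval₂, hpc])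
    refine ⟨p ^ n, hp.pow n, ?_⟩
    rw [Polynomial.eval₂_pow, ← Ideal.Quotient.eq_zero_iff_mem.2 hn, map_pow,
      Polynomial.hom_eval₂]
    rfl⟩
  have : Module.Finite R (C ⧸ Module.annihilator C N) := Algebra.IsIntegral.finite
  have : Module.Finite (C ⧸ Module.annihilator C N) N := Module.Finite.of_restrictScalars_finite C _ _
  exact Module.Finite.trans (C ⧸ Module.annihilator C N) N
end
end KCorr

/-! ### Full faithfulness over an affine scheme -/

namespace KCorr

noncomputable section

open Scheme.Modules

namespace Rep

variable {S : Scheme.{u}} {U Y : Over S} {m n : ℕ}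

lemma comb_gen_eq_pushSec (ρ : Rep U Y n) (a : Matrix (Fin n) (Fin m) Γ(U.left, ⊤)) (i : Fin m) :
    comb (prodFst U Y).appTop.hom a ρ.gen i =
      (show Γ(ρ.mod, ⊤) from ρ.pushSec ⊤ fun j ↦ a j i) :=
  Finset.sum_congr rfl fun j _ ↦ congrArg (fun y : Γ(ρ.mod, ⊤) ↦ (prodFst U Y).appTop (a j i) • y)
    (mres_self ρ.mod le_rfl (ρ.gen j)).symm

variable [IsAffine S] [IsAffine Y.left] [IsAffine U.left]

lemma extend_top_one (ρ : Rep U Y n) :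
    ρ.extend (isAffineOpen_top U.left) 1 = ρ.toHom 1 := by
  rw [extend_one]
  exact map_res_top _

/-- By `pushSec_eq_zero_iff`, the only relations with coefficients from `U` among the generators are
those killed by ρ(1). -/
lemma comb_gen_eq_iff (ρ : Rep U Y n) (a a' : Matrix (Fin n) (Fin m) Γ(U.left, ⊤)) :
    comb (prodFst U Y).appTop.hom a ρ.gen = comb (prodFst U Y).appTop.hom a' ρ.gen ↔
      ρ.toHom 1 * a = ρ.toHom 1 * a' := by
  have key (i : Fin m) : comb (prodFst U Y).appTop.hom a ρ.gen i =
      comb (prodFst U Y).appTop.hom a' ρ.gen i ↔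
        ∀ k, (ρ.toHom 1 * a) k i = (ρ.toHom 1 * a') k i := by
    rw [comb_gen_eq_pushSec, comb_gen_eq_pushSec, ← sub_eq_zero]
    refine Iff.trans (iff_of_eq (congrArg (· = 0)
      (map_sub (ρ.pushSec ⊤) (fun j ↦ a j i) fun j ↦ a' j i).symm)) ?_
    refine (ρ.pushSec_eq_zero_iff (isAffineOpen_top _) _).trans ?_
    rw [extend_top_one, Matrix.mulVec_sub, sub_eq_zero, funext_iff]
    rfl
  rw [funext_iff, ← Matrix.ext_iff]
  simp only [key]
  exact forall_comm

/-- Coefficients for the images of the generators exist by surjectivity of `pushSec`. Multiplying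
them by ρ'(1) makes them unique without changing the combinations, and linearity of `φ` over
functions on `Y` becomes the intertwining relation. -/
lemma exists_matrix (ρ : Rep U Y n) (ρ' : Rep U Y m) (φ : ρ.mod ⟶ ρ'.mod) :
    ∃ a : Matrix (Fin m) (Fin n) Γ(U.left, ⊤), ρ'.toHom 1 * a = a ∧
      (∀ b, a * ρ.toHom b = ρ'.toHom b * a) ∧
        ∀ i, φ.app ⊤ (ρ.gen i) = comb (prodFst U Y).appTop.hom a ρ'.gen i := by
  choose v hv using fun i ↦ ρ'.pushSec_surjective (isAffineOpen_top U.left)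
    (φ.app ⊤ (ρ.gen i) : Γ(ρ'.mod, ⊤))
  let a₀ : Matrix (Fin m) (Fin n) Γ(U.left, ⊤) := .of fun j i ↦ v i j
  have h₁ : ρ'.toHom 1 * (ρ'.toHom 1 * a₀) = ρ'.toHom 1 * a₀ := by
    rw [← Matrix.mul_assoc, ← map_mul, one_mul]
  have ha₀ (i : Fin n) : φ.app ⊤ (ρ.gen i) = comb (prodFst U Y).appTop.hom a₀ ρ'.gen i :=
    (hv i).symm.trans (ρ'.comb_gen_eq_pushSec a₀ i).symm
  have ha : (fun i ↦ φ.app ⊤ (ρ.gen i)) =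
      comb (prodFst U Y).appTop.hom (ρ'.toHom 1 * a₀) ρ'.gen :=
    (funext ha₀).trans ((ρ'.comb_gen_eq_iff _ _).2 h₁.symm)
  refine ⟨_, h₁, fun b ↦ ?_, congr_fun ha⟩
  have h₂ : ρ'.toHom 1 * (ρ'.toHom 1 * a₀ * ρ.toHom b) =
      ρ'.toHom 1 * (ρ'.toHom b * (ρ'.toHom 1 * a₀)) := by
    rw [← comb_gen_eq_iff, comb_mul, ← ha, comb_mul, ← ρ'.isSolution_gen, comb_smul, ← ha]
    funext i
    rw [← app_comb, ← ρ.isSolution_gen, Pi.smul_apply, Pi.smul_apply]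
    exact Hom.app_smul φ _ _
  rwa [← Matrix.mul_assoc, h₁, ← Matrix.mul_assoc, ← map_mul, one_mul] at h₂

end Rep

namespace BigBimodule

variable {S : Scheme.{u}} {X Y : Over S}

variable [IsAffine S] [IsAffine Y.left] [IsAffine X.left] [IsLocallyNoetherian X.left]

instance : (ofMatFunctor X Y).Faithful where
  map_injective {A B f g} h := by
    have h₁ : comb (prodFst X Y).appTop.hom (MatRep.mat f) (B.rep.map (𝟙 X)).gen =
        comb (prodFst X Y).appTop.hom (MatRep.mat g) (B.rep.map (𝟙 X)).gen := funext fun i ↦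
      (ofMatHom_gen f (𝟙 X) i).symm.trans (Eq.trans (congrArg (fun α ↦ Hom.app α ⊤ _) h)
        (ofMatHom_gen g (𝟙 X) i))
    rw [Rep.comb_gen_eq_iff] at h₁
    exact MatRep.hom_ext ((MatRep.one_mul_mat f).symm.trans (h₁.trans (MatRep.one_mul_mat g)))

instance : (ofMatFunctor X Y).Full where
  map_surjective {A B} α := by
    obtain ⟨a, h₁, h₂, h₃⟩ := Rep.exists_matrix (A.rep.map (𝟙 X)) (B.rep.map (𝟙 X)) α
    refine ⟨(⟨a, h₁, (h₂ 1).trans h₁, h₂⟩ : MatRep.Hom A B),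
      Rep.mod_hom_ext (ρ := A.rep.map (𝟙 X)) fun i ↦ ?_⟩
    exact (ofMatHom_gen (A := A) (B := B) (⟨a, h₁, (h₂ 1).trans h₁, h₂⟩ : MatRep.Hom A B)
      (𝟙 X) i).trans (h₃ i).symm

end BigBimodule

end

end KCorr

/-! ### Essential surjectivity over an affine scheme -/

namespace KCorr

noncomputable section

open Scheme.Modules

variable {S : Scheme.{u}} {U Y : Over S}

lemma prodSnd_appTop_appTop (r : Γ(S, ⊤)) : (prodSnd U Y).appTop (Y.hom.appTop r) =
    (prodFst U Y).appTop (U.hom.appTop r) := by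
  have : Y.hom.appTop ≫ (prodSnd U Y).appTop = U.hom.appTop ≫ (prodFst U Y).appTop := by
    rw [← Scheme.Hom.comp_appTop, ← Scheme.Hom.comp_appTop, pullback.condition]
  exact congr($this r)

namespace Rep

section OfSection

variable {n : ℕ} (M : (prod U Y).Modules)
  (π : (Fin n → Γ(U.left, ⊤)) →ₗ[Γ(U.left, ⊤)] Γ((pushforward (prodFst U Y)).obj M, ⊤))
  (s : Γ((pushforward (prodFst U Y)).obj M, ⊤) →ₗ[Γ(U.left, ⊤)] (Fin n → Γ(U.left, ⊤)))
  (h : ∀ x, π (s x) = x)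

/-- Multiplication by a function on `Y`. -/
def act (b : Γ(Y.left, ⊤)) : Γ((pushforward (prodFst U Y)).obj M, ⊤) →ₗ[Γ(U.left, ⊤)]
    Γ((pushforward (prodFst U Y)).obj M, ⊤) where
  toFun x := ((prodSnd U Y).appTop b • (show Γ(M, ⊤) from x) : Γ(M, ⊤))
  map_add' x y := smul_add ((prodSnd U Y).appTop b) (show Γ(M, ⊤) from x) (show Γ(M, ⊤) from y)
  map_smul' r x := smul_comm ((prodSnd U Y).appTop b) ((prodFst U Y).appTop r)
    (show Γ(M, ⊤) from x)

lemma act_apply (b : Γ(Y.left, ⊤)) (x : Γ((pushforward (prodFst U Y)).obj M, ⊤)) :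
    act M b x = ((prodSnd U Y).appTop b • (show Γ(M, ⊤) from x) : Γ(M, ⊤)) := rfl

/-- The action of functions on `Y` on a module whose direct image is a direct summand of a free
module. -/
def ofSection : Rep U Y n where
  toHom :=
    { toFun b := LinearMap.toMatrix' (s ∘ₗ act M b ∘ₗ π)
      map_zero' := by
        have : act M (0 : Γ(Y.left, ⊤)) = 0 := LinearMap.ext fun x ↦ by
          rw [act_apply, map_zero]
          exact zero_smul _ (show Γ(M, ⊤) from x)
        rw [this, LinearMap.zero_comp, LinearMap.comp_zero, map_zero]
      map_add' b b' := by
        have : act M (b + b') = act M b + act M b' := LinearMap.ext fun x ↦ by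
          rw [act_apply, map_add]
          exact add_smul _ _ (show Γ(M, ⊤) from x)
        rw [this, LinearMap.add_comp, LinearMap.comp_add, map_add]
      map_mul' b b' := by
        rw [← LinearMap.toMatrix'_mul]
        congr 1
        refine LinearMap.ext fun v ↦ congrArg s ?_
        -- Multiplicativity holds because π s = 1 cancels in the middle. The value at 1 is only the
        -- idempotent s π, which is why non-unital homomorphisms occur.
        change act M (b * b') (π v) = act M b (π (s (act M b' (π v))))
        rw [h, act_apply, map_mul]
        exact mul_smul _ _ (show Γ(M, ⊤) from π v) }
  map_smul r b := by
    change LinearMap.toMatrix' (s ∘ₗ act M _ ∘ₗ π) = _ • LinearMap.toMatrix' (s ∘ₗ act M b ∘ₗ π)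
    have : act M (Y.hom.appTop r * b) = U.hom.appTop r • act M b := LinearMap.ext fun x ↦ by
      rw [act_apply, map_mul]
      refine (mul_smul _ _ (show Γ(M, ⊤) from x)).trans ?_
      exact congrArg (fun c : Γ(prod U Y, ⊤) ↦
        c • ((prodSnd U Y).appTop b • (show Γ(M, ⊤) from x))) (prodSnd_appTop_appTop r)
    rw [this, LinearMap.smul_comp, LinearMap.comp_smul]
    exact LinearEquiv.map_smul _ _ _

lemma ofSection_mulVec (b : Γ(Y.left, ⊤)) (v : Fin n → Γ(U.left, ⊤)) :
    ((ofSection M π s h).toHom b).mulVec v = s (act M b (π v)) :=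
  LinearMap.toMatrix'_mulVec (s ∘ₗ act M b ∘ₗ π) v

lemma comb_single {m : ℕ} (a : Matrix (Fin n) (Fin m) Γ(U.left, ⊤)) (i : Fin m) :
    comb (prodFst U Y).appTop.hom a
      (fun j ↦ (show Γ(M, ⊤) from π (Pi.single j 1))) i = (show Γ(M, ⊤) from π (fun j ↦ a j i)) := by
  conv_rhs => rw [pi_eq_sum_univ' fun j ↦ a j i]
  refine Eq.trans ?_ (map_sum π _ _).symm
  refine Finset.sum_congr rfl fun j _ ↦ ?_
  refine Eq.trans ?_ (π.map_smul (a j i) _).symm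
  rfl

lemma isSolution_ofSection : (ofSection M π s h).IsSolution
    fun j ↦ (show Γ(M, ⊤) from π (Pi.single j 1)) := fun b ↦ by
  funext i
  rw [comb_single]
  have h₁ : (fun j ↦ (ofSection M π s h).toHom b j i) =
      ((ofSection M π s h).toHom b).mulVec (Pi.single i 1) :=
    (Matrix.mulVec_single_one _ i).symm
  rw [h₁, ofSection_mulVec, h]
  rfl

variable [IsAffine S] [IsAffine Y.left] [IsAffine U.left]

-- The images under π of the basis vectors solve the relations, which gives a morphism from the
-- module of s b π to `M`. On global sections both sides are the free module modulo the kernel of π,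
-- and on an affine scheme this suffices.
include h in
lemma exists_iso_of_section [M.IsQuasicoherent] : ∃ ρ : Rep U Y n, Nonempty (ρ.mod ≅ M) := by
  let ρ := ofSection M π s h
  let f : ρ.mod ⟶ M := desc (isSolution_ofSection M π s h)
  have hf (v) : f.app ⊤ (ρ.pushSec ⊤ v) = (show Γ(M, ⊤) from π v) := by
    have h₁ := ρ.comb_gen_eq_pushSec (Matrix.of fun j (_ : Fin 1) ↦ v j) 0
    refine (congrArg (f.app ⊤) h₁.symm).trans ?_
    rw [app_comb, funext fun j ↦ desc_gen (isSolution_ofSection M π s h) j]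
    exact comb_single M π (Matrix.of fun j (_ : Fin 1) ↦ v j) 0
  have : IsAffine (prod U Y) := isAffine_of_isAffineHom (prodFst U Y)
  have hb : Function.Bijective (f.app ⊤) := by
    refine ⟨(injective_iff_map_eq_zero _).2 fun x hx ↦ ?_, fun y ↦ ⟨ρ.pushSec ⊤ (s y), ?_⟩⟩
    · obtain ⟨v, rfl⟩ := ρ.pushSec_surjective (isAffineOpen_top U.left) x
      refine (ρ.pushSec_eq_zero_iff (isAffineOpen_top U.left) v).2 ?_
      rw [extend_top_one, ofSection_mulVec]
      have h₁ : π v = 0 := (hf v).symm.trans hx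
      rw [h₁, map_zero, map_zero]
    · exact (hf _).trans (h y)
  have := isIso_of_bijective_app_top f hb
  exact ⟨ρ, ⟨asIso f⟩⟩

end OfSection

end Rep

variable [IsAffine S] [IsAffine Y.left] [IsAffine U.left] [IsLocallyNoetherian U.left]
  [LocallyOfFiniteType (prodFst U Y)]

/-- Finiteness over `U` comes from finiteness of the support through `finite_of_exists_pow`.
Flatness comes from local freeness of the direct image, and over a noetherian ring finite flat
modules are projective. -/
lemma IsBimodule.finite_and_projective {M : (prod U Y).Modules} (hM : IsBimodule U Y M) :
    Module.Finite Γ(U.left, ⊤) Γ((pushforward (prodFst U Y)).obj M, ⊤) ∧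
      Module.Projective Γ(U.left, ⊤) Γ((pushforward (prodFst U Y)).obj M, ⊤) := by
  have := hM.isQuasicoherent
  have := hM.isFiniteType
  have := hM.isLocallyFree
  have : IsNoetherianRing Γ(U.left, ⊤) :=
    IsLocallyNoetherian.component_noetherian ⟨⊤, isAffineOpen_top _⟩
  have := flat_sections ((pushforward (prodFst U Y)).obj M) (isAffineOpen_top U.left)
  have hfin : Module.Finite Γ(U.left, ⊤) Γ((pushforward (prodFst U Y)).obj M, ⊤) := by
    let := (prodFst U Y).appTop.hom.toAlgebra
    let : Module Γ(prod U Y, ⊤) Γ((pushforward (prodFst U Y)).obj M, ⊤) :=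
      inferInstanceAs (Module Γ(prod U Y, ⊤) Γ(M, ⊤))
    have : IsScalarTower Γ(U.left, ⊤) Γ(prod U Y, ⊤) Γ((pushforward (prodFst U Y)).obj M, ⊤) :=
      ⟨fun a b x ↦ mul_smul ((prodFst U Y).appTop a) b (show Γ(M, ⊤) from x)⟩
    have hV := (isAffineOpen_top U.left).preimage (prodFst U Y)
    have : Module.Finite Γ(prod U Y, ⊤) Γ((pushforward (prodFst U Y)).obj M, ⊤) :=
      finite_sections M hV
    have : Algebra.FiniteType Γ(U.left, ⊤) Γ(prod U Y, ⊤) := by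
      have := (prodFst U Y).finiteType_appLE (isAffineOpen_top _) hV le_rfl
      rwa [← Scheme.Hom.app_eq_appLE] at this
    refine finite_of_exists_pow
      ((Scheme.IdealSheafData.vanishingIdeal (suppClosure M)).subschemeι.app ⊤).hom
      (finite_comp_app _ hM.isFinite_supp (isAffineOpen_top U.left)).to_isIntegral fun c hc t ↦ ?_
    exact exists_pow_smul_eq_zero (prodOpen U Y (isAffineOpen_top U.left))
      ((subschemeι_app_eq_zero_iff _ (isAffineOpen_top U.left) c).1 hc) t
  have := Module.finitePresentation_of_finite Γ(U.left, ⊤)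
    Γ((pushforward (prodFst U Y)).obj M, ⊤)
  exact ⟨hfin, Module.Flat.projective_of_finitePresentation⟩

lemma IsBimodule.exists_rep {M : (prod U Y).Modules} (hM : IsBimodule U Y M) :
    ∃ (n : ℕ) (ρ : Rep U Y n), Nonempty (ρ.mod ≅ M) := by
  have := hM.isQuasicoherent
  obtain ⟨_, _⟩ := hM.finite_and_projective
  obtain ⟨n, π, hπ⟩ := Module.Finite.exists_fin' Γ(U.left, ⊤)
    Γ((pushforward (prodFst U Y)).obj M, ⊤)
  obtain ⟨s, hs⟩ := Module.projective_lifting_property π LinearMap.id hπ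
  exact ⟨n, Rep.exists_iso_of_section M π s fun x ↦ congr($hs x)⟩

namespace BigBimodule

/-- An isomorphism of components over the base is an isomorphism of big bimodules. -/
def isoOfSelf {P Q : BigBimodule U Y} (e : P.obj (Sch.self U) ≅ Q.obj (Sch.self U)) : P ≅ Q where
  hom := e.hom
  inv := e.inv
  hom_inv_id := e.hom_inv_id
  inv_hom_id := e.inv_hom_id

instance : (ofMatFunctor U Y).EssSurj where
  mem_essImage P := by
    obtain ⟨n, ρ, ⟨e⟩⟩ := (P.isBimodule (Sch.self U)).exists_rep
    exact ⟨⟨n, ρ⟩, ⟨isoOfSelf (eqToIso (congrArg Rep.mod ρ.map_id) ≪≫ e)⟩⟩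

instance : (ofMatFunctor U Y).IsEquivalence where

end BigBimodule

end

end KCorr

theorem mainTheorem6 {k : Type u} [Field k] (Y : KCorr.Sm k) (hY : IsAffine Y.obj.left) :
    (∀ X : KCorr.Sm k, HasFiniteBiproducts (KCorr.Corr X.obj Y.obj)) ∧
    (∀ X : KCorr.Sm k, HasFiniteBiproducts (KCorr.BigBimodule X.obj Y.obj)) ∧
    (∃ 𝒜 : KCorr.AdditivePresheaf (fun X : KCorr.Sm k ↦ KCorr.Corr X.obj Y.obj),
      KCorr.IsCorrPresheaf 𝒜) ∧
    ∀ 𝒜 : KCorr.AdditivePresheaf (fun X : KCorr.Sm k ↦ KCorr.Corr X.obj Y.obj),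
      KCorr.IsCorrPresheaf 𝒜 →
      ∃ F : KCorr.AdditivePresheaf.Hom 𝒜 (KCorr.bigBimodules Y),
        ∀ X : KCorr.Sm k, IsAffine X.obj.left → (F.app X).IsEquivalence := by
  have hfst (X : KCorr.Sm k) : LocallyOfFiniteType (KCorr.prodFst X.obj Y.obj) := inferInstance
  refine ⟨fun X ↦ KCorr.Corr.hasFiniteBiproducts, fun X ↦ KCorr.BigBimodule.hasFiniteBiproducts,
    ⟨KCorr.corrPresheaf, KCorr.isCorrPresheaf_corrPresheaf⟩, fun 𝒜 h𝒜 ↦ ?_⟩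
  refine ⟨⟨fun X ↦ KCorr.Corr.toMat X.obj Y.obj ⋙ KCorr.BigBimodule.ofMatFunctor X.obj Y.obj,
    fun X ↦ inferInstance, fun {X' X} f ↦ ?_⟩, fun X hX ↦ ?_⟩
  · change 𝒜.map f ⋙ KCorr.Corr.toMat X'.obj Y.obj ⋙ KCorr.BigBimodule.ofMatFunctor X'.obj Y.obj =
      (KCorr.Corr.toMat X.obj Y.obj ⋙ KCorr.BigBimodule.ofMatFunctor X.obj Y.obj) ⋙
        KCorr.BigBimodule.pull f.hom Y.obj
    -- Naturality is strict on both sides of the intermediate category: first for 𝒜, by the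
    -- characterisation of its pullback functors, then for big bimodules.
    rw [← Functor.assoc, KCorr.Corr.comp_toMat_eq_of_isPullbackFunctor (h𝒜 f), Functor.assoc,
      KCorr.BigBimodule.pull_comp_ofMatFunctor, Functor.assoc]
  · change (KCorr.Corr.toMat X.obj Y.obj ⋙
      KCorr.BigBimodule.ofMatFunctor X.obj Y.obj).IsEquivalence
    infer_instance
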